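/- Let $r\ge 2$ (the basis) and $m\ge 1$ (the dimension) be integers, let $\Sigma_r=\{0,\dots,r-1\}$ and $S_r=\{0,r-1\}$, and let $\star\notin\Sigma_r$ be a separator. A Muller automaton $A=(Q,\Sigma,T,Q_0,\mathcal F)$ consists of a finite set $Q$ of states, a set $T\subseteq Q\times\Sigma\times Q$ of transitions, initial states $Q_0\subseteq Q$ and an accepting condition $\mathcal F\subseteq 2^{Q}$; it recognizes the set $L(A)$ of all infinite words that label an infinite path which starts in $Q_0$ and whose set of infinitely often visited states belongs to $\mathcal F$. An arithmetic automaton in basis $r$ and dimension $m$ is a (possibly nondeterministic) Muller automaton over $\Sigma_r\cup\{\star\}$ with $L(A)\subseteq S_r^m\star(\Sigma_r^m)^*\star\Sigma_r^\omega$. It symbolically represents the set $$X=\{\gamma(s,\sigma)-\lambda(w)\;:\; s\star\sigma\star w\in L(A)\}\subseteq\mathbb R^m,$$ where, for $1\le i\le m$ and $k=|\sigma|/m$, $$\gamma(s,\sigma)[i]=r^{k}\frac{s(i)}{1-r}+\sum_{j=1}^{k}r^{k-j}\sigma(m(j-1)+i),\qquad -\lambda(w)[i]=\sum_{j=0}^{\infty}\frac{w(mj+i)}{r^{j+1}}.$$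 **Theorem.** (1) For every arithmetic automaton in basis $r$ and dimension $m$, the closed convex hull $\overline{\mathrm{conv}}(X)$ of the set $X$ it represents is rational polyhedral, that is, of the form $\{x\in\mathbb R^m : Mx+v\le 0\}$ for a rational matrix $M$ and a rational vector $v$ (with finitely many rows). (2) It is computable in exponential time: there are one algorithm and one polynomial $p$ such that, for all $r\ge2$ and $m\ge1$ and every arithmetic automaton $A$ in basis $r$ and dimension $m$, the algorithm, given $r$, $m$ and $A$ (the number of states and the lists of transitions, of initial states and of accepting sets, with all numbers in binary), halts after at most $2^{p(N)}$ steps, where $N$ is the size of the input, and outputs a rational matrix $M$ and a rational vector $v$ (with entries in binary) such that $\overline{\mathrm{conv}}(X)=\{x\in\mathbb R^m : Mx+v\le 0\}$. -/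

import Mathlib

namespace ArithAutomata

/-! ### Muller automata -/

/-- A Muller automaton over the alphabet `α` with states in `Q` (nondeterministic, with several
initial states). -/
structure MullerAutomaton (α : Type*) (Q : Type*) where
  /-- the labelled transitions -/
  trans : Set (Q × α × Q)
  /-- the initial condition -/
  init : Set Q
  /-- the accepting condition -/
  acc : Set (Set Q)

namespace MullerAutomaton

variable {α Q : Type*}

/-- `ρ 0, ρ 1, …` are the successive states of an infinite path labelled by `w` that starts in an
initial state. -/
def IsRun (A : MullerAutomaton α Q) (w : Stream' α) (ρ : ℕ → Q) : Prop :=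
  ρ 0 ∈ A.init ∧ ∀ k, (ρ k, w.get k, ρ (k + 1)) ∈ A.trans

/-- The set of states that are visited infinitely often. -/
def infSet (ρ : ℕ → Q) : Set Q :=
  {q | ∃ᶠ k in Filter.atTop, ρ k = q}

/-- The language of infinite words recognized by a Muller automaton. -/
def language (A : MullerAutomaton α Q) : Set (Stream' α) :=
  {w | ∃ ρ : ℕ → Q, A.IsRun w ρ ∧ infSet ρ ∈ A.acc}

end MullerAutomaton

/-! ### Most significant digit first decompositions -/

/-- The alphabet of the `r`-digits together with the separator `⋆`, which is `none`. -/
abbrev Letter (r : ℕ) : Type := Option (Fin r)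

/-- The sign digits are `0` and `r - 1`. -/
def IsSignDigit {r : ℕ} (a : Fin r) : Prop :=
  (a : ℕ) = 0 ∨ (a : ℕ) = r - 1

/-- The infinite word `s ⋆ σ ⋆ w`, where `σ` consists of `k` blocks of `m` digits. -/
def msdWord {r m k : ℕ} (s : Fin m → Fin r) (σ : Fin k → Fin m → Fin r) (w : Stream' (Fin r)) :
    Stream' (Letter r) :=
  ((List.ofFn s).map some ++ none :: (((List.ofFn σ).flatMap List.ofFn).map some ++ [none]))
    ++ₛ w.map some

/-- The integer part `γ(s, σ)`: for the component `i` it is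
`r ^ k * s(i) / (1 - r) + ∑ r ^ (k - j) * σ(m (j - 1) + i)`, the sum over `1 ≤ j ≤ k`
(below, blocks and components are numbered from `0`). -/
noncomputable def gammaVec {r m k : ℕ} (s : Fin m → Fin r) (σ : Fin k → Fin m → Fin r) :
    Fin m → ℝ := fun i =>
  (r : ℝ) ^ k * ((s i : ℕ) : ℝ) / (1 - (r : ℝ))
    + ∑ j : Fin k, (r : ℝ) ^ (k - 1 - (j : ℕ)) * ((σ j i : ℕ) : ℝ)

/-- The opposite `λ(w)` of the decimal part: for the component `i` it is
`- ∑ w(m j + i) / r ^ (j + 1)`, the sum over all `j ≥ 0`. -/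
noncomputable def lambdaVec {r : ℕ} (m : ℕ) (w : Stream' (Fin r)) : Fin m → ℝ := fun i =>
  - ∑' j : ℕ, ((w.get (m * j + i) : ℕ) : ℝ) / (r : ℝ) ^ (j + 1)

/-- An arithmetic automaton in basis `r` and in dimension `m`: all words it recognizes are of the
form `s ⋆ σ ⋆ w`. -/
def MullerAutomaton.IsArithmetic {r : ℕ} {Q : Type*} (m : ℕ)
    (A : MullerAutomaton (Letter r) Q) : Prop :=
  ∀ u ∈ A.language, ∃ (s : Fin m → Fin r) (k : ℕ) (σ : Fin k → Fin m → Fin r)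
    (w : Stream' (Fin r)), (∀ i, IsSignDigit (s i)) ∧ u = msdWord s σ w

/-- The set of real vectors symbolically represented by an arithmetic automaton. -/
def MullerAutomaton.represented {r : ℕ} {Q : Type*} (m : ℕ)
    (A : MullerAutomaton (Letter r) Q) : Set (Fin m → ℝ) :=
  {x | ∃ (s : Fin m → Fin r) (k : ℕ) (σ : Fin k → Fin m → Fin r) (w : Stream' (Fin r)),
    (∀ i, IsSignDigit (s i)) ∧ msdWord s σ w ∈ A.language ∧ x = gammaVec s σ - lambdaVec m w}

/-! ### Rational polyhedral convex sets -/

/-- The set of real solutions of the rational system `M x + v ≤ 0`. -/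
def solutionSet {m n : ℕ} (M : Matrix (Fin n) (Fin m) ℚ) (v : Fin n → ℚ) : Set (Fin m → ℝ) :=
  {x | ∀ i, ∑ j, (M i j : ℝ) * x j + (v i : ℝ) ≤ 0}

/-- A set is rational polyhedral when it is the solution set of a finite system of linear
inequalities with rational coefficients. -/
def IsRationalPolyhedral {m : ℕ} (C : Set (Fin m → ℝ)) : Prop :=
  ∃ (n : ℕ) (M : Matrix (Fin n) (Fin m) ℚ) (v : Fin n → ℚ), C = solutionSet M v

/-! ### Programs and running time

The machine model is a `while` language on binary trees. Every instruction is charged the size of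
the whole tree it is applied to, so that a run of cost `t` only handles trees of size at most `t`
and that the model and Turing machines simulate each other with polynomial overhead. -/

/-- The data values: binary trees. -/
inductive Data : Type where
  | nil : Data
  | cons : Data → Data → Data
  deriving DecidableEq

namespace Data

/-- The number of nodes and leaves of a tree. -/
def size : Data → ℕ
  | nil => 1
  | cons a b => a.size + b.size + 1

/-- The left subtree. -/
def fst : Data → Data
  | nil => nil
  | cons a _ => a

/-- The right subtree. -/
def snd : Data → Data
  | nil => nil
  | cons _ b => b

/-- Truth values and bits: `false` is the leaf, `true` is the tree with one inner node. -/
def ofBool : Bool → Data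
  | false => nil
  | true => cons nil nil

/-- Finite lists. -/
def ofList : List Data → Data
  | [] => nil
  | a :: l => cons a (ofList l)

/-- Natural numbers, in binary (least significant bit first). -/
def ofNat (n : ℕ) : Data := ofList (n.bits.map ofBool)

/-- Integers: sign and absolute value. -/
def ofInt (z : ℤ) : Data := cons (ofBool (decide (z < 0))) (ofNat z.natAbs)

/-- Rational numbers: numerator and denominator of the reduced fraction. -/
def ofRat (q : ℚ) : Data := cons (ofInt q.num) (ofNat q.den)

/-- Letters: the separator `⋆` is the leaf. -/
def ofLetter {r : ℕ} : Letter r → Data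
  | none => nil
  | some a => cons (ofNat a) nil

/-- Rational systems of linear inequalities `M x + v ≤ 0`: the list of the rows. -/
def ofSystem {m n : ℕ} (M : Matrix (Fin n) (Fin m) ℚ) (v : Fin n → ℚ) : Data :=
  ofList (List.ofFn fun i => cons (ofList (List.ofFn fun j => ofRat (M i j))) (ofRat (v i)))

end Data

/-- Programs; each of them denotes a partial function from trees to trees. -/
inductive Prog : Type where
  | id : Prog
  | nil : Prog
  | fst : Prog
  | snd : Prog
  | eq : Prog
  | pair : Prog → Prog → Prog
  | comp : Prog → Prog → Prog
  | cond : Prog → Prog → Prog → Prog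
  | loop : Prog → Prog → Prog

/-- `Eval P x y t`: the program `P` halts on the input `x` with the output `y` in time `t`.
The leaf counts as false in tests, any other tree as true. -/
inductive Eval : Prog → Data → Data → ℕ → Prop where
  | id (x : Data) : Eval Prog.id x x x.size
  | nil (x : Data) : Eval Prog.nil x Data.nil x.size
  | fst (x : Data) : Eval Prog.fst x x.fst x.size
  | snd (x : Data) : Eval Prog.snd x x.snd x.size
  /-- are the two subtrees of the input equal? -/
  | eq (x : Data) : Eval Prog.eq x (Data.ofBool (decide (x.fst = x.snd))) (x.size + 2)
  /-- run both programs on the input and join their outputs -/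
  | pair {P P' : Prog} {x y y' : Data} {t t' : ℕ} :
      Eval P x y t → Eval P' x y' t' → Eval (Prog.pair P P') x (Data.cons y y') (t + t' + x.size)
  /-- run the second program, then run the first one on its output -/
  | comp {P P' : Prog} {x y z : Data} {t t' : ℕ} :
      Eval P' x y t → Eval P y z t' → Eval (Prog.comp P P') x z (t + t' + x.size)
  /-- if the test succeeds, run the first branch -/
  | cond_true {B P P' : Prog} {x b c y : Data} {t t' : ℕ} :
      Eval B x (Data.cons b c) t → Eval P x y t' → Eval (Prog.cond B P P') x y (t + t' + x.size)
  /-- if the test fails, run the second branch -/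
  | cond_false {B P P' : Prog} {x y : Data} {t t' : ℕ} :
      Eval B x Data.nil t → Eval P' x y t' → Eval (Prog.cond B P P') x y (t + t' + x.size)
  /-- leave a loop when its test fails -/
  | loop_done {B P : Prog} {x : Data} {t : ℕ} :
      Eval B x Data.nil t → Eval (Prog.loop B P) x x (t + x.size)
  /-- run the body of a loop and start again as long as its test succeeds -/
  | loop_step {B P : Prog} {x b c y z : Data} {t t' t'' : ℕ} :
      Eval B x (Data.cons b c) t → Eval P x y t' → Eval (Prog.loop B P) y z t'' →
      Eval (Prog.loop B P) x z (t + t' + t'' + x.size)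

/-! ### Automata as inputs of programs -/

/-- An explicit description, by lists, of a Muller automaton with digits in basis `r` and with
states `0, …, n - 1`. -/
structure AutomatonCode (r n : ℕ) where
  /-- the transitions -/
  trans : List (Fin n × Letter r × Fin n)
  /-- the initial states -/
  init : List (Fin n)
  /-- the accepting sets of states -/
  acc : List (List (Fin n))

/-- The automaton that is described. -/
def AutomatonCode.toMuller {r n : ℕ} (c : AutomatonCode r n) :
    MullerAutomaton (Letter r) (Fin n) where
  trans := {e | e ∈ c.trans}
  init := {q | q ∈ c.init}
  acc := {F | ∃ l ∈ c.acc, F = {q | q ∈ l}}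

/-- The input tree: the basis `r`, the dimension `m`, the number `n` of states (all in binary) and
the lists of transitions, of initial states and of accepting sets. -/
def AutomatonCode.toData {r n : ℕ} (m : ℕ) (c : AutomatonCode r n) : Data :=
  Data.ofList
    [Data.ofNat r, Data.ofNat m, Data.ofNat n,
      Data.ofList (c.trans.map fun e =>
        Data.cons (Data.ofNat e.1) (Data.cons (Data.ofLetter e.2.1) (Data.ofNat e.2.2))),
      Data.ofList (c.init.map fun q => Data.ofNat q),
      Data.ofList (c.acc.map fun l => Data.ofList (l.map fun q => Data.ofNat q))]

end ArithAutomata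

open ArithAutomata

namespace ArithAutomata

/-! ### Polynomial time on encoded types -/

/-! An affine form a·x + b is treated as the linear form (a, b) on pairs (V, h). The closed convex
hull of X is governed by integer pairs (`IsGen`) read off from a path to a cycle v at a state from
which acceptance is still possible. If v follows u in the integer part, the pair is the direction
(γ(s,uv) − γ(s,u), 0). If a nonempty v follows l⋆u, the pair is (γ(s,luv) − γ(s,lu), r^|uv| −
r^|u|), a positive multiple of the homogenised value of s⋆l⋆uv^ω.

A form that is nonpositive on X is nonpositive on every generator: otherwise pumping the cycle makes
it positive on some accepted word (`ev_nonpos_of_gen`). Conversely, with E the list of transitions,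
it is enough to be nonpositive on the generators of at most 2|E| + 1 blocks (`nonpos_of_gen`):
cycles are removed from the integer part, and each cycle in the fractional part contracts the
possible positive value by a factor of at least 2.

By Hahn–Banach, a point outside the hull is separated by a form that is valid on X, hence on the
generators. A vertex of the polar cone cut by a box, together with Cramer's rule, turns it into an
integer form with explicitly bounded coefficients (`exists_bounded_functional`). Finitely many
half-spaces therefore cut out the hull (`closure_convexHull_eq`), which gives rationality.

The algorithm is brute force: it enumerates all bounded integer forms and keeps those that pass the
test on all bounded paths. The exponents stay polynomial because every length is bounded through the
lists in the input and never through the number of states, which is written in binary. The dimension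
is binary too, but X is empty when it exceeds the number of transitions (`represented_eq_empty`).

For the running time, `PT` is a class of polynomial-time functions closed under the usual list
combinators. The algorithm is polynomial on an input padded with a complete binary tree of
exponential size, so enumerations and unary numbers are affordable; building the padding costs
exponential time (`exists_prog_of_pad`). Correctness is collected in `output_spec`. -/

theorem eval_poly_mono (p : Polynomial ℕ) {a b : ℕ} (h : a ≤ b) : p.eval a ≤ p.eval b := by
  rw [Polynomial.eval_eq_sum, Polynomial.eval_eq_sum]
  exact Finset.sum_le_sum fun i _ => Nat.mul_le_mul_left _ (Nat.pow_le_pow_left h _)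

theorem Data.size_pos (x : Data) : 1 ≤ x.size := by cases x <;> simp [Data.size]

theorem Data.size_fst_le (x : Data) : x.fst.size ≤ x.size := by
  cases x <;> simp [Data.size, Data.fst]; omega

theorem Data.size_snd_le (x : Data) : x.snd.size ≤ x.size := by
  cases x <;> simp [Data.size, Data.snd]; omega

/-- Since every instruction is charged for the trees it handles, a time bound is also a bound on the
output. This is what makes polynomial time stable under composition. -/
theorem Eval.size_le {P : Prog} {x y : Data} {t : ℕ} (h : Eval P x y t) : y.size ≤ t := by
  induction h with
  | id x => exact le_rfl
  | nil x => exact x.size_pos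
  | fst x => exact x.size_fst_le
  | snd x => exact x.size_snd_le
  | eq x =>
    have := x.size_pos
    by_cases h : x.fst = x.snd <;> simp only [h, decide_true, decide_false, Data.ofBool, Data.size] <;> omega
  | @pair _ _ x _ _ _ _ _ _ h h' => have := x.size_pos; simp only [Data.size]; omega
  | comp _ _ _ h => omega
  | cond_true _ _ _ h => omega
  | cond_false _ _ _ h => omega
  | loop_done _ h => omega
  | loop_step _ _ _ _ _ h => omega

/-- Types whose elements are encoded as trees. -/
class Enc (α : Type) where
  /-- the encoding -/
  enc : α → Data
  inj : Function.Injective enc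

open Enc

/-- The size of an encoded value. -/
def esize {α : Type} [Enc α] (a : α) : ℕ := (enc a).size

instance : Enc Data := ⟨_root_.id, Function.injective_id⟩

instance : Enc Unit := ⟨fun _ => Data.nil, fun _ _ _ => rfl⟩

instance : Enc Bool := ⟨Data.ofBool, fun a b h => by cases a <;> cases b <;> simp_all [Data.ofBool]⟩

instance {α β : Type} [Enc α] [Enc β] : Enc (α × β) :=
  ⟨fun p => Data.cons (enc p.1) (enc p.2), fun a b h => by
    injection h with h1 h2
    exact Prod.ext (inj h1) (inj h2)⟩

/-- The tree of `some a` is that of the one-element list `[a]`, and also the shape used by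
`Data.ofLetter`; both coincidences are exploited through `PT.congr_enc`. -/
instance {α : Type} [Enc α] : Enc (Option α) :=
  ⟨fun o => o.elim Data.nil fun a => Data.cons (enc a) Data.nil, fun a b h => by
    cases a <;> cases b <;> simp at h ⊢
    exact inj h⟩

theorem Data.ofList_injective : Function.Injective Data.ofList := by
  intro l
  induction l with
  | nil => intro l' h; cases l' <;> simp_all [Data.ofList]
  | cons a l ih =>
    intro l' h
    cases l' with
    | nil => simp [Data.ofList] at h
    | cons b l' =>
      simp only [Data.ofList, Data.cons.injEq] at h
      rw [h.1, ih h.2]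

instance {α : Type} [Enc α] : Enc (List α) :=
  ⟨fun l => Data.ofList (l.map enc), fun _ _ h => List.map_injective_iff.2 inj (Data.ofList_injective h)⟩

/-- Natural numbers are encoded in unary. -/
instance : Enc ℕ :=
  ⟨fun n => Data.ofList (List.replicate n Data.nil), fun _ _ h => by
    simpa using congrArg List.length (Data.ofList_injective h)⟩

instance {α : Type} [Enc α] (p : α → Prop) : Enc {a // p a} :=
  ⟨fun a => enc a.1, fun _ _ h => Subtype.ext (inj h)⟩

section sizes
variable {α β : Type} [Enc α] [Enc β]

theorem esize_pair (a : α) (b : β) : esize (a, b) = esize a + esize b + 1 := rfl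
theorem esize_nil : esize ([] : List α) = 1 := rfl
theorem esize_cons (a : α) (l : List α) : esize (a :: l) = esize a + esize l + 1 := rfl
theorem esize_bool_le (b : Bool) : esize b ≤ 3 := by cases b <;> decide

theorem esize_nat (n : ℕ) : esize n = 2 * n + 1 := by
  induction n with
  | zero => rfl
  | succ n ih =>
    have : esize (n + 1) = 1 + esize n + 1 := rfl
    omega

theorem esize_append (l l' : List α) : esize (l ++ l') + 1 = esize l + esize l' := by
  induction l with
  | nil => simp [esize_nil]; omega
  | cons a l ih => simp only [List.cons_append, esize_cons]; omega

theorem length_lt_esize (l : List α) : l.length < esize l := by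
  induction l with
  | nil => simp [esize_nil]
  | cons a l ih => simp only [List.length_cons, esize_cons]; omega

theorem esize_mem_lt {l : List α} {a : α} (h : a ∈ l) : esize a < esize l := by
  induction l with
  | nil => simp at h
  | cons b l ih =>
    rw [esize_cons]
    rcases List.mem_cons.1 h with rfl | h
    · omega
    · have := ih h; omega

theorem esize_list_le {l : List α} {K : ℕ} (h : ∀ a ∈ l, esize a ≤ K) :
    esize l ≤ l.length * (K + 1) + 1 := by
  induction l with
  | nil => simp [esize_nil]
  | cons a l ih =>
    have h1 := ih fun a ha => h a (List.mem_cons_of_mem _ ha)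
    have h2 := h a List.mem_cons_self
    rw [esize_cons, List.length_cons, Nat.succ_mul]
    omega

theorem esize_reverse (l : List α) : esize l.reverse = esize l := by
  induction l with
  | nil => rfl
  | cons a l ih =>
    have := esize_append l.reverse [a]
    simp only [List.reverse_cons, esize_cons, esize_nil] at *
    omega

theorem esize_sublist {l l' : List α} (h : l.Sublist l') : esize l ≤ esize l' := by
  induction h with
  | slnil => exact le_rfl
  | cons a _ ih => rw [esize_cons]; omega
  | cons_cons a _ ih => rw [esize_cons, esize_cons]; omega

end sizes

/-- Numerical functions that are polynomially bounded in the size of their argument. -/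
def PB {α : Type} [Enc α] (g : α → ℕ) : Prop :=
  ∃ p : Polynomial ℕ, ∀ a, g a ≤ p.eval (esize a)

/-- Functions that are computable in polynomial time. -/
def PT {α β : Type} [Enc α] [Enc β] (f : α → β) : Prop :=
  ∃ (P : Prog) (p : Polynomial ℕ), ∀ a, ∃ t, Eval P (enc a) (enc (f a)) t ∧ t ≤ p.eval (esize a)

section basic
variable {α β γ δ : Type} [Enc α] [Enc β] [Enc γ] [Enc δ]

theorem PB.mono {g h : α → ℕ} (hg : PB g) (H : ∀ a, h a ≤ g a) : PB h := by
  obtain ⟨p, hp⟩ := hg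
  exact ⟨p, fun a => (H a).trans (hp a)⟩

theorem PB.const (n : ℕ) : PB fun _ : α => n := ⟨Polynomial.C n, fun a => by simp⟩

theorem PB.add {g h : α → ℕ} (hg : PB g) (hh : PB h) : PB fun a => g a + h a := by
  obtain ⟨p, hp⟩ := hg
  obtain ⟨q, hq⟩ := hh
  exact ⟨p + q, fun a => by simpa using add_le_add (hp a) (hq a)⟩

theorem PB.mul {g h : α → ℕ} (hg : PB g) (hh : PB h) : PB fun a => g a * h a := by
  obtain ⟨p, hp⟩ := hg
  obtain ⟨q, hq⟩ := hh
  exact ⟨p * q, fun a => by simpa using Nat.mul_le_mul (hp a) (hq a)⟩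

theorem PB.esize : PB (esize : α → ℕ) := ⟨Polynomial.X, fun a => by simp⟩

theorem PT.size {f : α → β} (hf : PT f) : PB fun a => ArithAutomata.esize (f a) := by
  obtain ⟨P, p, hp⟩ := hf
  refine ⟨p, fun a => ?_⟩
  obtain ⟨t, h, ht⟩ := hp a
  exact h.size_le.trans ht

theorem PB.comp {g : β → ℕ} {f : α → β} (hg : PB g) (hf : PT f) : PB fun a => g (f a) := by
  obtain ⟨p, hp⟩ := hg
  obtain ⟨q, hq⟩ := hf.size
  refine ⟨p.comp q, fun a => (hp _).trans ?_⟩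
  rw [Polynomial.eval_comp]
  exact eval_poly_mono _ (hq a)

theorem PT.of_prog {f : α → β} (P : Prog) (T : α → ℕ) (hT : PB T)
    (h : ∀ a, Eval P (enc a) (enc (f a)) (T a)) : PT f := by
  obtain ⟨p, hp⟩ := hT
  exact ⟨P, p, fun a => ⟨T a, h a, hp a⟩⟩

theorem PT.of_enc_eq {f : α → β} (h : ∀ a, enc (f a) = enc a) : PT f :=
  .of_prog Prog.id _ PB.esize fun a => by rw [h]; exact Eval.id _

theorem PT.id : PT fun a : α => a := .of_enc_eq fun _ => rfl

theorem PT.comp {g : β → γ} {f : α → β} (hg : PT g) (hf : PT f) : PT fun a => g (f a) := by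
  obtain ⟨q, hq⟩ := hf.size
  obtain ⟨P, p, hp⟩ := hf
  obtain ⟨P', p', hp'⟩ := hg
  refine ⟨Prog.comp P' P, p + p'.comp q + Polynomial.X, fun a => ?_⟩
  obtain ⟨t, h, ht⟩ := hp a
  obtain ⟨t', h', ht'⟩ := hp' (f a)
  refine ⟨_, Eval.comp h h', ?_⟩
  have := ht'.trans (eval_poly_mono p' (hq a))
  simp only [Polynomial.eval_add, Polynomial.eval_comp, Polynomial.eval_X]
  have : (enc a).size = ArithAutomata.esize a := rfl
  omega

theorem PT.pair {f : α → β} {g : α → γ} (hf : PT f) (hg : PT g) : PT fun a => (f a, g a) := by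
  obtain ⟨P, p, hp⟩ := hf
  obtain ⟨P', p', hp'⟩ := hg
  refine ⟨Prog.pair P P', p + p' + Polynomial.X, fun a => ?_⟩
  obtain ⟨t, h, ht⟩ := hp a
  obtain ⟨t', h', ht'⟩ := hp' a
  refine ⟨_, Eval.pair h h', ?_⟩
  simp only [Polynomial.eval_add, Polynomial.eval_X]
  have : (enc a).size = ArithAutomata.esize a := rfl
  omega

theorem PT.of_enc_eq_fst {f : α → β} (h : ∀ a, enc (f a) = (enc a).fst) : PT f :=
  .of_prog Prog.fst _ PB.esize fun a => by rw [h]; exact Eval.fst _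

theorem PT.of_enc_eq_snd {f : α → β} (h : ∀ a, enc (f a) = (enc a).snd) : PT f :=
  .of_prog Prog.snd _ PB.esize fun a => by rw [h]; exact Eval.snd _

theorem PT.fst {f : α → β × γ} (hf : PT f) : PT fun a => (f a).1 :=
  (PT.of_enc_eq_fst (f := fun p : β × γ => p.1) fun _ => rfl).comp hf

theorem PT.snd {f : α → β × γ} (hf : PT f) : PT fun a => (f a).2 :=
  (PT.of_enc_eq_snd (f := fun p : β × γ => p.2) fun _ => rfl).comp hf

/-- Values with the same encoding can be exchanged. -/
theorem PT.congr_enc {f : α → β} {g : α → γ} (hf : PT f) (h : ∀ a, enc (g a) = enc (f a)) :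
    PT g := by
  obtain ⟨P, p, hp⟩ := hf
  exact ⟨P, p, fun a => by rw [h]; exact hp a⟩

theorem PT.val {p : β → Prop} {f : α → {b // p b}} (hf : PT f) : PT fun a => (f a).1 :=
  hf.congr_enc fun _ => rfl

theorem PT.const (b : β) : PT fun _ : α => b := by
  suffices h : ∀ d : Data, PT fun _ : α => d from (h (enc b)).congr_enc fun _ => rfl
  intro d
  induction d with
  | nil => exact .of_prog Prog.nil _ PB.esize fun a => Eval.nil _
  | cons d d' h h' => exact (h.pair h').congr_enc fun _ => rfl

/-- The branches live on subtypes, so each is required to be defined and fast only on the inputs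
that reach it. This allows a branch to take the head of a list known to be nonempty. -/
theorem PT.dite {c : α → Bool} {h : α → β} (f : {a // c a = true} → β) (g : {a // c a = false} → β)
    (hc : PT c) (hf : PT f) (hg : PT g) (ht : ∀ a, h a.1 = f a) (he : ∀ a, h a.1 = g a) :
    PT h := by
  obtain ⟨B, b, hb⟩ := hc
  obtain ⟨P, p, hp⟩ := hf
  obtain ⟨P', p', hp'⟩ := hg
  refine ⟨Prog.cond B P P', b + p + p' + Polynomial.X, fun a => ?_⟩
  simp only [Polynomial.eval_add, Polynomial.eval_X]
  have e : (enc a).size = ArithAutomata.esize a := rfl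
  obtain ⟨s, hs, hs'⟩ := hb a
  cases h' : c a
  · obtain ⟨t, ht, ht'⟩ := hp' ⟨a, h'⟩
    rw [h'] at hs
    rw [← he] at ht
    have e' : p'.eval (ArithAutomata.esize (⟨a, h'⟩ : {a // c a = false})) =
      p'.eval (ArithAutomata.esize a) := rfl
    exact ⟨_, Eval.cond_false hs ht, by omega⟩
  · obtain ⟨t, h1, ht'⟩ := hp ⟨a, h'⟩
    rw [h'] at hs
    rw [← ht] at h1
    have e' : p.eval (ArithAutomata.esize (⟨a, h'⟩ : {a // c a = true})) =
      p.eval (ArithAutomata.esize a) := rfl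
    exact ⟨_, Eval.cond_true hs h1, by omega⟩

theorem PT.cond {c : α → Bool} {f g : α → β} (hc : PT c) (hf : PT f) (hg : PT g) :
    PT fun a => bif c a then f a else g a :=
  .dite (fun a => f a.1) (fun a => g a.1) hc (hf.comp (PT.val PT.id)) (hg.comp (PT.val PT.id))
    (fun a => by simp [a.2]) (fun a => by simp [a.2])

theorem PT.ite {c : α → Prop} [DecidablePred c] {f g : α → β} (hc : PT fun a => decide (c a))
    (hf : PT f) (hg : PT g) : PT fun a => if c a then f a else g a := by
  have := hc.cond hf hg
  refine this.congr_enc fun a => ?_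
  by_cases h : c a <;> simp [h]

theorem PT.eq [DecidableEq β] {f g : α → β} (hf : PT f) (hg : PT g) :
    PT fun a => decide (f a = g a) := by
  refine PT.comp (g := fun p : β × β => decide (p.1 = p.2)) ?_ (hf.pair hg)
  refine .of_prog Prog.eq _ (PB.esize.add (PB.const 2)) fun a => ?_
  have := Eval.eq (enc a)
  have e : decide ((enc a).fst = (enc a).snd) = decide (a.1 = a.2) :=
    decide_eq_decide.2 (inj (α := β)).eq_iff
  rw [e] at this
  exact this

theorem PT.not {c : α → Bool} (hc : PT c) : PT fun a => !(c a) := by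
  refine (hc.cond (PT.const false) (PT.const true)).congr_enc fun a => ?_
  cases c a <;> rfl

theorem PT.and {c d : α → Bool} (hc : PT c) (hd : PT d) : PT fun a => c a && d a := by
  refine (hc.cond hd (PT.const false)).congr_enc fun a => ?_
  cases c a <;> rfl

theorem PT.or {c d : α → Bool} (hc : PT c) (hd : PT d) : PT fun a => c a || d a := by
  refine (hc.cond (PT.const true) hd).congr_enc fun a => ?_
  cases c a <;> rfl

theorem PT.cons {f : α → β} {g : α → List β} (hf : PT f) (hg : PT g) : PT fun a => f a :: g a :=
  (hf.pair hg).congr_enc fun _ => rfl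

theorem PT.tail {f : α → List β} (hf : PT f) : PT fun a => (f a).tail :=
  (PT.of_enc_eq_snd (f := fun l : List β => l.tail) fun l => by cases l <;> rfl).comp hf

theorem PT.succ {f : α → ℕ} (hf : PT f) : PT fun a => f a + 1 :=
  ((PT.const (β := Unit) ()).pair hf).congr_enc fun _ => rfl

theorem PT.pred {f : α → ℕ} (hf : PT f) : PT fun a => f a - 1 :=
  (PT.of_enc_eq_snd (f := fun n : ℕ => n - 1) fun n => by cases n <;> rfl).comp hf

theorem PT.some {f : α → β} (hf : PT f) : PT fun a => some (f a) :=
  (hf.pair (PT.const ())).congr_enc fun _ => rfl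

theorem PT.isEmpty {f : α → List β} (hf : PT f) : PT fun a => (f a).isEmpty := by
  have := PT.eq (hf.congr_enc (g := fun a => enc (f a)) fun _ => rfl) (PT.const Data.nil)
  refine this.congr_enc fun a => ?_
  cases h : f a <;> simp [enc, Data.ofList]

theorem PT.listCases {l : α → List β} {f : α → γ} {g : α → β → List β → γ} {h : α → γ}
    (hl : PT l) (hf : PT f) (hg : PT fun p : α × β × List β => g p.1 p.2.1 p.2.2)
    (h0 : ∀ a, l a = [] → h a = f a) (h1 : ∀ a b l', l a = b :: l' → h a = g a b l') : PT h := by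
  have hne (a : {a // (l a).isEmpty = false}) : l a.1 ≠ [] := by simpa using a.2
  refine .dite (fun a => f a.1) (fun a => g a.1 ((l a.1).head (hne a)) (l a.1).tail) hl.isEmpty
    (hf.comp (PT.val PT.id)) ?_ (fun a => h0 _ (by simpa using a.2))
    fun a => h1 _ _ _ (List.cons_head_tail (hne a)).symm
  refine hg.comp ((PT.val PT.id).pair (.pair ?_ (PT.tail (hl.comp (PT.val PT.id)))))
  have h2 := hl.comp (PT.val (PT.id (α := {a // (l a).isEmpty = false})))
  refine (PT.of_enc_eq_fst (f := fun d : Data => d.fst) fun _ => rfl).comp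
    (h2.congr_enc (g := fun a => enc (l a.1)) fun _ => rfl) |>.congr_enc fun a => ?_
  show _ = (enc (l a.1)).fst
  conv_rhs => rw [← List.cons_head_tail (hne a)]
  rfl

theorem PT.optionElim {o : α → Option β} {f : α → γ} {g : α → β → γ} (ho : PT o) (hf : PT f)
    (hg : PT fun p : α × β => g p.1 p.2) : PT fun a => (o a).elim (f a) (g a) := by
  refine PT.listCases (l := fun a => (o a).toList) (g := fun a b _ => g a b)
    (ho.congr_enc fun a => ?_) hf (hg.comp (PT.id.fst.pair PT.id.snd.fst)) (fun a h => ?_)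
    fun a b l' h => ?_
  · cases o a <;> rfl
  · cases h' : o a <;> simp_all
  · cases h' : o a <;> simp_all

/-- The cost of a loop. -/
theorem eval_loop {c : α → Bool} {g : α → α} {B P : Prog} {b p : Polynomial ℕ}
    (hb : ∀ a, ∃ t, Eval B (enc a) (enc (c a)) t ∧ t ≤ b.eval (ArithAutomata.esize a))
    (hp : ∀ a, ∃ t, Eval P (enc a) (enc (g a)) t ∧ t ≤ p.eval (ArithAutomata.esize a)) {S : ℕ}
    (k : ℕ) (a : α) (h1 : ∀ i < k, c (g^[i] a) = true) (h2 : c (g^[k] a) = false)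
    (hS : ∀ i ≤ k, ArithAutomata.esize (g^[i] a) ≤ S) :
    ∃ t, Eval (Prog.loop B P) (enc a) (enc (g^[k] a)) t ∧
      t ≤ (k + 1) * (b.eval S + p.eval S + S) := by
  induction k generalizing a with
  | zero =>
    obtain ⟨t, ht, ht'⟩ := hb a
    have h3 := hS 0 le_rfl
    have h4 := eval_poly_mono b h3
    simp only [Function.iterate_zero, _root_.id] at *
    rw [h2] at ht
    refine ⟨_, Eval.loop_done ht, ?_⟩
    have e : (enc a).size = ArithAutomata.esize a := rfl
    omega
  | succ k ih =>
    obtain ⟨t, ht, ht'⟩ := hb a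
    obtain ⟨t', hq, hq'⟩ := hp a
    obtain ⟨t'', hr, hr'⟩ := ih (g a) (fun i hi => h1 (i + 1) (by omega)) h2
      fun i hi => hS (i + 1) (by omega)
    have h3 := hS 0 (by omega)
    have h4 := h1 0 (by omega)
    simp only [Function.iterate_zero, _root_.id] at *
    have h5 := eval_poly_mono b h3
    have h6 := eval_poly_mono p h3
    rw [h4] at ht
    refine ⟨_, Eval.loop_step ht hq hr, ?_⟩
    have e : (enc a).size = ArithAutomata.esize a := rfl
    rw [add_mul (k + 1) 1]
    omega

/-- Polynomially many polynomial-time steps may still build exponentially large values (by doubling,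
for instance), so the intermediate sizes need a bound of their own. -/
theorem PT.iterate {s : α → β} {g : β → β} {c : β → Bool} {k : α → ℕ} (hs : PT s) (hg : PT g)
    (hc : PT c) (hk : PB k) (h1 : ∀ a, ∀ i < k a, c (g^[i] (s a)) = true)
    (h2 : ∀ a, c (g^[k a] (s a)) = false)
    (hS : ∃ S : α → ℕ, PB S ∧ ∀ a, ∀ i ≤ k a, ArithAutomata.esize (g^[i] (s a)) ≤ S a) :
    PT fun a => g^[k a] (s a) := by
  obtain ⟨S, hS, hS'⟩ := hS
  obtain ⟨pk, hk⟩ := hk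
  obtain ⟨pS, hS⟩ := hS
  obtain ⟨B, b, hb⟩ := hc
  obtain ⟨P, p, hp⟩ := hg
  obtain ⟨P', p', hp'⟩ := hs
  refine ⟨Prog.comp (Prog.loop B P) P', p' + (pk + 1) * (b.comp pS + p.comp pS + pS) +
    Polynomial.X, fun a => ?_⟩
  obtain ⟨t, ht, ht'⟩ := hp' a
  obtain ⟨t', hu, hu'⟩ := eval_loop hb hp (S := pS.eval (ArithAutomata.esize a)) (k a) (s a)
    (h1 a) (h2 a) fun i hi => (hS' a i hi).trans (hS a)
  refine ⟨_, Eval.comp ht hu, ?_⟩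
  simp only [Polynomial.eval_add, Polynomial.eval_mul, Polynomial.eval_one, Polynomial.eval_comp,
    Polynomial.eval_X]
  have e : (enc a).size = ArithAutomata.esize a := rfl
  have := hu'.trans (Nat.mul_le_mul_right _ (add_le_add (hk a) le_rfl))
  omega

/-- Recursion over lists, under a bound on the size of the intermediate results. -/
theorem PT.foldl {l : α → List γ} {b : α → β} {f : α → β → γ → β} (hl : PT l) (hb : PT b)
    (hf : PT fun p : α × β × γ => f p.1 p.2.1 p.2.2)
    (hS : ∃ S : α → ℕ, PB S ∧
      ∀ a, ∀ l', l' <+: l a → ArithAutomata.esize (l'.foldl (f a) (b a)) ≤ S a) :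
    PT fun a => (l a).foldl (f a) (b a) := by
  obtain ⟨S, hS, hS'⟩ := hS
  -- The state of the loop: the parameter, the part of the list still to be read, and the
  -- accumulator.
  let g : α × List γ × β → α × List γ × β := fun s =>
    match s.2.1 with
    | [] => s
    | x :: l' => (s.1, l', f s.1 s.2.2 x)
  have hg : PT g := by
    refine PT.listCases (l := fun s => s.2.1) (f := fun s => s)
      (g := fun s x l' => (s.1, l', f s.1 s.2.2 x)) PT.id.snd.fst PT.id ?_ ?_ ?_
    · exact PT.id.fst.fst.pair (PT.id.snd.snd.pair
        (hf.comp (PT.id.fst.fst.pair (PT.id.fst.snd.snd.pair PT.id.snd.fst))))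
    · intro s h
      simp only [g, h]
    · intro s x l' h
      simp only [g, h]
  have hi (a : α) (k : ℕ) (hk : k ≤ (l a).length) :
      g^[k] (a, l a, b a) = (a, (l a).drop k, ((l a).take k).foldl (f a) (b a)) := by
    induction k with
    | zero => simp
    | succ k ih =>
      rw [Function.iterate_succ_apply', ih (by omega)]
      simp only [g]
      rw [List.drop_eq_getElem_cons (by omega), List.take_succ_eq_append_getElem (by omega),
        List.foldl_append]
      rfl
  have h := PT.iterate (s := fun a => (a, l a, b a)) (g := g) (c := fun s => !s.2.1.isEmpty)
    (k := fun a => (l a).length) (PT.id.pair (hl.pair hb)) hg PT.id.snd.fst.isEmpty.not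
    (hl.size.mono fun a => (length_lt_esize _).le) (fun a i hi' => by simp [hi _ _ hi'.le, hi'])
    (fun a => by simp [hi]) ⟨_, (PB.esize.add (hl.size.add hS)).add (PB.const 2), fun a i hi' => ?_⟩
  · refine h.snd.snd.congr_enc fun a => ?_
    rw [hi _ _ le_rfl]
    simp
  · rw [hi _ _ hi', esize_pair, esize_pair]
    have h1 := hS' a _ (List.take_prefix i (l a))
    have h2 := esize_sublist (List.drop_sublist i (l a))
    omega

end basic
open Enc
-- Polynomial-time operations on lists and on unary numbers
section lists
variable {α β γ δ : Type} [Enc α] [Enc β] [Enc γ] [Enc δ]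

theorem PB.length {l : α → List β} (hl : PT l) : PB fun a => (l a).length :=
  hl.size.mono fun _ => (length_lt_esize _).le

theorem PB.nat {n : α → ℕ} (hn : PT n) : PB n :=
  hn.size.mono fun a => by rw [esize_nat]; omega

theorem PT.reverse {l : α → List β} (hl : PT l) : PT fun a => (l a).reverse := by
  have := PT.foldl (b := fun _ => ([] : List β)) (f := fun _ b x => x :: b) hl (PT.const _)
    (PT.id.snd.snd.cons PT.id.snd.fst) ⟨_, hl.size, fun a l' h => ?_⟩
  · exact this.congr_enc fun a => by simp
  · simp only [List.foldl_flip_cons_eq_append', List.append_nil]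
    rw [esize_reverse]
    exact esize_sublist h.sublist

theorem PT.foldr {l : α → List γ} {b : α → β} {f : α → γ → β → β} (hl : PT l) (hb : PT b)
    (hf : PT fun p : α × γ × β => f p.1 p.2.1 p.2.2)
    (hS : ∃ S : α → ℕ, PB S ∧
      ∀ a, ∀ l', l' <:+ l a → ArithAutomata.esize (l'.foldr (f a) (b a)) ≤ S a) :
    PT fun a => (l a).foldr (f a) (b a) := by
  obtain ⟨S, hS, h⟩ := hS
  have := PT.foldl (f := fun a y x => f a x y) hl.reverse hb
    (hf.comp (PT.id.fst.pair (PT.id.snd.snd.pair PT.id.snd.fst))) ⟨S, hS, fun a l' h' => ?_⟩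
  · exact this.congr_enc fun a => by simp
  · have h1 := h a l'.reverse (by simpa using h'.reverse)
    simpa using h1

theorem PT.append {l l' : α → List β} (hl : PT l) (hl' : PT l') : PT fun a => l a ++ l' a := by
  have := PT.foldr (f := fun _ x b => x :: b) hl hl' (PT.id.snd.fst.cons PT.id.snd.snd)
    ⟨_, hl.size.add hl'.size, fun a k h => ?_⟩
  · exact this.congr_enc fun a => by simp
  · have h1 := esize_append k (l' a)
    have h2 := esize_sublist h.sublist
    have h3 : List.foldr (fun x b => x :: b) (l' a) k = k ++ l' a := by simp
    rw [h3]
    omega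

theorem PT.map {l : α → List β} {f : α → β → γ} (hl : PT l)
    (hf : PT fun p : α × β => f p.1 p.2) : PT fun a => (l a).map (f a) := by
  obtain ⟨p, hp⟩ := hf.size
  have := PT.foldr (b := fun _ => []) (f := fun a x b => f a x :: b) hl (PT.const _)
    ((hf.comp (PT.id.fst.pair PT.id.snd.fst)).cons PT.id.snd.snd)
    ⟨_, ((PB.length hl).mul ((PB.mono (g := fun a => p.eval (esize a + (esize (l a)) + 1)) ?_
      fun _ => le_rfl).add (PB.const 1))).add (PB.const 1), fun a k h => ?_⟩
  · exact this.congr_enc fun a => by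
      rw [← List.map_eq_foldr]
  · obtain ⟨q, hq⟩ := hl.size
    refine ⟨p.comp (Polynomial.X + q + 1), fun a => ?_⟩
    simp only [Polynomial.eval_comp, Polynomial.eval_add, Polynomial.eval_X, Polynomial.eval_one]
    exact eval_poly_mono _ (by have h1 : esize (l a) ≤ q.eval (esize a) := hq a; omega)
  · rw [← List.map_eq_foldr]
    refine (esize_list_le (K := p.eval (esize a + (esize (l a)) + 1)) fun y hy => ?_).trans ?_
    · obtain ⟨x, hx, rfl⟩ := List.mem_map.1 hy
      refine (hp (a, x)).trans (eval_poly_mono _ ?_)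
      have := esize_mem_lt (h.subset hx)
      rw [esize_pair]
      omega
    · rw [List.length_map]
      have := h.length_le
      gcongr

theorem esize_flatten_le (l : List (List β)) : esize l.flatten ≤ esize l := by
  induction l with
  | nil => exact le_rfl
  | cons a l ih =>
    have := esize_append a l.flatten
    rw [List.flatten_cons, esize_cons]
    omega

omit [Enc β] in
theorem foldr_append_eq_flatten (l : List (List β)) :
    l.foldr (fun x b => x ++ b) [] = l.flatten := by
  induction l with
  | nil => rfl
  | cons a l ih => simp [ih]

theorem PT.flatten {l : α → List (List β)} (hl : PT l) : PT fun a => (l a).flatten := by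
  have := PT.foldr (b := fun _ => []) (f := fun _ (x : List β) b => x ++ b) hl (PT.const _)
    (PT.id.snd.fst.append PT.id.snd.snd) ⟨_, hl.size, fun a k h => ?_⟩
  · exact this.congr_enc fun a => by rw [foldr_append_eq_flatten]
  · refine le_trans ?_ (esize_sublist h.sublist)
    rw [foldr_append_eq_flatten]
    exact esize_flatten_le k

theorem PT.flatMap {l : α → List β} {f : α → β → List γ} (hl : PT l)
    (hf : PT fun p : α × β => f p.1 p.2) : PT fun a => (l a).flatMap (f a) :=
  (hl.map hf).flatten.congr_enc fun a => by rw [List.flatMap_def]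

theorem PT.filterMap {l : α → List β} {f : α → β → Option γ} (hl : PT l)
    (hf : PT fun p : α × β => f p.1 p.2) : PT fun a => (l a).filterMap (f a) := by
  refine (hl.flatMap (f := fun a x => (f a x).toList)
    (hf.congr_enc fun p => by cases f p.1 p.2 <;> rfl)).congr_enc fun a => ?_
  rw [List.filterMap_eq_flatMap_toList]

theorem PT.filter {l : α → List β} {c : α → β → Bool} (hl : PT l)
    (hc : PT fun p : α × β => c p.1 p.2) : PT fun a => (l a).filter (c a) := by
  refine (hl.filterMap (f := fun a x => bif c a x then Option.some x else none)
    (hc.cond PT.id.snd.some (PT.const none))).congr_enc fun a => ?_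
  congr 1
  rw [← List.filterMap_eq_filter]
  congr 1
  funext x
  cases h : c a x <;> simp [Option.guard, h]

theorem PT.all {l : α → List β} {c : α → β → Bool} (hl : PT l)
    (hc : PT fun p : α × β => c p.1 p.2) : PT fun a => (l a).all (c a) := by
  refine (PT.foldr (b := fun _ => true) (f := fun a x b => c a x && b) hl (PT.const _)
    ((hc.comp (PT.id.fst.pair PT.id.snd.fst)).and PT.id.snd.snd)
    ⟨_, PB.const 3, fun _ _ _ => esize_bool_le _⟩).congr_enc fun a => ?_
  congr 1
  induction l a with
  | nil => rfl
  | cons x l ih => simp [← ih]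

theorem PT.any {l : α → List β} {c : α → β → Bool} (hl : PT l)
    (hc : PT fun p : α × β => c p.1 p.2) : PT fun a => (l a).any (c a) := by
  refine (PT.foldr (b := fun _ => false) (f := fun a x b => c a x || b) hl (PT.const _)
    ((hc.comp (PT.id.fst.pair PT.id.snd.fst)).or PT.id.snd.snd)
    ⟨_, PB.const 3, fun _ _ _ => esize_bool_le _⟩).congr_enc fun a => ?_
  congr 1
  induction l a with
  | nil => rfl
  | cons x l ih => simp [← ih]

theorem PT.mem [DecidableEq β] {x : α → β} {l : α → List β} [∀ a, Decidable (x a ∈ l a)]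
    (hx : PT x) (hl : PT l) : PT fun a => decide (x a ∈ l a) := by
  refine (hl.any (c := fun a y => decide (y = x a)) (PT.eq PT.id.snd (hx.comp PT.id.fst))).congr_enc
    fun a => ?_
  congr 1
  rw [Bool.eq_iff_iff]
  simp

theorem PT.length {l : α → List β} (hl : PT l) : PT fun a => (l a).length :=
  (hl.map (f := fun _ _ => ()) (PT.const ())).congr_enc fun a => by
    simp only [enc, List.map_const', List.map_replicate]

theorem PT.replicate {n : α → ℕ} {x : α → β} (hn : PT n) (hx : PT x) :
    PT fun a => List.replicate (n a) (x a) := by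
  refine ((hn.congr_enc (g := fun a => List.replicate (n a) ()) fun a => ?_).map
    (f := fun a _ => x a) (hx.comp PT.id.fst)).congr_enc fun a => ?_
  · simp only [enc, List.map_replicate]
  · simp

/-- Recursion over natural numbers, under a bound on the size of the intermediate results. -/
theorem PT.natIterate {n : α → ℕ} {b : α → β} {f : α → β → β} (hn : PT n) (hb : PT b)
    (hf : PT fun p : α × β => f p.1 p.2)
    (hS : ∃ S : α → ℕ, PB S ∧ ∀ a, ∀ i ≤ n a, ArithAutomata.esize ((f a)^[i] (b a)) ≤ S a) :
    PT fun a => (f a)^[n a] (b a) := by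
  obtain ⟨S, hS, h⟩ := hS
  have key (a : α) (i : ℕ) :
      (List.replicate i ()).foldl (fun y _ => f a y) (b a) = (f a)^[i] (b a) := by
    induction i with
    | zero => rfl
    | succ i ih => rw [List.replicate_succ', List.foldl_append, ih, Function.iterate_succ_apply']; rfl
  refine (PT.foldl (l := fun a => List.replicate (n a) ()) (f := fun a y _ => f a y)
    (hn.replicate (PT.const ())) hb (hf.comp (PT.id.fst.pair PT.id.snd.fst))
    ⟨S, hS, fun a l' hl => ?_⟩).congr_enc fun a => by rw [key]
  have h1 : l' = List.replicate l'.length () := List.eq_replicate_iff.2 ⟨rfl, fun _ _ => rfl⟩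
  rw [h1, key]
  exact h a _ (by simpa using hl.length_le)

theorem PT.add {m n : α → ℕ} (hm : PT m) (hn : PT n) : PT fun a => m a + n a := by
  refine (PT.length ((hm.replicate (PT.const ())).append (hn.replicate (PT.const ())))).congr_enc
    fun a => by simp

theorem PT.mul {m n : α → ℕ} (hm : PT m) (hn : PT n) : PT fun a => m a * n a := by
  refine (PT.length (PT.flatMap (hm.replicate (PT.const ()))
    (f := fun a _ => List.replicate (n a) ()) ((hn.comp PT.id.fst).replicate (PT.const ())))).congr_enc
    fun a => by simp

theorem PT.sub {m n : α → ℕ} (hm : PT m) (hn : PT n) : PT fun a => m a - n a := by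
  have key (k i : ℕ) : (fun y => y - 1)^[i] k = k - i := by
    induction i with
    | zero => rfl
    | succ i ih => rw [Function.iterate_succ_apply', ih]; omega
  refine (PT.natIterate (f := fun _ y => y - 1) hn hm PT.id.snd.pred
    ⟨_, hm.size, fun a i _ => ?_⟩).congr_enc fun a => by rw [key]
  rw [key, esize_nat, esize_nat]
  omega

theorem PT.le {m n : α → ℕ} (hm : PT m) (hn : PT n) : PT fun a => decide (m a ≤ n a) := by
  refine (PT.eq (hm.sub hn) (PT.const 0)).congr_enc fun a => ?_
  congr 1
  simp [Nat.sub_eq_zero_iff_le]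

theorem PT.sum {l : α → List ℕ} (hl : PT l) : PT fun a => (l a).sum := by
  refine (PT.length (PT.flatMap hl (f := fun _ n => List.replicate n ())
    (PT.id.snd.replicate (PT.const ())))).congr_enc fun a => ?_
  simp [List.length_flatMap]

theorem PT.dvd {m n : α → ℕ} (hm : PT m) (hn : PT n) : PT fun a => decide (m a ∣ n a) := by
  -- A counter modulo m. For m = 0 it is never reset, in agreement with `i % 0 = i`.
  let f : ℕ → ℕ → ℕ := fun m y => if y + 1 = m then 0 else y + 1
  have key (m i : ℕ) : (f m)^[i] 0 = i % m := by
    induction i with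
    | zero => simp
    | succ i ih =>
      rw [Function.iterate_succ_apply', ih]
      simp only [f]
      rcases Nat.eq_zero_or_pos m with rfl | hm
      · simp
      have h1 := Nat.mod_lt i hm
      have h2 := Nat.div_add_mod i m
      split_ifs with h
      · symm
        apply Nat.mod_eq_zero_of_dvd
        exact ⟨i / m + 1, by rw [mul_add]; omega⟩
      · have : i + 1 = (i % m + 1) + m * (i / m) := by omega
        rw [this, Nat.add_mul_mod_self_left, Nat.mod_eq_of_lt (a := i % m + 1) (by omega)]
  refine (PT.eq (PT.natIterate (f := fun a => f (m a)) (b := fun _ => 0) hn (PT.const 0)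
    (PT.ite (PT.eq PT.id.snd.succ (hm.comp PT.id.fst)) (PT.const 0) PT.id.snd.succ)
    ⟨_, hn.size, fun a i h => ?_⟩) (PT.const 0)).congr_enc fun a => ?_
  · rw [key, esize_nat, esize_nat]
    have := Nat.mod_le i (m a)
    omega
  · rw [key]
    simp [Nat.dvd_iff_mod_eq_zero]

theorem PT.zip {l : α → List β} {k : α → List γ} (hl : PT l) (hk : PT k) :
    PT fun a => (l a).zip (k a) := by
  -- The fold runs over one list while its state consumes the other; the pairs come out in reverse
  -- order.
  let f : List γ × List (β × γ) → β → List γ × List (β × γ) := fun s x =>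
    match s.1 with
    | [] => s
    | y :: k' => (k', (x, y) :: s.2)
  have key (l : List β) (k : List γ) (o : List (β × γ)) :
      l.foldl f (k, o) = (k.drop l.length, (l.zip k).reverse ++ o) := by
    induction l generalizing k o with
    | nil => simp
    | cons x l ih => cases k <;> simp [f, ih]
  refine (PT.foldl (b := fun a => (k a, [])) (f := fun _ => f) hl (hk.pair (PT.const _))
    ?_ ⟨_, ((hk.size.add (PB.const 2)).add ((PB.length hl).mul
      (((hl.size.add hk.size).add (PB.const 1)).add (PB.const 1)))), fun a l' h => ?_⟩).snd.reverse.congr_enc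
        fun a => ?_
  · refine PT.listCases (l := fun p => p.2.1.1) (f := fun p => p.2.1)
      (g := fun p y k' => (k', (p.2.2, y) :: p.2.1.2)) PT.id.snd.fst.fst PT.id.snd.fst
      (PT.id.snd.snd.pair ((PT.id.fst.snd.snd.pair PT.id.snd.fst).cons PT.id.fst.snd.fst.snd))
      (fun p h => ?_) fun p y k' h => ?_ <;> simp only [f, h]
  · rw [key, esize_pair, List.append_nil, esize_reverse]
    have h1 := esize_sublist (List.drop_sublist l'.length (k a))
    have h2 : esize (l'.zip (k a)) ≤ (l'.zip (k a)).length * (esize (l a) + esize (k a) + 1 + 1) + 1 := by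
      refine esize_list_le fun p hp => ?_
      have h3 := List.of_mem_zip (a := p.1) (b := p.2) hp
      have h4 := esize_mem_lt (h.subset h3.1)
      have h5 := esize_mem_lt h3.2
      have h6 : esize p = esize p.1 + esize p.2 + 1 := rfl
      omega
    have h3 : (l'.zip (k a)).length ≤ (l a).length := by
      have := h.length_le
      simp; omega
    have h4 := Nat.mul_le_mul_right (esize (l a) + esize (k a) + 1 + 1) h3
    omega
  · rw [key]
    simp

theorem PT.optionMap {o : α → Option β} {f : α → β → γ} (ho : PT o)
    (hf : PT fun p : α × β => f p.1 p.2) : PT fun a => (o a).map (f a) :=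
  (ho.optionElim (f := fun _ => none) (g := fun a b => Option.some (f a b)) (PT.const _)
    hf.some).congr_enc fun a => by cases o a <;> rfl

theorem PT.headD {l : α → List β} {d : α → β} (hl : PT l) (hd : PT d) :
    PT fun a => (l a).headD (d a) :=
  hl.listCases (f := d) (g := fun _ b _ => b) hd PT.id.snd.fst
    (fun a h => by simp [h]) fun a b l' h => by simp [h]

/-- All lists of length at most `k` over a given list. -/
def listsLE (C : List β) : ℕ → List (List β)
  | 0 => [[]]
  | k + 1 => [] :: C.flatMap fun x => (listsLE C k).map (x :: ·)

omit [Enc β] in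
theorem mem_listsLE {C : List β} {k : ℕ} {l : List β} :
    l ∈ listsLE C k ↔ l.length ≤ k ∧ ∀ x ∈ l, x ∈ C := by
  induction k generalizing l with
  | zero =>
    simp only [listsLE, List.mem_singleton, Nat.le_zero, List.length_eq_zero_iff]
    exact ⟨fun h => by simp [h], fun h => h.1⟩
  | succ k ih =>
    cases l with
    | nil => simp [listsLE]
    | cons x l => simp [listsLE, ih]; tauto

omit [Enc β] in
theorem length_listsLE_le (C : List β) (k : ℕ) : (listsLE C k).length ≤ (C.length + 1) ^ k := by
  induction k with
  | zero => simp [listsLE]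
  | succ k ih =>
    simp only [listsLE, List.length_cons, List.length_flatMap, List.length_map, List.map_const',
      List.sum_replicate, smul_eq_mul]
    have h1 : 1 ≤ (C.length + 1) ^ k := Nat.one_le_pow _ _ (by omega)
    have h2 := Nat.mul_le_mul_left C.length ih
    rw [pow_succ', add_mul]
    omega

theorem esize_listsLE_le (C : List β) (k : ℕ) :
    esize (listsLE C k) ≤ (C.length + 1) ^ k * (k * (esize C + 1) + 1 + 1) + 1 := by
  refine (esize_list_le (K := k * (esize C + 1) + 1) fun l hl => ?_).trans ?_
  · rw [mem_listsLE] at hl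
    refine (esize_list_le (K := esize C) fun x hx => (esize_mem_lt (hl.2 x hx)).le).trans ?_
    gcongr
    exact hl.1
  · gcongr
    exact length_listsLE_le C k

/-- The enumeration is exponential in k by nature; the hypothesis `h` moves this cost to the size of
the argument, where the padding will pay for it. -/
theorem PT.listsLE {C : α → List β} {k : α → ℕ} (hC : PT C) (hk : PT k)
    (h : PB fun a => ((C a).length + 1) ^ k a) : PT fun a => ArithAutomata.listsLE (C a) (k a) := by
  let f : List β → List (List β) → List (List β) := fun C S => [] :: C.flatMap fun x => S.map (x :: ·)
  have key (C : List β) (i : ℕ) : (f C)^[i] [[]] = ArithAutomata.listsLE C i := by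
    induction i with
    | zero => rfl
    | succ i ih => rw [Function.iterate_succ_apply', ih]; rfl
  refine (PT.natIterate (f := fun a => f (C a)) hk (PT.const [[]]) ?_
    ⟨_, (h.mul ((((PB.nat hk).mul (hC.size.add (PB.const 1))).add (PB.const 1)).add
      (PB.const 1))).add (PB.const 1), fun a i hi => ?_⟩).congr_enc fun a => by rw [key]
  · refine (PT.const []).cons ((hC.comp PT.id.fst).flatMap
      (f := fun p x => List.map (x :: ·) p.2) ?_)
    exact PT.map (f := fun (p : (α × List (List β)) × β) l => p.2 :: l) PT.id.fst.snd (PT.id.fst.snd.cons PT.id.snd)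
  · rw [key]
    refine (esize_listsLE_le _ _).trans ?_
    gcongr
    omega

end lists

/-! ### Walks in automata -/

namespace MullerAutomaton
variable {α Q : Type*} (A : MullerAutomaton α Q)

/-- `A.Walk p l q`: the list `l` of transitions leads from `p` to `q`. -/
def Walk (A : MullerAutomaton α Q) : Q → List (Q × α × Q) → Q → Prop
  | p, [], q => p = q
  | p, e :: l, q => e ∈ A.trans ∧ e.1 = p ∧ Walk A e.2.2 l q

/-- The labels of a list of transitions. -/
def labels (l : List (Q × α × Q)) : List α := l.map fun e => e.2.1

/-- `A.Accepts q w`: there is an accepting run on `w` from the state `q`. -/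
def Accepts (q : Q) (w : Stream' α) : Prop :=
  ∃ ρ : ℕ → Q, ρ 0 = q ∧ (∀ k, (ρ k, w.get k, ρ (k + 1)) ∈ A.trans) ∧ infSet ρ ∈ A.acc

variable {A}

theorem mem_language_iff {w : Stream' α} : w ∈ A.language ↔ ∃ q ∈ A.init, A.Accepts q w := by
  constructor
  · rintro ⟨ρ, ⟨h0, h⟩, hF⟩
    exact ⟨_, h0, ρ, rfl, h, hF⟩
  · rintro ⟨q, hq, ρ, rfl, h, hF⟩
    exact ⟨ρ, ⟨hq, h⟩, hF⟩

theorem walk_append {p q : Q} {l l' : List (Q × α × Q)} :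
    A.Walk p (l ++ l') q ↔ ∃ x, A.Walk p l x ∧ A.Walk x l' q := by
  induction l generalizing p with
  | nil => simp [Walk]
  | cons e l ih => simp [Walk, ih, and_assoc]

theorem Walk.append {p q x : Q} {l l' : List (Q × α × Q)} (h : A.Walk p l x) (h' : A.Walk x l' q) :
    A.Walk p (l ++ l') q := walk_append.2 ⟨x, h, h'⟩

theorem Walk.mem {p q : Q} {l : List (Q × α × Q)} (h : A.Walk p l q) : ∀ e ∈ l, e ∈ A.trans := by
  induction l generalizing p with
  | nil => simp
  | cons e l ih =>
    intro e' he
    rcases List.mem_cons.1 he with rfl | he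
    · exact h.1
    · exact ih h.2.2 _ he

theorem infSet_succ (ρ : ℕ → Q) : infSet (fun k => ρ (k + 1)) = infSet ρ := by
  ext q
  simp only [infSet, Set.mem_ofPred_eq, Filter.frequently_atTop]
  constructor
  · intro h a
    obtain ⟨b, hb, h⟩ := h a
    exact ⟨b + 1, by omega, h⟩
  · intro h a
    obtain ⟨b, hb, h⟩ := h (a + 1)
    exact ⟨b - 1, by omega, by rw [Nat.sub_add_cancel (by omega)]; exact h⟩

theorem infSet_add (ρ : ℕ → Q) (n : ℕ) : infSet (fun k => ρ (k + n)) = infSet ρ := by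
  induction n with
  | zero => rfl
  | succ n ih =>
    rw [← ih, ← infSet_succ fun k => ρ (k + n)]
    congr 1
    funext k
    congr 1
    omega

theorem Walk.accepts {p q : Q} {l : List (Q × α × Q)} {w : Stream' α} (h : A.Walk p l q)
    (hw : A.Accepts q w) : A.Accepts p (labels l ++ₛ w) := by
  induction l generalizing p with
  | nil =>
    cases h
    exact hw
  | cons e l ih =>
    obtain ⟨he, rfl, hl⟩ := h
    obtain ⟨ρ, h0, h, hF⟩ := ih hl
    refine ⟨fun k => Nat.casesOn k e.1 ρ, rfl, fun k => ?_, ?_⟩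
    · cases k with
      | zero =>
        show (e.1, e.2.1, ρ 0) ∈ A.trans
        rw [h0]
        exact he
      | succ k => exact h k
    · rw [← infSet_succ]
      exact hF

theorem run_walk {x : List α} {w : Stream' α} {ρ : ℕ → Q}
    (h : ∀ k, (ρ k, (x ++ₛ w).get k, ρ (k + 1)) ∈ A.trans) :
    (∃ l, A.Walk (ρ 0) l (ρ x.length) ∧ labels l = x) ∧
      ∀ k, (ρ (k + x.length), w.get k, ρ (k + x.length + 1)) ∈ A.trans := by
  induction x generalizing ρ with
  | nil => exact ⟨⟨[], rfl, rfl⟩, h⟩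
  | cons a x ih =>
    obtain ⟨⟨l, hl, hx⟩, h2⟩ := ih (ρ := fun k => ρ (k + 1)) fun k => h (k + 1)
    refine ⟨⟨(ρ 0, a, ρ 1) :: l, ⟨h 0, rfl, hl⟩, ?_⟩, h2⟩
    simp only [labels, List.map_cons] at hx ⊢
    rw [hx]

theorem Accepts.split {x : List α} {w : Stream' α} {p : Q} (h : A.Accepts p (x ++ₛ w)) :
    ∃ l q, A.Walk p l q ∧ labels l = x ∧ A.Accepts q w := by
  obtain ⟨ρ, rfl, h, hF⟩ := h
  obtain ⟨⟨l, hl, hx⟩, h2⟩ := run_walk h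
  refine ⟨l, _, hl, hx, fun k => ρ (k + x.length), by simp, fun k => ?_, by rwa [infSet_add]⟩
  have := h2 k
  convert this using 4
  omega

/-! ### Certificates for the existence of accepting runs -/

/-- The piece between two occurrences of the same transition is cut out, keeping one occurrence.
Repetitions of transitions are used instead of repetitions of states: the walk stays nonempty, and
its length is bounded by the number of transitions, whereas the number of states may be exponential
in the input. -/
theorem Walk.shorten {p q : Q} {l : List (Q × α × Q)} (h : A.Walk p l q) (hl : l ≠ []) :
    ∃ l', A.Walk p l' q ∧ l' ≠ [] ∧ l'.Nodup ∧ l' ⊆ l := by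
  induction hn : l.length using Nat.strong_induction_on generalizing l with
  | _ n ih =>
    by_cases hd : l.Nodup
    · exact ⟨l, h, hl, hd, List.Subset.refl _⟩
    · obtain ⟨e, he⟩ : ∃ e, List.Duplicate e l := by
        by_contra! hc
        exact hd (List.nodup_iff_forall_not_duplicate.2 hc)
      obtain ⟨a, b, c, rfl⟩ : ∃ a b c, l = a ++ e :: (b ++ e :: c) := by
        clear ih h hl hn hd
        induction he with
        | cons_mem hm =>
          obtain ⟨b, c, rfl⟩ := List.append_of_mem hm
          exact ⟨[], b, c, rfl⟩
        | cons_duplicate _ ih =>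
          obtain ⟨a, b, c, rfl⟩ := ih
          exact ⟨_ :: a, b, c, rfl⟩
      obtain ⟨x, h1, h2⟩ := walk_append.1 h
      obtain ⟨h3, rfl, h4⟩ := h2
      obtain ⟨y, h5, h6⟩ := walk_append.1 h4
      obtain ⟨l', h7, h8, h9, h10⟩ := ih (a ++ e :: c).length (by simp at hn ⊢; omega)
        (h1.append (show A.Walk e.1 (e :: c) q from ⟨h3, rfl, h6.2.2⟩)) (by simp) rfl
      refine ⟨l', h7, h8, h9, fun z hz => ?_⟩
      have := h10 hz
      simp only [List.mem_append, List.mem_cons] at this ⊢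
      tauto

theorem Walk.shorten_length {p q : Q} {l E : List (Q × α × Q)} (h : A.Walk p l q) (hl : l ≠ [])
    (hE : ∀ e ∈ A.trans, e ∈ E) :
    ∃ l', A.Walk p l' q ∧ l' ≠ [] ∧ l'.length ≤ E.length ∧ l' ⊆ l := by
  obtain ⟨l', h1, h2, h3, h4⟩ := h.shorten hl
  exact ⟨l', h1, h2, (List.subperm_of_subset h3 fun e he => hE e (h1.mem e he)).length_le, h4⟩

/-- A path from `q` to a cycle through all states of an accepting set. -/
def Cert (A : MullerAutomaton α Q) (q q' : Q) (t c : List (Q × α × Q)) : Prop :=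
  A.Walk q t q' ∧ A.Walk q' c q' ∧ c ≠ [] ∧ {x | x ∈ c.map Prod.fst} ∈ A.acc

/-- Going around the cycle forever visits exactly the states of the cycle infinitely often. -/
theorem Cert.exists_accepts {q q' : Q} {t c : List (Q × α × Q)} (h : A.Cert q q' t c) :
    ∃ w, A.Accepts q w := by
  obtain ⟨h1, h2, h3, h4⟩ := h
  have hpos : 0 < c.length := List.length_pos_iff.2 h3
  -- In a walk, each transition ends where the next one starts, and the last one ends at the
  -- endpoint.
  have hstep : ∀ (l : List (Q × α × Q)) (p x : Q), A.Walk p l x → ∀ i (hi : i < l.length),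
      l[i] ∈ A.trans ∧ l[i].2.2 = if h : i + 1 < l.length then (l[i + 1]).1 else x := by
    intro l
    induction l with
    | nil => simp
    | cons e l ih =>
      intro p x h i hi
      cases i with
      | zero =>
        refine ⟨h.1, ?_⟩
        cases l with
        | nil => simpa [Walk] using h.2.2
        | cons e' l => simpa using h.2.2.2.1.symm
      | succ i =>
        have := ih _ _ h.2.2 i (by simpa using hi)
        simpa using this
  have h0 : (c.get ⟨0, hpos⟩).1 = q' := by
    cases c with
    | nil => exact absurd rfl h3
    | cons e c => exact h2.2.1
  refine ⟨_, h1.accepts (w := fun k => (c.get ⟨k % c.length, Nat.mod_lt _ hpos⟩).2.1)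
    ⟨fun k => (c.get ⟨k % c.length, Nat.mod_lt _ hpos⟩).1, by simpa using h0, fun k => ?_, ?_⟩⟩
  · obtain ⟨h5, h6⟩ := hstep c _ _ h2 (k % c.length) (Nat.mod_lt _ hpos)
    have h7 : (c.get ⟨(k + 1) % c.length, Nat.mod_lt _ hpos⟩).1 =
        (c.get ⟨k % c.length, Nat.mod_lt _ hpos⟩).2.2 := by
      simp only [List.get_eq_getElem]
      rw [h6]
      split_ifs with h
      · congr 2
        rw [Nat.add_mod, Nat.mod_eq_of_lt (a := 1) (by omega), Nat.mod_eq_of_lt h]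
      · rw [← h0]
        simp only [List.get_eq_getElem]
        congr 2
        have := Nat.mod_lt k hpos
        apply Nat.mod_eq_zero_of_dvd
        have h8 := Nat.div_add_mod k c.length
        exact ⟨k / c.length + 1, by rw [mul_add]; omega⟩
    show ((c.get ⟨k % c.length, Nat.mod_lt _ hpos⟩).1,
      (c.get ⟨k % c.length, Nat.mod_lt _ hpos⟩).2.1,
      (c.get ⟨(k + 1) % c.length, Nat.mod_lt _ hpos⟩).1) ∈ A.trans
    rw [h7]
    exact h5
  · convert h4 using 1
    ext x
    simp only [infSet, Set.mem_ofPred_eq, Filter.frequently_atTop, List.mem_map]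
    constructor
    · intro h
      obtain ⟨k, _, hk⟩ := h 0
      exact ⟨_, List.getElem_mem _, hk⟩
    · rintro ⟨e, he, rfl⟩ a
      obtain ⟨i, hi, rfl⟩ := List.mem_iff_getElem.1 he
      refine ⟨i + c.length * a, by nlinarith, ?_⟩
      rw [List.get_eq_getElem]
      congr 2
      exact (Nat.add_mul_mod_self_left _ _ _).trans (Nat.mod_eq_of_lt hi)

theorem exists_run_walk {w : Stream' α} {ρ : ℕ → Q}
    (h : ∀ k, (ρ k, w.get k, ρ (k + 1)) ∈ A.trans) (a b : ℕ) :
    ∃ l, A.Walk (ρ a) l (ρ (b + a)) ∧ l.length = b ∧ ∀ e ∈ l, ∃ k ≥ a, e.1 = ρ k := by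
  induction b with
  | zero => exact ⟨[], by simp [Walk], rfl, by simp⟩
  | succ b ih =>
    obtain ⟨l, h1, h2, h3⟩ := ih
    refine ⟨l ++ [(ρ (b + a), w.get (b + a), ρ (b + a + 1))], h1.append ⟨h _, rfl, ?_⟩, by simp [h2],
      ?_⟩
    · show ρ _ = ρ _
      congr 1
      omega
    · intro e he
      rcases List.mem_append.1 he with he | he
      · exact h3 e he
      · rw [List.mem_singleton.1 he]
        exact ⟨_, by omega, rfl⟩

/-- From some time K on, the run stays inside the set of states visited infinitely often, and any
two of these are joined by a piece of the run after K. Shortening only discards transitions, so the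
pieces stay in that set. -/
theorem Accepts.exists_cert [Finite Q] {q : Q} {w : Stream' α} (h : A.Accepts q w)
    {E : List (Q × α × Q)} (hE : ∀ e ∈ A.trans, e ∈ E) {N : ℕ}
    (hN : ∀ F ∈ A.acc, ∃ l : List Q, F = {x | x ∈ l} ∧ l.length ≤ N) :
    ∃ q' t c, A.Cert q q' t c ∧ t.length ≤ E.length ∧ c.length ≤ N * (2 * E.length) := by
  obtain ⟨ρ, rfl, h, hF⟩ := h
  obtain ⟨L, hL, hLN⟩ := hN _ hF
  have hmem (x : Q) : x ∈ L ↔ ∃ᶠ k in Filter.atTop, ρ k = x := by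
    have : x ∈ infSet ρ ↔ x ∈ L := by rw [hL]; rfl
    exact this.symm
  obtain ⟨K, hK⟩ : ∃ K, ∀ k ≥ K, ρ k ∈ L := by
    have : ∀ x : Q, ∃ K, ∀ k ≥ K, ρ k = x → x ∈ L := by
      intro x
      by_cases hx : x ∈ L
      · exact ⟨0, fun _ _ _ => hx⟩
      · rw [hmem, Filter.not_frequently, Filter.eventually_atTop] at hx
        obtain ⟨K, hK⟩ := hx
        exact ⟨K, fun k hk h => absurd h (hK k hk)⟩
    choose K hK using this
    have := Fintype.ofFinite Q
    exact ⟨Finset.univ.sup K, fun k hk =>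
      hK (ρ k) k ((Finset.le_sup (Finset.mem_univ _)).trans hk) rfl⟩
  have hwalk : ∀ x ∈ L, ∀ y ∈ L, ∃ l, A.Walk x l y ∧ l ≠ [] ∧ l.length ≤ E.length ∧
      ∀ e ∈ l, e.1 ∈ L := by
    intro x hx y hy
    obtain ⟨i, hi, rfl⟩ := (Filter.frequently_atTop.1 ((hmem x).1 hx)) K
    obtain ⟨j, hj, rfl⟩ := (Filter.frequently_atTop.1 ((hmem y).1 hy)) (i + 1)
    obtain ⟨l, h1, h2, h3⟩ := exists_run_walk h i (j - i)
    rw [Nat.sub_add_cancel (by omega)] at h1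
    obtain ⟨l', h4, h5, h6, h7⟩ := h1.shorten_length (by rw [← List.length_pos_iff]; omega) hE
    refine ⟨l', h4, h5, h6, fun e he => ?_⟩
    obtain ⟨k, hk, hk'⟩ := h3 e (h7 he)
    rw [hk']
    exact hK k (by omega)
  have hx := hK K le_rfl
  -- One round trip from `ρ K` to each state of the list: two shortened walks per state, whence the
  -- factor 2|E|.
  have hcyc : ∀ L' ⊆ L, ∃ c, A.Walk (ρ K) c (ρ K) ∧ c.length ≤ L'.length * (2 * E.length) ∧
      (∀ e ∈ c, e.1 ∈ L) ∧ ∀ y ∈ L', ∃ e ∈ c, e.1 = y := by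
    intro L' hL'
    induction L' with
    | nil => exact ⟨[], rfl, by simp, by simp, by simp⟩
    | cons y L' ih =>
      obtain ⟨c, h1, h2, h3, h4⟩ := ih fun z hz => hL' (List.mem_cons_of_mem _ hz)
      have hy := hL' (List.mem_cons_self (a := y))
      obtain ⟨l1, a1, a2, a3, a4⟩ := hwalk _ hx _ hy
      obtain ⟨l2, b1, b2, b3, b4⟩ := hwalk _ hy _ hx
      refine ⟨l1 ++ (l2 ++ c), a1.append (b1.append h1), ?_, ?_, ?_⟩
      · simp only [List.length_append, List.length_cons, add_mul]
        omega
      · intro e he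
        simp only [List.mem_append] at he
        rcases he with he | he | he
        exacts [a4 e he, b4 e he, h3 e he]
      · intro z hz
        rcases List.mem_cons.1 hz with rfl | hz
        · cases l2 with
          | nil => exact absurd rfl b2
          | cons e l2 => exact ⟨e, by simp, b1.2.1⟩
        · obtain ⟨e, he, rfl⟩ := h4 z hz
          exact ⟨e, by simp [he], rfl⟩
  obtain ⟨c, h1, h2, h3, h4⟩ := hcyc L (List.Subset.refl _)
  obtain ⟨l, h5, -, -⟩ := exists_run_walk h 0 K
  have hset : {x | x ∈ c.map Prod.fst} ∈ A.acc := by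
    convert hF using 1
    rw [hL]
    ext x
    simp only [List.mem_map, Set.mem_ofPred_eq]
    exact ⟨fun ⟨e, he, h⟩ => h ▸ h3 e he, fun hx => h4 x hx⟩
  have hc : c ≠ [] := by
    rintro rfl
    simpa using h4 _ hx
  have hc' : c.length ≤ N * (2 * E.length) := h2.trans (Nat.mul_le_mul_right _ hLN)
  by_cases hl : l = []
  · subst hl
    exact ⟨_, [], c, ⟨h5, h1, hc, hset⟩, by simp, hc'⟩
  · obtain ⟨l', h6, -, h7, -⟩ := h5.shorten_length hl hE
    exact ⟨_, l', c, ⟨h6, h1, hc, hset⟩, h7, hc'⟩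

end MullerAutomaton

/-! ### Values of words -/

section streams
variable {α β : Type*}

theorem append_stream_inj {x x' : List α} {w w' : Stream' α} (h : x.length = x'.length)
    (e : x ++ₛ w = x' ++ₛ w') : x = x' ∧ w = w' := by
  induction x generalizing x' with
  | nil =>
    cases x' with
    | nil => exact ⟨rfl, e⟩
    | cons a x' => simp at h
  | cons a x ih =>
    cases x' with
    | nil => simp at h
    | cons b x' =>
      have h0 : a = b := congrFun e 0
      obtain ⟨h1, h2⟩ := ih (by simpa using h) (funext fun n => congrFun e (n + 1))
      exact ⟨by rw [h0, h1], h2⟩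

theorem get_append_stream_left {x : List α} {w : Stream' α} {i : ℕ} (h : i < x.length) :
    (x ++ₛ w).get i = x[i] := by
  induction x generalizing i with
  | nil => simp at h
  | cons a x ih =>
    cases i with
    | zero => rfl
    | succ i => exact ih (by simpa using h)

theorem get_append_stream_right (x : List α) (w : Stream' α) (i : ℕ) :
    (x ++ₛ w).get (x.length + i) = w.get i := by
  induction x with
  | nil => simp
  | cons a x ih =>
    have : (a :: x).length + i = (x.length + i) + 1 := by simp; omega
    rw [this]
    exact ih

theorem map_append_eq_map {f : α → β} {x : List α} {y : Stream' β} {w : Stream' α}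
    (hf : Function.Injective f) (h : x.map f ++ₛ y = w.map f) :
    ∃ w', w = x ++ₛ w' ∧ y = w'.map f := by
  refine ⟨w.drop x.length, ?_⟩
  have h1 : w.map f = (w.take x.length).map f ++ₛ (w.drop x.length).map f := by
    rw [← Stream'.map_append_stream, Stream'.append_take_drop]
  rw [h1] at h
  obtain ⟨h2, h3⟩ := append_stream_inj (by simp) h
  exact ⟨(Stream'.append_take_drop x.length w).symm.trans
    (by rw [← List.map_injective_iff.2 hf h2]), h3⟩

theorem some_append_eq {d d' : List α} {y : Stream' (Option α)} {w : Stream' (Option α)}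
    (h : d.map some ++ₛ y = d'.map some ++ₛ ([none] ++ₛ w)) :
    ∃ d'', d' = d ++ d'' ∧ y = d''.map some ++ₛ ([none] ++ₛ w) := by
  induction d generalizing d' with
  | nil => exact ⟨d', rfl, h⟩
  | cons a d ih =>
    cases d' with
    | nil => exact absurd (congrFun h 0) (Option.some_ne_none a)
    | cons b d' =>
      have h0 : a = b := Option.some_injective _ (congrFun h 0)
      obtain ⟨d'', h1, h2⟩ := ih (d' := d') (funext fun n => congrFun h (n + 1))
      exact ⟨d'', by rw [h0, h1]; rfl, h2⟩

end streams

/-- The digits of a list of blocks. -/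
def flat {r m : ℕ} (l : List (Fin m → Fin r)) : List (Fin r) := l.flatMap List.ofFn

/-- The integer part of a decomposition, as an integer vector. -/
def intPart {r m : ℕ} (s : Fin m → Fin r) (l : List (Fin m → Fin r)) : Fin m → ℤ :=
  l.foldl (fun V b i => r * V i + ((b i : ℕ) : ℤ)) fun i => if (s i : ℕ) = 0 then 0 else -1

/-- The fractional part of a decomposition. -/
noncomputable def fracPart {r m : ℕ} (w : Stream' (Fin r)) (i : Fin m) : ℝ :=
  ∑' j : ℕ, ((w.get (m * j + i) : ℕ) : ℝ) / (r : ℝ) ^ (j + 1)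

/-- The word `s ⋆ σ ⋆ w`, where `σ` is given by its list of blocks. -/
def word {r m : ℕ} (s : Fin m → Fin r) (l : List (Fin m → Fin r)) (w : Stream' (Fin r)) :
    Stream' (Letter r) :=
  ((List.ofFn s).map some ++ [none]) ++ₛ ((flat l).map some ++ₛ ([none] ++ₛ w.map some))

section values
variable {r m : ℕ}

theorem flat_append (l l' : List (Fin m → Fin r)) : flat (l ++ l') = flat l ++ flat l' :=
  List.flatMap_append

theorem length_flat (l : List (Fin m → Fin r)) : (flat l).length = l.length * m := by
  simp [flat, List.length_flatMap]

theorem flat_eq_append {l u : List (Fin m → Fin r)} {d : List (Fin r)} (hm : 1 ≤ m)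
    (h : flat l = flat u ++ d) : ∃ t : List (Fin m → Fin r), d = flat t := by
  have h1 := congrArg List.length h
  simp only [List.length_append, length_flat] at h1
  have h2 : u.length ≤ l.length := Nat.le_of_mul_le_mul_right (by omega : u.length * m ≤ _) hm
  refine ⟨l.drop u.length, ?_⟩
  rw [← List.take_append_drop u.length l, flat_append] at h
  exact (List.append_inj h (by simp [length_flat, h2])).2.symm

theorem exists_flat_of_dvd {d : List (Fin r)} (h : m ∣ d.length) :
    ∃ l : List (Fin m → Fin r), d = flat l := by
  obtain ⟨k, hk⟩ := h
  induction k generalizing d with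
  | zero => exact ⟨[], List.length_eq_zero_iff.1 hk⟩
  | succ k ih =>
    have h1 : m ≤ d.length := by rw [hk]; nlinarith
    obtain ⟨l, hl⟩ := ih (d := d.drop m) (by rw [List.length_drop, hk, mul_add]; omega)
    refine ⟨(fun i => d[i]) :: l, ?_⟩
    show d = List.ofFn _ ++ flat l
    rw [← hl]
    conv_lhs => rw [← List.take_append_drop m d]
    congr 1
    apply List.ext_getElem <;> simp [h1]

theorem exists_stream_eq_flat (w : Stream' (Fin r)) (k : ℕ) :
    ∃ (l : List (Fin m → Fin r)) (w' : Stream' (Fin r)), l.length = k ∧ w = flat l ++ₛ w' := by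
  induction k generalizing w with
  | zero => exact ⟨[], w, rfl, rfl⟩
  | succ k ih =>
    obtain ⟨l, w', h1, h2⟩ := ih (w.drop m)
    refine ⟨(fun i => w.get i) :: l, w', by simp [h1], ?_⟩
    have h3 : List.ofFn (fun i : Fin m => w.get i) = w.take m := by
      apply List.ext_getElem <;> simp
    show w = (List.ofFn _ ++ flat l) ++ₛ w'
    rw [Stream'.append_append_stream, ← h2, h3, Stream'.append_take_drop]

theorem msdWord_eq_word {k : ℕ} (s : Fin m → Fin r) (σ : Fin k → Fin m → Fin r)
    (w : Stream' (Fin r)) : msdWord s σ w = word s (List.ofFn σ) w := by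
  simp only [msdWord, word, ← Stream'.append_append_stream, flat]
  congr 1
  simp

theorem lambdaVec_eq (w : Stream' (Fin r)) : lambdaVec m w = fun i => -fracPart w i := rfl

theorem intPart_append_singleton (s : Fin m → Fin r) (l : List (Fin m → Fin r)) (b : Fin m → Fin r)
    (i : Fin m) : intPart s (l ++ [b]) i = r * intPart s l i + ((b i : ℕ) : ℤ) := by
  simp [intPart]

/-- The sign digit r − 1 contributes r^k (r − 1)/(1 − r) = −r^k, so γ is a Horner evaluation started
at 0 or −1. -/
theorem gammaVec_eq {k : ℕ} (hr : 2 ≤ r) (s : Fin m → Fin r) (hs : ∀ i, IsSignDigit (s i))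
    (σ : Fin k → Fin m → Fin r) (i : Fin m) : gammaVec s σ i = intPart s (List.ofFn σ) i := by
  have hr' : (2 : ℝ) ≤ r := by exact_mod_cast hr
  induction k with
  | zero =>
    simp only [gammaVec, pow_zero, one_mul, Finset.univ_eq_empty, Finset.sum_empty, add_zero,
      List.ofFn_zero, intPart, List.foldl_nil]
    rcases hs i with h | h
    · simp [h]
    · have h' : r - 1 ≠ 0 := by omega
      rw [h, if_neg h', Nat.cast_sub (by omega), div_eq_iff (by linarith)]
      push_cast
      ring
  | succ k ih =>
    have h1 := ih fun j => σ j.castSucc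
    rw [List.ofFn_succ', List.concat_eq_append, intPart_append_singleton]
    push_cast
    rw [← h1]
    simp only [gammaVec, Fin.sum_univ_castSucc, mul_add, Finset.mul_sum, Fin.val_castSucc,
      Fin.val_last, Nat.add_sub_cancel, Nat.sub_self, pow_zero, one_mul]
    rw [← add_assoc]
    congr 2
    · rw [pow_succ]; ring
    · refine Finset.sum_congr rfl fun j _ => ?_
      have : k - (j : ℕ) = (k - 1 - j) + 1 := by have := j.2; omega
      rw [this, pow_succ]
      ring

theorem intPart_append_sub (s : Fin m → Fin r) (l l' t : List (Fin m → Fin r)) (i : Fin m) :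
    intPart s (l ++ t) i - intPart s (l' ++ t) i = r ^ t.length * (intPart s l i - intPart s l' i) := by
  induction t using List.reverseRecOn with
  | nil => simp
  | append_singleton t b ih =>
    rw [← List.append_assoc, ← List.append_assoc, intPart_append_singleton,
      intPart_append_singleton, List.length_append, pow_add]
    simp only [List.length_singleton, pow_one]
    linear_combination (r : ℤ) * ih

theorem abs_intPart_le (hr : 1 ≤ r) (s : Fin m → Fin r) (l : List (Fin m → Fin r)) (i : Fin m) :
    -(r ^ l.length : ℤ) ≤ intPart s l i ∧ intPart s l i < r ^ l.length := by
  induction l using List.reverseRecOn with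
  | nil =>
    simp only [intPart, List.foldl_nil, List.length_nil, pow_zero]
    split_ifs <;> omega
  | append_singleton t b ih =>
    rw [intPart_append_singleton, List.length_append, pow_add]
    simp only [List.length_singleton, pow_one]
    have h1 : ((b i : ℕ) : ℤ) < r := by exact_mod_cast (b i).2
    have h2 : (0 : ℤ) ≤ ((b i : ℕ) : ℤ) := by positivity
    have h3 : (1 : ℤ) ≤ r := by exact_mod_cast hr
    constructor <;> nlinarith

theorem frac_term_le (hr : 2 ≤ r) (w : Stream' (Fin r)) (i j : ℕ) :
    ((w.get i : ℕ) : ℝ) / (r : ℝ) ^ (j + 1) ≤ 1 * (r⁻¹ : ℝ) ^ j := by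
  have hr' : (2 : ℝ) ≤ r := by exact_mod_cast hr
  have h1 : ((w.get i : ℕ) : ℝ) ≤ r := by exact_mod_cast (w.get i).2.le
  rw [inv_pow, div_le_iff₀ (by positivity), pow_succ, one_mul, ← mul_assoc,
    inv_mul_cancel₀ (by positivity), one_mul]
  exact h1

theorem summable_frac (hr : 2 ≤ r) (w : Stream' (Fin r)) (i : ℕ) :
    Summable fun j : ℕ => ((w.get (m * j + i) : ℕ) : ℝ) / (r : ℝ) ^ (j + 1) := by
  have hr' : (2 : ℝ) ≤ r := by exact_mod_cast hr
  refine Summable.of_nonneg_of_le (fun j => by positivity) (fun j => frac_term_le hr w _ j)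
    ((summable_geometric_of_lt_one (by positivity) ?_).mul_left 1)
  exact inv_lt_one_of_one_lt₀ (by linarith)

theorem fracPart_nonneg (w : Stream' (Fin r)) (i : Fin m) : 0 ≤ fracPart w i :=
  tsum_nonneg fun j => by positivity

theorem fracPart_le (hr : 2 ≤ r) (w : Stream' (Fin r)) (i : Fin m) : fracPart w i ≤ 2 := by
  have hr' : (2 : ℝ) ≤ r := by exact_mod_cast hr
  have h1 : (r⁻¹ : ℝ) ≤ 2⁻¹ := by gcongr
  have hs := summable_geometric_of_lt_one (r := (r⁻¹ : ℝ)) (by positivity) (by linarith)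
  refine (Summable.tsum_le_tsum (fun j => frac_term_le hr w _ j) (summable_frac hr w i)
    (hs.mul_left 1)).trans ?_
  rw [tsum_mul_left, tsum_geometric_of_lt_one (by positivity) (by linarith), one_mul]
  rw [inv_le_comm₀ (by linarith) (by norm_num)]
  linarith

theorem fracPart_cons (hr : 2 ≤ r) (b : Fin m → Fin r) (w : Stream' (Fin r)) (i : Fin m) :
    r * fracPart (List.ofFn b ++ₛ w) i = (b i : ℕ) + fracPart w i := by
  have hr' : (2 : ℝ) ≤ r := by exact_mod_cast hr
  unfold fracPart
  rw [(summable_frac hr _ i).tsum_eq_zero_add, mul_add, ← tsum_mul_left]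
  congr 1
  · rw [mul_zero, zero_add, get_append_stream_left (by simp)]
    simp
    field_simp
  · refine tsum_congr fun j => ?_
    have : m * (j + 1) + (i : ℕ) = (List.ofFn b).length + (m * j + i) := by simp; ring
    rw [this, get_append_stream_right, pow_succ (r : ℝ) (j + 1)]
    field_simp

/-- Multiplication by r^|u| moves the separator to the right across u. -/
theorem pow_mul_value (hr : 2 ≤ r) (s : Fin m → Fin r) (l u : List (Fin m → Fin r))
    (w : Stream' (Fin r)) (i : Fin m) :
    (r : ℝ) ^ u.length * (intPart s l i + fracPart (flat u ++ₛ w) i) =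
      intPart s (l ++ u) i + fracPart w i := by
  induction u generalizing l with
  | nil => simp [flat]
  | cons b u ih =>
    have h1 := ih (l ++ [b])
    rw [intPart_append_singleton, List.append_assoc] at h1
    have h2 : flat (b :: u) ++ₛ w = List.ofFn b ++ₛ (flat u ++ₛ w) :=
      Stream'.append_append_stream _ _ _
    have h3 := fracPart_cons hr b (flat u ++ₛ w) i
    rw [h2, List.length_cons, pow_succ]
    rw [List.singleton_append] at h1
    rw [← h1]
    push_cast
    linear_combination (r : ℝ) ^ u.length * h3

theorem mem_represented_iff {Q : Type*} {A : MullerAutomaton (Letter r) Q} (hr : 2 ≤ r)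
    {x : Fin m → ℝ} : x ∈ A.represented m ↔ ∃ (s : Fin m → Fin r) (l : List (Fin m → Fin r))
      (w : Stream' (Fin r)), (∀ i, IsSignDigit (s i)) ∧ word s l w ∈ A.language ∧
        x = fun i => intPart s l i + fracPart w i := by
  constructor
  · rintro ⟨s, k, σ, w, hs, h, rfl⟩
    refine ⟨s, List.ofFn σ, w, hs, by rwa [← msdWord_eq_word], ?_⟩
    funext i
    rw [Pi.sub_apply, gammaVec_eq hr s hs, lambdaVec_eq, sub_neg_eq_add]
  · rintro ⟨s, l, w, hs, h, rfl⟩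
    refine ⟨s, l.length, l.get, w, hs, by rwa [msdWord_eq_word, List.ofFn_get], ?_⟩
    funext i
    rw [Pi.sub_apply, gammaVec_eq hr s hs, lambdaVec_eq, sub_neg_eq_add, List.ofFn_get]

/-- The value of an affine functional at a decomposition. -/
noncomputable def val (a : Fin m → ℝ) (b : ℝ) (s : Fin m → Fin r) (l : List (Fin m → Fin r))
    (w : Stream' (Fin r)) : ℝ :=
  ∑ i, a i * (intPart s l i + fracPart w i) + b

/-- Moving the separator across uv on one side and across u on the other leaves the same tail w on
both sides. It cancels, and what remains is the form (a, b) evaluated at a fractional generator. -/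
theorem val_frac (hr : 2 ≤ r) (a : Fin m → ℝ) (b : ℝ) (s : Fin m → Fin r)
    (l u v : List (Fin m → Fin r)) (w : Stream' (Fin r)) :
    (r : ℝ) ^ (u ++ v).length * val a b s l (flat (u ++ v) ++ₛ w) =
      r ^ u.length * val a b s l (flat u ++ₛ w) +
      (∑ i, a i * ((intPart s (l ++ (u ++ v)) i - intPart s (l ++ u) i : ℤ) : ℝ) +
        b * (((r : ℤ) ^ (u ++ v).length - r ^ u.length : ℤ) : ℝ)) := by
  have key (u : List (Fin m → Fin r)) : (r : ℝ) ^ u.length * val a b s l (flat u ++ₛ w) =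
      ∑ i, a i * (intPart s (l ++ u) i + fracPart w i) + b * r ^ u.length := by
    simp only [← pow_mul_value hr]
    rw [val, mul_add, Finset.mul_sum, mul_comm b]
    congr 1
    exact Finset.sum_congr rfl fun i _ => by ring
  rw [key, key]
  push_cast
  simp only [mul_add, mul_sub, Finset.sum_add_distrib, Finset.sum_sub_distrib]
  ring

/-- Inserting v before t in the integer part is a translation by r^|t| times an integer generator;
the fractional part does not see it. -/
theorem val_int (a : Fin m → ℝ) (b : ℝ) (s : Fin m → Fin r)
    (u v t : List (Fin m → Fin r)) (w : Stream' (Fin r)) :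
    val a b s (u ++ v ++ t) w = val a b s (u ++ t) w +
      r ^ t.length * ∑ i, a i * ((intPart s (u ++ v) i - intPart s u i : ℤ) : ℝ) := by
  have key (i : Fin m) : (intPart s (u ++ v ++ t) i : ℝ) = intPart s (u ++ t) i +
      r ^ t.length * ((intPart s (u ++ v) i - intPart s u i : ℤ) : ℝ) := by
    rw [← sub_eq_iff_eq_add']
    exact_mod_cast intPart_append_sub s (u ++ v) u t i
  simp only [val, key, Finset.mul_sum]
  rw [add_right_comm, ← Finset.sum_add_distrib]
  congr 1
  exact Finset.sum_congr rfl fun i _ => by ring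

theorem val_le (hr : 2 ≤ r) (a : Fin m → ℝ) (b : ℝ) (s : Fin m → Fin r)
    (l : List (Fin m → Fin r)) : ∃ C, 0 ≤ C ∧ ∀ w, val a b s l w ≤ C := by
  refine ⟨∑ i, |a i| * (|(intPart s l i : ℝ)| + 2) + |b|, by positivity, fun w => ?_⟩
  refine add_le_add (Finset.sum_le_sum fun i _ => ?_) (le_abs_self b)
  refine (le_abs_self _).trans ?_
  rw [abs_mul]
  gcongr
  refine (abs_add_le _ _).trans ?_
  gcongr
  rw [abs_of_nonneg (fracPart_nonneg w i)]
  exact fracPart_le hr w i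

end values

/-! ### Generators -/

namespace MullerAutomaton
variable {r m : ℕ} {Q : Type*}

/-- The homogeneous vectors given by a path to a state from which an accepting run exists, and by
a cycle in this state. -/
inductive IsGen (A : MullerAutomaton (Letter r) Q) (m N : ℕ) : (Fin m → ℤ) → ℤ → Prop
  | int {q0 q1 q2 : Q} {z π ν : List (Q × Letter r × Q)} {s : Fin m → Fin r}
      {u v : List (Fin m → Fin r)} : q0 ∈ A.init → A.Walk q0 z q1 →
      labels z = (List.ofFn s).map some ++ [none] → A.Walk q1 π q2 → labels π = (flat u).map some →
      A.Walk q2 ν q2 → labels ν = (flat v).map some → (∃ y, A.Accepts q2 y) →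
      u.length + v.length ≤ N → IsGen A m N (fun i => intPart s (u ++ v) i - intPart s u i) 0
  | frac {q0 q1 q2 : Q} {z π ν : List (Q × Letter r × Q)} {s : Fin m → Fin r}
      {l u v : List (Fin m → Fin r)} : q0 ∈ A.init → A.Walk q0 z q1 →
      labels z = (List.ofFn s).map some ++ [none] → A.Walk q1 π q2 →
      labels π = (flat l).map some ++ none :: (flat u).map some →
      A.Walk q2 ν q2 → labels ν = (flat v).map some → (∃ y, A.Accepts q2 y) →
      l.length + (u.length + v.length) ≤ N →
      IsGen A m N (fun i => intPart s (l ++ (u ++ v)) i - intPart s (l ++ u) i)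
        ((r : ℤ) ^ (u ++ v).length - r ^ u.length)

variable {A : MullerAutomaton (Letter r) Q}

theorem word_eq_append {s s' : Fin m → Fin r} {l : List (Fin m → Fin r)} {w : Stream' (Fin r)}
    {y : Stream' (Letter r)} (h : ((List.ofFn s).map some ++ [none]) ++ₛ y = word s' l w) :
    s = s' ∧ y = (flat l).map some ++ₛ ([none] ++ₛ w.map some) := by
  obtain ⟨h1, h2⟩ := append_stream_inj (by simp) h
  refine ⟨List.ofFn_injective (List.map_injective_iff.2 (Option.some_injective _)
    (List.append_left_injective _ h1)), h2⟩

/-- If the form were positive on the generator, each further turn of the cycle would raise the value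
by a definite amount. The word u v^ω itself is not used: an accepting condition may reject it, so
its value need not belong to X. -/
theorem ev_nonpos_of_gen (hr : 2 ≤ r) (hm : 1 ≤ m) (hA : A.IsArithmetic m) {a : Fin m → ℝ} {b : ℝ}
    (hX : ∀ x ∈ A.represented m, ∑ i, a i * x i + b ≤ 0) {N : ℕ} {V : Fin m → ℤ} {h : ℤ}
    (hg : IsGen A m N V h) : ∑ i, a i * (V i : ℝ) + b * (h : ℝ) ≤ 0 := by
  have hr' : (2 : ℝ) ≤ r := by exact_mod_cast hr
  have hval (s : Fin m → Fin r) (l : List (Fin m → Fin r)) (w : Stream' (Fin r))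
      (hs : ∀ i, IsSignDigit (s i)) (h : word s l w ∈ A.language) : val a b s l w ≤ 0 :=
    hX _ ((mem_represented_iff hr).2 ⟨s, l, w, hs, h, rfl⟩)
  have harith (u) (hu : u ∈ A.language) : ∃ (s : Fin m → Fin r) (l : List (Fin m → Fin r))
      (w : Stream' (Fin r)), (∀ i, IsSignDigit (s i)) ∧ u = word s l w := by
    obtain ⟨s, k, σ, w, hs, rfl⟩ := hA u hu
    exact ⟨s, _, w, hs, msdWord_eq_word _ _ _⟩
  by_contra! hpos
  cases hg with
  | @int q0 q1 q2 z π ν s u v h0 hz lz hπ lπ hν lν hy _ =>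
    simp only [Int.cast_zero, mul_zero, add_zero] at hpos
    set g := ∑ i, a i * ((intPart s (u ++ v) i - intPart s u i : ℤ) : ℝ) with hg
    obtain ⟨y, hy⟩ := hy
    have hacc (y) (hy : A.Accepts q2 y) : ((List.ofFn s).map some ++ [none]) ++ₛ
        ((flat u).map some ++ₛ y) ∈ A.language :=
      mem_language_iff.2 ⟨q0, h0, lz ▸ hz.accepts (lπ ▸ hπ.accepts hy)⟩
    obtain ⟨s', l', w, hs, e0⟩ := harith _ (hacc y hy)
    obtain ⟨rfl, e1⟩ := word_eq_append e0
    obtain ⟨d, h1, h2⟩ := some_append_eq e1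
    obtain ⟨t, rfl⟩ := flat_eq_append hm h1
    -- The tail is quantified inside the induction: a bound for the tail v ++ t at stage i yields a
    -- bound for t, better by g, at stage i + 1. For a fixed tail this cannot go on for all i.
    have key (i : ℕ) : ∀ t w, A.Accepts q2 ((flat t).map some ++ₛ ([none] ++ₛ w.map some)) →
        val a b s (u ++ t) w ≤ -(i * g) := by
      induction i with
      | zero =>
        intro t w h
        simp only [Nat.cast_zero, zero_mul, neg_zero]
        refine hval s _ w hs ?_
        have := hacc _ h
        rwa [← Stream'.append_append_stream ((flat u).map some), ← List.map_append,
          ← flat_append] at this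
      | succ i ih =>
        intro t w h
        have h1 := hν.accepts h
        rw [lν, ← Stream'.append_append_stream, ← List.map_append, ← flat_append] at h1
        have h2 := ih _ _ h1
        rw [← List.append_assoc, val_int, ← hg] at h2
        have h3 : (1 : ℝ) ≤ r ^ t.length := one_le_pow₀ (by linarith)
        push_cast
        nlinarith
    obtain ⟨n, hn⟩ := exists_nat_gt (-(val a b s (u ++ t) w) / g)
    rw [div_lt_iff₀ hpos] at hn
    have := key n t w (h2 ▸ hy)
    linarith
  | @frac q0 q1 q2 z π ν s l u v h0 hz lz hπ lπ hν lν hy _ =>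
    set g := ∑ i, a i * ((intPart s (l ++ (u ++ v)) i - intPart s (l ++ u) i : ℤ) : ℝ) +
        b * (((r : ℤ) ^ (u ++ v).length - r ^ u.length : ℤ) : ℝ) with hg
    obtain ⟨y, hy⟩ := hy
    have hacc (y) (hy : A.Accepts q2 y) : ((List.ofFn s).map some ++ [none]) ++ₛ
        ((flat l).map some ++ₛ ([none] ++ₛ ((flat u).map some ++ₛ y))) ∈ A.language := by
      refine mem_language_iff.2 ⟨q0, h0, ?_⟩
      have := hz.accepts (hπ.accepts hy)
      rwa [lz, lπ, Stream'.append_append_stream ((flat l).map some)] at this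
    obtain ⟨s', l', w, hs, e0⟩ := harith _ (hacc y hy)
    obtain ⟨rfl, e1⟩ := word_eq_append e0
    obtain ⟨d, -, e⟩ := some_append_eq e1
    -- The path has already read the second separator, so the integer part of the accepted word is
    -- exactly l.
    have hd : d = [] := by
      cases d with
      | nil => rfl
      | cons c d => exact absurd (congrFun e 0).symm (Option.some_ne_none c)
    subst hd
    obtain ⟨w', -, rfl⟩ := map_append_eq_map (Option.some_injective _)
      (append_stream_inj (x := [none]) (x' := [none]) rfl e).2
    have key (i : ℕ) : ∀ w, A.Accepts q2 (w.map some) →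
        (r : ℝ) ^ u.length * val a b s l (flat u ++ₛ w) ≤ -(i * g) := by
      induction i with
      | zero =>
        intro w h
        simp only [Nat.cast_zero, zero_mul, neg_zero]
        refine mul_nonpos_of_nonneg_of_nonpos (by positivity) (hval s l _ hs ?_)
        have := hacc _ h
        rwa [← Stream'.map_append_stream] at this
      | succ i ih =>
        intro w h
        have h1 := hν.accepts h
        rw [lν, ← Stream'.map_append_stream] at h1
        have h2 := ih _ h1
        have h3 := val_frac hr a b s l u v w
        rw [← hg, flat_append, Stream'.append_append_stream, List.length_append, pow_add] at h3
        have h4 : (1 : ℝ) ≤ r ^ v.length := one_le_pow₀ (by linarith)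
        have h5 : 0 ≤ (i : ℝ) * g := by positivity
        push_cast
        nlinarith
    obtain ⟨n, hn⟩ := exists_nat_gt (-((r : ℝ) ^ u.length * val a b s l (flat u ++ₛ w')) / g)
    rw [div_lt_iff₀ hpos] at hn
    have := key n w' hy
    linarith

/-- Among sufficiently many blocks, a state is repeated. -/
theorem Accepts.exists_cycle (hm : 1 ≤ m) {E : List (Q × Letter r × Q)}
    (hE : ∀ e ∈ A.trans, e ∈ E) {p : Q} {l : List (Fin m → Fin r)} {y : Stream' (Letter r)}
    (h : A.Accepts p ((flat l).map some ++ₛ y)) (hl : l.length = E.length + 1) :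
    ∃ u v t q π ν, l = u ++ v ++ t ∧ v ≠ [] ∧ A.Walk p π q ∧ labels π = (flat u).map some ∧
      A.Walk q ν q ∧ labels ν = (flat v).map some ∧ A.Accepts q ((flat t).map some ++ₛ y) := by
  classical
  obtain ⟨ρ, rfl, h, hF⟩ := h
  obtain ⟨i, j, hi, hij, hj, e⟩ : ∃ i j, 1 ≤ i ∧ i < j ∧ j ≤ l.length ∧ ρ (i * m) = ρ (j * m) := by
    -- Pigeonhole on the transitions that end at the block boundaries 1, …, |E| + 1. Boundary 0 is
    -- left out, since no transition need lead there.
    let f : Fin (E.length + 1) → {e // e ∈ E.toFinset} := fun i =>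
      ⟨_, List.mem_toFinset.2 (hE _ (h ((i + 1) * m - 1)))⟩
    obtain ⟨i, j, hij, e⟩ := Fintype.exists_ne_map_eq_of_card_lt f (by
      rw [Fintype.card_coe, Fintype.card_fin]
      exact Nat.lt_succ_of_le (List.toFinset_card_le E))
    have e' : ρ ((i + 1) * m - 1 + 1) = ρ ((j + 1) * m - 1 + 1) :=
      congrArg (fun e => e.1.2.2) e
    have hp (k : ℕ) : (k + 1) * m - 1 + 1 = (k + 1) * m := by
      have : 1 ≤ (k + 1) * m := Nat.mul_pos (by omega) hm
      omega
    rw [hp, hp] at e'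
    have hne : (i : ℕ) ≠ j := fun h => hij (Fin.ext h)
    have := i.2
    have := j.2
    rcases Nat.lt_or_gt_of_ne hne with h | h
    · exact ⟨i + 1, j + 1, by omega, by omega, by omega, e'⟩
    · exact ⟨j + 1, i + 1, by omega, by omega, by omega, e'.symm⟩
  obtain ⟨u, v, t, rfl, hu, hv⟩ : ∃ u v t, l = u ++ v ++ t ∧ u.length = i ∧ v.length = j - i := by
    refine ⟨l.take i, (l.drop i).take (j - i), (l.drop i).drop (j - i), ?_, ?_, ?_⟩
    · rw [List.append_assoc, List.take_append_drop, List.take_append_drop]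
    · simp; omega
    · simp; omega
  rw [flat_append, flat_append, List.map_append, List.map_append, Stream'.append_append_stream,
    Stream'.append_append_stream] at h
  obtain ⟨⟨π, h1, h2⟩, h3⟩ := run_walk h
  have hlu : ((flat u).map (some : Fin r → Letter r)).length = i * m := by simp [length_flat, hu]
  have hlv : ((flat v).map (some : Fin r → Letter r)).length = (j - i) * m := by
    simp [length_flat, hv]
  rw [hlu] at h1 h3
  obtain ⟨⟨ν, h4, h5⟩, h6⟩ := run_walk (ρ := fun k => ρ (k + i * m)) fun k => by
    have := h3 k
    convert this using 4
    omega
  have hji : (j - i) * m + i * m = j * m := by rw [← add_mul]; congr 1; omega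
  rw [hlv] at h4 h6
  simp only [zero_add, hji, ← e] at h4
  refine ⟨u, v, t, _, π, ν, rfl, ?_, h1, h2, h4, h5, fun k => ρ (k + j * m), by simp [e],
    fun k => ?_, by rwa [infSet_add]⟩
  · rintro rfl
    simp at hv
    omega
  · have := h6 k
    simp only [add_assoc, hji] at this
    convert this using 4
    rw [← hji]
    omega

/-- An integer part with more than |E| blocks contains a cycle, whose removal lowers the value by a
nonpositive multiple of nothing worse than a generator; hence short integer parts suffice. For
these, the uniform bound C on the value is halved again and again with the help of cycles in the
fractional part. -/
theorem nonpos_of_gen (hr : 2 ≤ r) (hm : 1 ≤ m) {E : List (Q × Letter r × Q)}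
    (hE : ∀ e ∈ A.trans, e ∈ E) {a : Fin m → ℝ} {b : ℝ}
    (hg : ∀ V h, IsGen A m (2 * E.length + 1) V h → ∑ i, a i * (V i : ℝ) + b * (h : ℝ) ≤ 0) :
    ∀ x ∈ A.represented m, ∑ i, a i * x i + b ≤ 0 := by
  have hr' : (2 : ℝ) ≤ r := by exact_mod_cast hr
  intro x hx
  obtain ⟨s, l, w, hs, hw, rfl⟩ := (mem_represented_iff hr).1 hx
  obtain ⟨q0, h0, h⟩ := mem_language_iff.1 hw
  obtain ⟨z, q1, hz, lz, h'⟩ := h.split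
  suffices H : ∀ l w, A.Accepts q1 ((flat l).map some ++ₛ ([none] ++ₛ w.map some)) →
      val a b s l w ≤ 0 from H l w h'
  clear h' h hw hx w l
  intro l
  induction hn : l.length using Nat.strong_induction_on generalizing l with
  | _ n ih =>
    intro w h
    rcases Nat.lt_or_ge E.length l.length with hlt | hle
    · obtain ⟨l1, l2, rfl, hl1⟩ : ∃ l1 l2, l = l1 ++ l2 ∧ l1.length = E.length + 1 :=
        ⟨l.take (E.length + 1), l.drop (E.length + 1), (List.take_append_drop _ _).symm,
          by simp; omega⟩
      rw [flat_append, List.map_append, Stream'.append_append_stream] at h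
      obtain ⟨u, v, t, q, π, ν, rfl, hv, hπ, lπ, hν, lν, hq⟩ := h.exists_cycle hm hE hl1
      have h1 := hg _ _ (IsGen.int h0 hz lz hπ lπ hν lν ⟨_, hq⟩ (by simp at hl1; omega))
      simp only [Int.cast_zero, mul_zero, add_zero] at h1
      have h2 := hπ.accepts hq
      rw [lπ, ← Stream'.append_append_stream ((flat t).map some),
        ← Stream'.append_append_stream ((flat u).map some), ← List.map_append,
        ← List.map_append, ← flat_append, ← flat_append] at h2
      have hv' := List.length_pos_iff.2 hv
      have h3 := ih _ (by simp at hn ⊢; omega) _ rfl _ h2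
      rw [List.append_assoc (u ++ v), val_int]
      have h4 : (0 : ℝ) ≤ r ^ (t ++ l2).length := by positivity
      nlinarith
    · obtain ⟨π0, q1', hπ0, lπ0, h'⟩ := (show A.Accepts q1 (((flat l).map some ++ [none]) ++ₛ
        w.map some) by rwa [Stream'.append_append_stream]).split
      obtain ⟨C, hC0, hC⟩ := val_le hr a b s l
      -- If w = u v w₂ with a cycle v, then r^|v| times the value is at most the value at u w₂,
      -- because the generator contributes a nonpositive term; and r^|v| ≥ 2.
      have key (k : ℕ) : ∀ w, A.Accepts q1' (w.map some) → val a b s l w ≤ C * (2⁻¹) ^ k := by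
        induction k with
        | zero => exact fun w _ => by simpa using hC w
        | succ k ihk =>
          intro w hw
          obtain ⟨l1, w2, hl1, rfl⟩ := exists_stream_eq_flat (m := m) w (E.length + 1)
          rw [Stream'.map_append_stream] at hw
          obtain ⟨u, v, t, q, π, ν, rfl, hv, hπ, lπ, hν, lν, hq⟩ := hw.exists_cycle hm hE hl1
          -- Here l has at most |E| blocks and u, v lie within |E| + 1 blocks; this is the origin of
          -- 2|E| + 1.
          have h1 := hg _ _ (IsGen.frac (l := l) (u := u) h0 hz lz (hπ0.append hπ)
            (by simp only [labels, List.map_append] at *; rw [lπ0, lπ]; simp) hν lν ⟨_, hq⟩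
            (by simp at hl1; omega))
          have h2 := hπ.accepts hq
          rw [lπ, ← Stream'.map_append_stream, ← Stream'.map_append_stream] at h2
          have h3 := ihk _ h2
          have h4 := val_frac hr a b s l u v (flat t ++ₛ w2)
          rw [flat_append, Stream'.append_append_stream]
          rw [List.length_append, pow_add, mul_assoc] at h4
          have h5 : (0 : ℝ) < r ^ u.length := by positivity
          have h6 : (r : ℝ) ^ v.length * val a b s l (flat (u ++ v) ++ₛ (flat t ++ₛ w2)) ≤
              C * (2⁻¹) ^ k := by
            refine le_trans ?_ h3
            refine le_of_mul_le_mul_left ?_ h5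
            rw [List.length_append] at h1
            rw [h4]
            linarith
          have h7 : (2 : ℝ) ≤ r ^ v.length := by
            refine hr'.trans ?_
            exact le_self_pow₀ (by linarith) (by simpa using hv)
          have h8 : 0 ≤ C * (2⁻¹ : ℝ) ^ k := by positivity
          rw [pow_succ]
          by_cases h9 : val a b s l (flat (u ++ v) ++ₛ (flat t ++ₛ w2)) ≤ 0
          · linarith
          · nlinarith
      refine ge_of_tendsto' (x := Filter.atTop) (f := fun k : ℕ => C * (2⁻¹ : ℝ) ^ k) ?_
        fun k => key k w h'
      simpa using (tendsto_pow_atTop_nhds_zero_of_lt_one (r := (2⁻¹ : ℝ)) (by norm_num)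
        (by norm_num)).const_mul C

end MullerAutomaton

/-! ### Bounded integer certificates -/

section separation
variable {ι : Type*} [Fintype ι] [DecidableEq ι]

/-- Solutions of square integer systems, up to a positive factor. -/
theorem exists_int_multiple (M : Matrix ι ι ℤ) (c : ι → ℤ) (x : ι → ℝ) (K : ℕ)
    (hM : ∀ i j, |M i j| ≤ K) (hc : ∀ i, |c i| ≤ K) (hdet : M.det ≠ 0)
    (h : ∀ i, ∑ j, (M i j : ℝ) * x j = c i) :
    ∃ (ψ : ι → ℤ) (t : ℝ), 0 < t ∧ (∀ i, (ψ i : ℝ) = t * x i) ∧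
      ∀ i, |ψ i| ≤ (Fintype.card ι).factorial * K ^ Fintype.card ι := by
  have key (i : ι) : ((M.cramer c i : ℤ) : ℝ) = M.det * x i := by
    have h1 : (M.map (Int.cast : ℤ → ℝ)).mulVec x = fun i => (c i : ℝ) := by
      funext i
      simp only [Matrix.mulVec, dotProduct, Matrix.map_apply]
      exact h i
    have h2 := congrArg ((M.map (Int.cast : ℤ → ℝ)).adjugate.mulVec) h1
    rw [Matrix.mulVec_mulVec, Matrix.adjugate_mul, Matrix.smul_mulVec, Matrix.one_mulVec] at h2
    have h3 := congrFun h2 i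
    have h4 : (M.map (Int.cast : ℤ → ℝ)).det = (M.det : ℝ) := (Int.cast_det M).symm
    have h5 : (M.map (Int.cast : ℤ → ℝ)).adjugate = M.adjugate.map (Int.cast : ℤ → ℝ) :=
      ((Int.castRingHom ℝ).map_adjugate M).symm
    rw [Pi.smul_apply, h4, h5, smul_eq_mul] at h3
    rw [h3, Matrix.cramer_eq_adjugate_mulVec]
    simp [Matrix.mulVec, dotProduct]
  -- The Leibniz formula: n! products of n entries, each of absolute value at most K.
  have hb (i : ι) : |M.cramer c i| ≤ (Fintype.card ι).factorial * K ^ Fintype.card ι := by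
    rw [Matrix.cramer_apply]
    have := Matrix.det_le (A := M.updateCol i c) (abv := AbsoluteValue.abs) (x := (K : ℤ))
      fun j k => by
        rw [Matrix.updateCol_apply]
        split_ifs
        exacts [hc j, hM j k]
    simpa using this
  -- The factor is |det M|, so a negative determinant requires a change of sign.
  rcases lt_or_gt_of_ne hdet with hd | hd
  · refine ⟨fun i => -M.cramer c i, -M.det, by simpa using hd, fun i => ?_, fun i => ?_⟩
    · rw [Int.cast_neg, key, neg_mul]
    · rw [abs_neg]
      exact hb i
  · exact ⟨M.cramer c, M.det, by exact_mod_cast hd, key, hb⟩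

/-- Vectors without a common nonzero annihilator span the space, so a basis can be chosen among
them. -/
theorem exists_det_ne_zero (T : Set (ι → ℤ))
    (hT : ∀ z : ι → ℝ, (∀ t ∈ T, ∑ i, (t i : ℝ) * z i = 0) → z = 0) :
    ∃ M : Matrix ι ι ℤ, (∀ i, M i ∈ T) ∧ M.det ≠ 0 := by
  let f : (ι → ℤ) → (ι → ℝ) := fun t i => (t i : ℝ)
  have hspan : Submodule.span ℝ (f '' T) = ⊤ := by
    by_contra hne
    obtain ⟨g, hg, hle⟩ := Submodule.exists_le_ker_of_lt_top _ (lt_top_iff_ne_top.2 hne)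
    apply hg
    have hrep (v : ι → ℝ) : g v = ∑ i, v i * g (Pi.single i 1) := by
      conv_lhs => rw [pi_eq_sum_univ' v, map_sum]
      simp
    have hz := hT (fun i => g (Pi.single i 1)) fun t ht => by
      have : f t ∈ LinearMap.ker g := hle (Submodule.subset_span ⟨t, ht, rfl⟩)
      rw [LinearMap.mem_ker, hrep] at this
      exact this
    ext i
    simpa using congrFun hz i
  obtain ⟨B, hB, hBs, hli⟩ := exists_linearIndependent ℝ (f '' T)
  rw [hspan] at hBs
  let b := Module.Basis.mk hli (by rw [Subtype.range_coe]; exact hBs.ge)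
  let e : ι ≃ B := (Pi.basisFun ℝ ι).indexEquiv b
  choose t ht hft using fun i => hB (e i).2
  refine ⟨Matrix.of t, ht, fun h0 => ?_⟩
  have h1 : LinearIndependent ℝ ((Matrix.of t).map (Int.cast : ℤ → ℝ)).row := by
    have : ((Matrix.of t).map (Int.cast : ℤ → ℝ)).row = (fun x : B => (x : ι → ℝ)) ∘ e := by
      funext i
      exact hft i
    rw [this]
    exact hli.comp _ e.injective
  rw [Matrix.linearIndependent_rows_iff_isUnit, Matrix.isUnit_iff_isUnit_det, isUnit_iff_ne_zero] at h1
  apply h1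
  have := Int.cast_det (R := ℝ) (Matrix.of t)
  rw [h0] at this
  simpa using this.symm

/-- The cone of forms valid on G, cut by the unit box, is a polytope with a vertex at which
evaluation at y is maximal. A vertex solves a square system formed by its tight constraints, so
Cramer's rule makes a positive multiple of it integral and bounded. -/
theorem exists_bounded_functional (G : Set (ι → ℤ)) (K : ℕ) (hK : 1 ≤ K)
    (hG : ∀ g ∈ G, ∀ i, |g i| ≤ K) (y φ : ι → ℝ) (hφ : ∀ g ∈ G, ∑ i, (g i : ℝ) * φ i ≤ 0)
    (hy : 0 < ∑ i, φ i * y i) :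
    ∃ ψ : ι → ℤ, (∀ i, |ψ i| ≤ (Fintype.card ι).factorial * K ^ Fintype.card ι) ∧
      (∀ g ∈ G, ∑ i, (g i : ℝ) * ψ i ≤ 0) ∧ 0 < ∑ i, (ψ i : ℝ) * y i := by
  have hfin : G.Finite := by
    refine (Set.finite_Icc (fun _ : ι => (-K : ℤ)) fun _ => (K : ℤ)).subset fun g hg => ?_
    exact ⟨fun i => (abs_le.1 (hG g hg i)).1, fun i => (abs_le.1 (hG g hg i)).2⟩
  let P : Set (ι → ℝ) := {x | (∀ i, |x i| ≤ 1) ∧ ∀ g ∈ G, ∑ i, (g i : ℝ) * x i ≤ 0}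
  have hclosed : IsClosed P := by
    simp only [P, Set.ofPred_and, Set.ofPred_forall]
    refine (isClosed_iInter fun i => ?_).inter (isClosed_iInter fun g => isClosed_iInter fun _ => ?_)
    · exact isClosed_le (by fun_prop) continuous_const
    · exact isClosed_le (by fun_prop) continuous_const
  have hcompact : IsCompact P := by
    refine (isCompact_Icc (a := fun _ : ι => (-1 : ℝ)) (b := fun _ => 1)).of_isClosed_subset hclosed ?_
    exact fun x hx => ⟨fun i => (abs_le.1 (hx.1 i)).1, fun i => (abs_le.1 (hx.1 i)).2⟩
  let L : (ι → ℝ) →L[ℝ] ℝ := ∑ i, (y i) • ContinuousLinearMap.proj i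
  have hL (x : ι → ℝ) : L x = ∑ i, x i * y i := by
    simp [L, mul_comm]
  obtain ⟨x0, hx0, hmax⟩ := hcompact.exists_isMaxOn ⟨0, by simp [P]⟩ L.continuous.continuousOn
  have hexp : IsExposed ℝ P (L.toExposed P) := ContinuousLinearMap.toExposed.isExposed
  have hFc : IsCompact (L.toExposed P) := hexp.isCompact hcompact
  -- An extreme point of the face where L is maximal is an extreme point of P.
  obtain ⟨e, he⟩ := hFc.extremePoints_nonempty ⟨x0, hx0, hmax⟩
  have heF : e ∈ L.toExposed P := he.1
  have heP := hexp.isExtreme.extremePoints_subset_extremePoints he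
  -- Scaled into the box, φ is a competitor with a positive value.
  have hpos : 0 < L e := by
    have hS : 0 < 1 + ∑ i, |φ i| := by positivity
    have h1 : (fun i => (1 + ∑ i, |φ i|)⁻¹ * φ i) ∈ P := by
      refine ⟨fun i => ?_, fun g hg => ?_⟩
      · rw [abs_mul, abs_of_pos (inv_pos.2 hS), inv_mul_le_iff₀ hS, mul_one]
        have : |φ i| ≤ ∑ i, |φ i| := Finset.single_le_sum (f := fun i => |φ i|)
          (fun i _ => abs_nonneg _) (Finset.mem_univ i)
        linarith
      · simp only [mul_left_comm _ (1 + ∑ i, |φ i|)⁻¹]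
        rw [← Finset.mul_sum]
        exact mul_nonpos_of_nonneg_of_nonpos (by positivity) (hφ g hg)
    refine lt_of_lt_of_le ?_ (heF.2 _ h1)
    simp only [hL, mul_assoc]
    rw [← Finset.mul_sum]
    positivity
  let T : Set (ι → ℤ) :=
    {t | (t ∈ G ∧ ∑ i, (t i : ℝ) * e i = 0) ∨ ∃ i, t = Pi.single i 1 ∧ |e i| = 1}
  -- A vector z annihilated by all tight constraints allows a small move from e in both directions
  -- ±z inside P; extremality forces z = 0.
  have hT (z : ι → ℝ) (hz : ∀ t ∈ T, ∑ i, (t i : ℝ) * z i = 0) : z = 0 := by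
    have hev : ∀ᶠ ε in nhds (0 : ℝ), (fun i => e i + ε * z i) ∈ P := by
      refine Filter.Eventually.and (Filter.eventually_all.2 fun i => ?_)
        ((Filter.eventually_all_finite hfin).2 fun g hg => ?_)
      · rcases (heP.1.1 i).eq_or_lt with h | h
        · have h1 := hz (Pi.single i 1) (Or.inr ⟨i, rfl, h⟩)
          have h2 : z i = 0 := by simpa [Pi.single_apply] using h1
          simp [h2, h]
        · have hc : ContinuousAt (fun ε : ℝ => |e i + ε * z i|) 0 := by fun_prop
          exact (hc.eventually_lt continuousAt_const (by simpa using h)).mono fun _ h => h.le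
      · have h0 (ε : ℝ) : ∑ i, (g i : ℝ) * (e i + ε * z i) =
            ∑ i, (g i : ℝ) * e i + ε * ∑ i, (g i : ℝ) * z i := by
          rw [Finset.mul_sum, ← Finset.sum_add_distrib]
          exact Finset.sum_congr rfl fun i _ => by ring
        rcases (heP.1.2 g hg).eq_or_lt with h | h
        · have h1 := hz g (Or.inl ⟨hg, h⟩)
          simp [h0, h, h1]
        · have hc : ContinuousAt (fun ε : ℝ => ∑ i, (g i : ℝ) * (e i + ε * z i)) 0 := by fun_prop
          exact (hc.eventually_lt continuousAt_const (by simpa using h)).mono fun _ h => h.le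
    obtain ⟨δ, hδ, hball⟩ := Metric.eventually_nhds_iff.1 hev
    have h1 := hball (y := δ / 2) (by simp [abs_of_pos hδ]; linarith)
    have h2 := hball (y := -(δ / 2)) (by simp [abs_of_pos hδ]; linarith)
    have h3 := heP.2 h1 h2 ⟨1 / 2, 1 / 2, by norm_num, by norm_num, by norm_num, by
      funext i
      simp
      ring⟩
    funext i
    have h4 := congrFun h3 i
    simp only [add_eq_left, mul_eq_zero] at h4
    rcases h4 with h4 | h4
    · linarith
    · exact h4
  -- The vertex solves M e = c with entries of c equal to 0 (generators) or ±1 (faces of the box);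
  -- `hK` makes the latter and the unit rows respect the bound K.
  obtain ⟨M, hM, hdet⟩ := exists_det_ne_zero T hT
  have hrow (t : ι → ℤ) (ht : t ∈ T) : (∀ j, |t j| ≤ K) ∧
      ∃ c : ℤ, |c| ≤ K ∧ ∑ j, (t j : ℝ) * e j = c := by
    have hK' : (1 : ℤ) ≤ K := by exact_mod_cast hK
    rcases ht with ⟨ht, h0⟩ | ⟨i, rfl, h1⟩
    · exact ⟨hG t ht, 0, by simp, by simpa using h0⟩
    · refine ⟨fun j => ?_, ?_⟩
      · rw [Pi.single_apply]
        split_ifs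
        · simpa using hK'
        · simp
      · rcases eq_or_eq_neg_of_abs_eq h1 with h | h
        · exact ⟨1, by simpa using hK', by simp [Pi.single_apply, h]⟩
        · exact ⟨-1, by simpa using hK', by simp [Pi.single_apply, h]⟩
  choose c hc hce using fun i => (hrow _ (hM i)).2
  obtain ⟨ψ, t, ht, hψ, hb⟩ :=
    exists_int_multiple M c e K (fun i => (hrow _ (hM i)).1) hc hdet hce
  refine ⟨ψ, hb, fun g hg => ?_, ?_⟩
  · simp only [hψ, mul_left_comm _ t]
    rw [← Finset.mul_sum]
    exact mul_nonpos_of_nonneg_of_nonpos ht.le (heP.1.2 g hg)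
  · simp only [hψ, mul_assoc]
    rw [← Finset.mul_sum, ← hL]
    positivity

end separation
-- The closed convex hull as a finite intersection of half-spaces
namespace MullerAutomaton
variable {r m : ℕ} {Q : Type*} {A : MullerAutomaton (Letter r) Q}

theorem IsGen.abs_le (hr : 2 ≤ r) {N : ℕ} {V : Fin m → ℤ} {h : ℤ} (hg : IsGen A m N V h) :
    (∀ i, |V i| ≤ (2 * r ^ N : ℕ)) ∧ |h| ≤ (2 * r ^ N : ℕ) := by
  have hr' : (1 : ℤ) ≤ r := by exact_mod_cast (by omega : 1 ≤ r)
  have hV (s : Fin m → Fin r) (l : List (Fin m → Fin r)) (hl : l.length ≤ N) (i : Fin m) :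
      |intPart s l i| ≤ (r : ℤ) ^ N := by
    obtain ⟨h1, h2⟩ := abs_intPart_le (by omega) s l i
    exact (_root_.abs_le.2 ⟨h1, h2.le⟩).trans (pow_le_pow_right₀ hr' hl)
  have hp (k : ℕ) (hk : k ≤ N) : |(r : ℤ) ^ k| ≤ (r : ℤ) ^ N := by
    rw [abs_of_nonneg (by positivity)]
    exact pow_le_pow_right₀ hr' hk
  have hsub (x y : ℤ) (hx : |x| ≤ (r : ℤ) ^ N) (hy : |y| ≤ (r : ℤ) ^ N) :
      |x - y| ≤ (2 * r ^ N : ℕ) := by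
    have := abs_sub x y
    push_cast
    linarith
  cases hg with
  | int _ _ _ _ _ _ _ _ hN =>
    exact ⟨fun i => hsub _ _ (hV _ _ (by simp; omega) i) (hV _ _ (by omega) i), by simp⟩
  | frac _ _ _ _ _ _ _ _ hN =>
    exact ⟨fun i => hsub _ _ (hV _ _ (by simp; omega) i) (hV _ _ (by simp; omega) i),
      hsub _ _ (hp _ (by simp; omega)) (hp _ (by omega))⟩

/-- The closed convex hull of the represented set is cut out by the half-spaces with bounded integer
coefficients that are valid for the generators. -/
theorem closure_convexHull_eq (hr : 2 ≤ r) (hm : 1 ≤ m) (hA : A.IsArithmetic m)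
    {E : List (Q × Letter r × Q)} (hE : ∀ e ∈ A.trans, e ∈ E) (N : ℕ)
    (R : Set ((Fin m → ℤ) × ℤ))
    (h1 : ∀ p ∈ R, ∀ V h, IsGen A m (2 * E.length + 1) V h → ∑ i, p.1 i * V i + p.2 * h ≤ 0)
    (h2 : ∀ p : (Fin m → ℤ) × ℤ,
      (∀ i, |p.1 i| ≤ ((m + 1).factorial * (2 * r ^ N) ^ (m + 1) : ℕ)) →
      |p.2| ≤ ((m + 1).factorial * (2 * r ^ N) ^ (m + 1) : ℕ) →
      (∀ V h, IsGen A m N V h → ∑ i, p.1 i * V i + p.2 * h ≤ 0) → p ∈ R) :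
    closure (convexHull ℝ (A.represented m)) =
      {x | ∀ p ∈ R, ∑ i, (p.1 i : ℝ) * x i + (p.2 : ℝ) ≤ 0} := by
  -- R need not be described exactly: soundness uses the generators up to 2|E| + 1 blocks,
  -- completeness those up to N. This slack matters because the algorithm bounds paths by letters,
  -- not by blocks.
  apply Set.Subset.antisymm
  · have hcl : {x : Fin m → ℝ | ∀ p ∈ R, ∑ i, (p.1 i : ℝ) * x i + (p.2 : ℝ) ≤ 0} =
        ⋂ p ∈ R, {x : Fin m → ℝ | ∑ i, (p.1 i : ℝ) * x i ≤ -(p.2 : ℝ)} := by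
      ext x
      simp [le_neg_iff_add_nonpos_right]
    rw [hcl]
    refine closure_minimal (convexHull_min ?_ ?_) ?_
    · rw [← hcl]
      intro x hx p hp
      refine nonpos_of_gen hr hm hE (fun V h hg => ?_) x hx
      exact_mod_cast h1 p hp V h hg
    · refine convex_iInter₂ fun p _ => convex_halfSpace_le ⟨fun x y => ?_, fun c x => ?_⟩ _
      · simp [mul_add, Finset.sum_add_distrib]
      · simp [Finset.mul_sum, mul_left_comm]
    · exact isClosed_biInter fun p _ => isClosed_le (by fun_prop) continuous_const
  · intro x hx
    by_contra hxC
    obtain ⟨f, u, hf, hu⟩ := geometric_hahn_banach_closed_point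
      (convex_convexHull ℝ (A.represented m)).closure isClosed_closure hxC
    have hrep (v : Fin m → ℝ) : f v = ∑ i, f (Pi.single i 1) * v i := by
      conv_lhs => rw [pi_eq_sum_univ' v, map_sum]
      simp [mul_comm]
    have hvalid (V : Fin m → ℤ) (h : ℤ) (hg : IsGen A m N V h) :
        ∑ i, f (Pi.single i 1) * (V i : ℝ) + (-u) * (h : ℝ) ≤ 0 := by
      refine ev_nonpos_of_gen hr hm hA (fun z hz => ?_) hg
      rw [← hrep]
      have := hf z (subset_closure (subset_convexHull ℝ _ hz))
      linarith
    -- Homogenisation: `none` indexes the coordinate h, and x becomes the vector with 1 there.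
    let G : Set (Option (Fin m) → ℤ) :=
      {g | ∃ V h, IsGen A m N V h ∧ g = fun o => o.elim h V}
    have hK : 1 ≤ 2 * r ^ N := by
      have : 1 ≤ r ^ N := Nat.one_le_pow _ _ (by omega)
      omega
    obtain ⟨ψ, hψ, hψG, hψx⟩ := exists_bounded_functional G (2 * r ^ N) hK
      (by
        rintro _ ⟨V, h, hg, rfl⟩ (_ | i)
        exacts [(hg.abs_le hr).2, (hg.abs_le hr).1 i])
      (fun o => o.elim 1 x) (fun o => o.elim (-u) fun i => f (Pi.single i 1))
      (by
        rintro _ ⟨V, h, hg, rfl⟩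
        have := hvalid V h hg
        simp only [Fintype.sum_option, Option.elim]
        rw [add_comm]
        simpa only [mul_comm] using this)
      (by
        simp only [Fintype.sum_option, Option.elim]
        rw [← hrep]
        linarith)
    rw [Fintype.card_option, Fintype.card_fin] at hψ
    have hR : ((fun i => ψ (some i), ψ none) : (Fin m → ℤ) × ℤ) ∈ R := by
      refine h2 _ (fun i => by exact_mod_cast hψ (some i)) (by exact_mod_cast hψ none)
        fun V h hg => ?_
      have := hψG _ ⟨V, h, hg, rfl⟩
      simp only [Fintype.sum_option, Option.elim] at this
      have h3 : h * ψ none + ∑ i, V i * ψ (some i) ≤ 0 := by exact_mod_cast this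
      simp only [mul_comm (ψ _)]
      linarith
    have h4 := hx _ hR
    simp only [Fintype.sum_option, Option.elim, mul_one] at hψx h4
    linarith

end MullerAutomaton
open Enc

/-! ### The algorithm -/

attribute [fun_prop] PT
attribute [fun_prop] PT.id PT.comp PT.const PT.pair PT.fst PT.snd PT.cons PT.tail PT.succ PT.some
  PT.isEmpty PT.not PT.and PT.or PT.eq PT.ite PT.append PT.map PT.all PT.any PT.mem PT.length PT.add
  PT.mul PT.le PT.sum PT.dvd PT.zip PT.headD PT.filterMap PT.flatMap PT.filter PT.replicate
  PT.optionMap PT.flatten PT.val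

/-- Natural numbers in binary. -/
abbrev Bits : Type := List Bool

/-- Transitions, with states and digits in binary. -/
abbrev Tr : Type := Bits × Option Bits × Bits

/-- Inputs: basis, dimension, number of states, transitions, initial states and accepting sets. -/
abbrev Inp : Type := Bits × Bits × Bits × List Tr × List Bits × List (List Bits) × Unit

/-- The value of a word of bits. -/
def toNat (b : Bits) : ℕ := b.foldr (fun x n => 2 * n + x.toNat) 0

/-- The value of a word of bits, for words whose length is at most `k`. -/
def bval (k : ℕ) (b : Bits) : ℕ := toNat (if b.length ≤ k then b else [])

namespace Inp

/-- The transitions. -/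
def trans (i : Inp) : List Tr := i.2.2.2.1
/-- The initial states. -/
def init (i : Inp) : List Bits := i.2.2.2.2.1
/-- The accepting sets. -/
def acc (i : Inp) : List (List Bits) := i.2.2.2.2.2.1
/-- The size parameter. -/
def par (i : Inp) : ℕ := i.1.length + i.2.1.length + i.trans.length + i.acc.flatten.length + 1
/-- The bound for the length of paths. -/
def len (i : Inp) : ℕ := 4 * (i.par + 1) * (i.par + 1)
/-- The bound for the size of coefficients. -/
def coeffLen (i : Inp) : ℕ := (i.par + 1) * (i.par + 3 + 2 * i.len * i.par)
/-- The logarithm of the size of the padding. -/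
def padLog (i : Inp) : ℕ :=
  -- The first summand covers the number of candidate forms, the second the unary numbers met along
  -- paths.
  (2 * i.coeffLen + 3) * (i.par + 1) + (i.par + 1) * (2 * i.len + 1)
/-- The states that occur as targets. -/
def states (i : Inp) : List Bits := i.trans.map fun e => e.2.2

end Inp

/-- Inputs together with a tree of exponential size. -/
abbrev Pad : Type := {p : Inp × Data // 2 ^ p.1.padLog ≤ p.2.size}

namespace Pad

/-- The input. -/
def inp (a : Pad) : Inp := a.1.1
/-- The basis. -/
def base (a : Pad) : ℕ := bval a.inp.par a.inp.1
/-- The dimension, or zero if it exceeds the number of transitions. -/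
def dim (a : Pad) : ℕ :=
  -- The cap keeps the length of the candidate forms below the size of the input; beyond it the
  -- represented set is empty.
  if bval a.inp.par a.inp.2.1 ≤ a.inp.trans.length then bval a.inp.par a.inp.2.1 else 0
/-- All lists of transitions of bounded length. -/
def paths (a : Pad) : List (List Tr) := listsLE a.inp.trans a.inp.len
/-- All coefficients of bounded size. -/
def coeffs (a : Pad) : List (Bool × Bits) :=
  -- Only canonical words occur: zero has no bits and no sign, any other number has leading bit
  -- `true`. They are thus the trees prescribed by `Data.ofInt`.
  (false, []) :: ((listsLE [false, true] a.inp.coeffLen).map (fun x => (false, x ++ [true])) ++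
    (listsLE [false, true] a.inp.coeffLen).map (fun x => (true, x ++ [true])))

end Pad

/-- Do the transitions lead from `q` to `q'`? -/
def isWalk (q : Bits) (l : List Tr) (q' : Bits) : Bool :=
  -- Sources followed by q' agree with q followed by targets exactly when the transitions are
  -- consecutive.
  decide (l.map (fun e => e.1) ++ [q'] = q :: l.map (fun e => e.2.2))

/-- Is there an accepting run from the state `q`? -/
def coacc (a : Pad) (q : Bits) : Bool :=
  a.inp.states.any fun q' => a.paths.any fun t => a.paths.any fun c =>
    isWalk q t q' && (isWalk q' c q' && (!c.isEmpty && a.inp.acc.any fun F =>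
      (F.all fun x => decide (x ∈ c.map fun e => e.1)) &&
        ((c.map fun e => e.1).all fun x => decide (x ∈ F))))

/-- Read a letter: rotate the components and multiply the first one by the basis. -/
def step (r k : ℕ) (s : List (ℕ × ℕ × ℕ) × Bool) (o : Option Bits) : List (ℕ × ℕ × ℕ) × Bool :=
  o.elim (s.1, true) fun d =>
    -- A component is a triple (positive part, negative part, scale). The list is a queue, back in
    -- its original order after each block; the flag tells that the second separator has been read,
    -- and only then is the scale multiplied.
    (s.1.tail ++ [(r * (s.1.headD (0, 0, 0)).1 + bval k d, r * (s.1.headD (0, 0, 0)).2.1,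
      if s.2 = true then r * (s.1.headD (0, 0, 0)).2.2 else (s.1.headD (0, 0, 0)).2.2)], s.2)

/-- The components that are given by the sign digits. -/
def signVec (z : List Tr) : List (ℕ × ℕ × ℕ) :=
  z.filterMap fun e => e.2.1.map fun d => if d = [] then (0, 0, 1) else (0, 1, 1)

/-- The vector after a path. -/
def pathVec (a : Pad) (z π : List Tr) : List (ℕ × ℕ × ℕ) :=
  -- The guard is harmless for the concatenation of two enumerated paths; it bounds the computed
  -- numbers on every argument.
  ((if π.length ≤ 2 * a.inp.len then π.map (fun e => e.2.1) else []).foldl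
    (step a.base a.inp.par) (signVec z, false)).1

/-- Homogeneous coordinates, as differences of natural numbers. -/
def homog (q : List (ℕ × ℕ × ℕ)) : List (ℕ × ℕ) :=
  ((q.headD (0, 0, 0)).2.2, 0) :: q.map fun x => (x.1, x.2.1)

/-- The positive part of the value of a functional. -/
def posPart (a : Pad) (φ : List (Bool × Bits)) (q : List (ℕ × ℕ × ℕ)) : ℕ :=
  ((φ.zip (homog q)).map fun p => bval (a.inp.coeffLen + 1) p.1.2 *
    if p.1.1 = true then p.2.2 else p.2.1).sum

/-- The negative part of the value of a functional. -/
def negPart (a : Pad) (φ : List (Bool × Bits)) (q : List (ℕ × ℕ × ℕ)) : ℕ :=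
  ((φ.zip (homog q)).map fun p => bval (a.inp.coeffLen + 1) p.1.2 *
    if p.1.1 = true then p.2.1 else p.2.2).sum

/-- Is the functional nonpositive on the given generator? -/
def testGen (a : Pad) (φ : List (Bool × Bits)) (z π ν : List Tr) : Bool :=
  decide (posPart a φ (pathVec a z (π ++ ν)) + negPart a φ (pathVec a z π) ≤
    posPart a φ (pathVec a z π) + negPart a φ (pathVec a z (π ++ ν)))

/-- Do the paths define a generator? -/
def isGenPath (a : Pad) (q0 q1 q2 : Bits) (z π ν : List Tr) : Bool :=
  -- For π the separator is not counted as a digit; for ν the length suffices, since for an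
  -- arithmetic automaton the remaining conditions exclude a separator in this cycle.
  isWalk q0 z q1 && (isWalk q1 π q2 && (isWalk q2 ν q2 && (decide (z.length = a.dim + 1) &&
    (decide (a.dim ∣ (π.filterMap fun e => e.2.1).length) && (decide (a.dim ∣ ν.length) &&
      coacc a q2)))))

/-- Is the functional nonpositive on all generators? -/
def valid (a : Pad) (φ : List (Bool × Bits)) : Bool :=
  a.inp.init.all fun q0 => a.inp.states.all fun q1 => a.inp.states.all fun q2 =>
    a.paths.all fun z => a.paths.all fun π => a.paths.all fun ν =>
      !(isGenPath a q0 q1 q2 z π ν) || testGen a φ z π ν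

/-- The valid functionals with bounded coefficients. -/
def functionals (a : Pad) : List (List (Bool × Bits)) :=
  (listsLE a.coeffs (a.dim + 1)).filter fun φ => decide (φ.length = a.dim + 1) && valid a φ

/-- An integer, as a rational number. -/
def toRat (x : Bool × Bits) : (Bool × Bits) × Bits := (x, [true])

/-- The output: a list of rows. -/
def output (a : Pad) : List (List ((Bool × Bits) × Bits) × ((Bool × Bits) × Bits)) :=
  if bval a.inp.par a.inp.2.1 ≤ a.inp.trans.length then
    (functionals a).map fun φ => (φ.tail.map toRat, toRat (φ.headD (false, [])))
  else [(List.replicate (bval a.inp.par a.inp.2.1) (toRat (false, [])), toRat (false, [true]))]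

/-! ### Running time, polynomial in the size of the padded input -/

section
variable {α : Type} [Enc α]

theorem toNat_lt (b : Bits) : toNat b < 2 ^ b.length := by
  induction b with
  | nil => simp [toNat]
  | cons x b ih =>
    have : toNat (x :: b) = 2 * toNat b + x.toNat := rfl
    have h2 : x.toNat ≤ 1 := Bool.toNat_le x
    rw [this, List.length_cons, pow_succ]
    omega

theorem bval_lt (k : ℕ) (b : Bits) : bval k b < 2 ^ k := by
  unfold bval
  split_ifs with h
  · exact (toNat_lt b).trans_le (Nat.pow_le_pow_right (by norm_num) h)
  · exact Nat.two_pow_pos k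

/-- The length guard in `bval` keeps the unary value below 2^k on all arguments, including those
that do not describe an automaton. -/
theorem PT.bval {k : α → ℕ} {b : α → Bits} (hk : PT k) (hb : PT b) (h : PB fun a => 2 ^ k a) :
    PT fun a => ArithAutomata.bval (k a) (b a) := by
  refine PT.foldr (l := fun a => if (b a).length ≤ k a then b a else []) (b := fun _ => 0)
    (f := fun _ x n => 2 * n + x.toNat) (by fun_prop) (PT.const _) ?_
    ⟨_, (h.mul (PB.const 2)).add (PB.const 1), fun a l hl => ?_⟩
  · have : PT fun p : α × Bool × ℕ => p.2.1.toNat :=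
      (PT.cond PT.id.snd.fst (PT.const 1) (PT.const 0)).congr_enc fun a => by
        cases a.2.1 <;> rfl
    fun_prop
  · rw [esize_nat]
    have h1 : toNat l < 2 ^ l.length := toNat_lt l
    have h2 : l.length ≤ k a := by
      refine hl.length_le.trans ?_
      split_ifs with h
      · exact h
      · exact Nat.zero_le _
    have h3 := Nat.pow_le_pow_right (n := 2) (by norm_num) h2
    have h4 : List.foldr (fun x n => 2 * n + x.toNat) 0 l = toNat l := rfl
    rw [h4]
    omega

theorem Inp.PT_trans : PT Inp.trans := by unfold Inp.trans; fun_prop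
theorem Inp.PT_init : PT Inp.init := by unfold Inp.init; fun_prop
theorem Inp.PT_acc : PT Inp.acc := by unfold Inp.acc; fun_prop
attribute [fun_prop] Inp.PT_trans Inp.PT_init Inp.PT_acc

theorem Inp.PT_states : PT Inp.states := by unfold Inp.states; fun_prop
attribute [fun_prop] Inp.PT_states

theorem Inp.PT_par : PT Inp.par := by unfold Inp.par; fun_prop
attribute [fun_prop] Inp.PT_par

theorem Inp.PT_len : PT Inp.len := by unfold Inp.len; fun_prop
attribute [fun_prop] Inp.PT_len

theorem Inp.PT_coeffLen : PT Inp.coeffLen := by unfold Inp.coeffLen; fun_prop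
attribute [fun_prop] Inp.PT_coeffLen

theorem Inp.PT_padLog : PT Inp.padLog := by unfold Inp.padLog; fun_prop

namespace Pad

theorem PB_pow {f : Pad → ℕ} (h : ∀ a, f a ≤ a.inp.padLog) : PB fun a => 2 ^ f a := by
  refine PB.esize.mono fun a => ?_
  have h1 := a.2
  have h2 : esize a = esize a.1.1 + esize a.1.2 + 1 := rfl
  have h3 : esize a.1.2 = a.1.2.size := rfl
  have h4 := Nat.pow_le_pow_right (n := 2) (by norm_num) (h a)
  unfold inp at h4
  omega

theorem par_le (a : Pad) : a.inp.par ≤ a.inp.padLog := by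
  unfold Inp.padLog; nlinarith

theorem PT_inp : PT inp := by unfold inp; fun_prop
attribute [fun_prop] PT_inp

theorem PT_base : PT base := by
  unfold base
  exact PT.bval (by fun_prop) (by fun_prop) (PB_pow par_le)
attribute [fun_prop] PT_base

theorem PT_dimVal : PT fun a : Pad => bval a.inp.par a.inp.2.1 :=
  PT.bval (by fun_prop) (by fun_prop) (PB_pow par_le)
attribute [fun_prop] PT_dimVal

theorem PT_dim : PT dim := by unfold dim; fun_prop
attribute [fun_prop] PT_dim

theorem trans_length_le (a : Pad) : a.inp.trans.length + 1 ≤ a.inp.par := by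
  unfold Inp.par; omega

theorem PT_paths : PT paths := by
  refine PT.listsLE (by fun_prop) (by fun_prop)
    ((PB_pow (f := fun a => a.inp.par * a.inp.len) fun a => ?_).mono fun a => ?_)
  · unfold Inp.padLog; nlinarith
  · rw [pow_mul]
    gcongr
    exact (trans_length_le a).trans Nat.lt_two_pow_self.le
attribute [fun_prop] PT_paths

theorem bits_pow_le (k : ℕ) : ([false, true].length + 1) ^ k ≤ 2 ^ (2 * k) := by
  rw [pow_mul]
  exact Nat.pow_le_pow_left (by norm_num) k

theorem PT_coeffs : PT coeffs := by
  have : PT fun a : Pad => listsLE [false, true] a.inp.coeffLen := by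
    refine PT.listsLE (by fun_prop) (by fun_prop)
      ((PB_pow (f := fun a => 2 * a.inp.coeffLen) fun a => ?_).mono fun a => bits_pow_le _)
    unfold Inp.padLog; nlinarith
  unfold coeffs
  fun_prop
attribute [fun_prop] PT_coeffs

theorem length_coeffs_le (a : Pad) : a.coeffs.length + 1 ≤ 2 ^ (2 * a.inp.coeffLen + 3) := by
  have h1 := length_listsLE_le [false, true] a.inp.coeffLen
  have h2 := bits_pow_le a.inp.coeffLen
  have h3 := Nat.one_le_two_pow (n := 2 * a.inp.coeffLen)
  simp only [coeffs, List.length_cons, List.length_append, List.length_map, pow_add] at *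
  omega

theorem dim_le (a : Pad) : a.dim + 1 ≤ a.inp.par := by
  have := trans_length_le a
  unfold dim
  split_ifs <;> omega

theorem PT_functionalLists : PT fun a : Pad => listsLE a.coeffs (a.dim + 1) := by
  refine PT.listsLE (by fun_prop) (by fun_prop)
    ((PB_pow (f := fun a => (2 * a.inp.coeffLen + 3) * (a.inp.par + 1)) fun a => ?_).mono fun a => ?_)
  · unfold Inp.padLog; nlinarith
  · rw [pow_mul]
    refine (Nat.pow_le_pow_left (length_coeffs_le a) _).trans ?_
    exact Nat.pow_le_pow_right (by positivity) (by have := dim_le a; omega)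
attribute [fun_prop] PT_functionalLists

end Pad
end
open Enc
section
variable {α : Type} [Enc α]

theorem PT.bval_par {a : α → Pad} {b : α → Bits} (ha : PT a) (hb : PT b) :
    PT fun x => ArithAutomata.bval (a x).inp.par (b x) :=
  PT.bval (by fun_prop) hb ((Pad.PB_pow Pad.par_le).comp ha)
attribute [fun_prop] PT.bval_par

theorem PT.bval_coeffLen {a : α → Pad} {b : α → Bits} (ha : PT a) (hb : PT b) :
    PT fun x => ArithAutomata.bval ((a x).inp.coeffLen + 1) (b x) :=
  PT.bval (by fun_prop) hb ((Pad.PB_pow (f := fun a => a.inp.coeffLen + 1)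
    fun a => by unfold Inp.padLog; nlinarith).comp ha)
attribute [fun_prop] PT.bval_coeffLen

theorem PT.isWalk {q q' : α → Bits} {l : α → List Tr} (hq : PT q) (hl : PT l) (hq' : PT q') :
    PT fun a => ArithAutomata.isWalk (q a) (l a) (q' a) := by
  unfold ArithAutomata.isWalk
  fun_prop
attribute [fun_prop] PT.isWalk

theorem PT.coacc {a : α → Pad} {q : α → Bits} (ha : PT a) (hq : PT q) :
    PT fun x => ArithAutomata.coacc (a x) (q x) := by
  unfold ArithAutomata.coacc
  refine PT.any (by fun_prop) (PT.any (by fun_prop) (PT.any (by fun_prop)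
    (PT.and (by fun_prop) (PT.and (by fun_prop) (PT.and (by fun_prop) (PT.any (by fun_prop)
      (PT.and (PT.all (by fun_prop) (by fun_prop)) (PT.all (by fun_prop) (by fun_prop)))))))))
attribute [fun_prop] PT.coacc

/-- The quantity X + 2^k, with X a bound for the entries, grows by a factor of at most r + 2 per
letter. -/
theorem step_bound (r k : ℕ) (q : List (ℕ × ℕ × ℕ)) (b : Bool) (l : List (Option Bits)) (X n : ℕ)
    (hq : ∀ x ∈ q, x.1 ≤ X ∧ x.2.1 ≤ X ∧ x.2.2 ≤ X) (hn : q.length ≤ n + 1) :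
    (l.foldl (step r k) (q, b)).1.length ≤ n + 1 ∧ ∀ x ∈ (l.foldl (step r k) (q, b)).1,
      x.1 ≤ (r + 2) ^ l.length * (X + 2 ^ k) ∧ x.2.1 ≤ (r + 2) ^ l.length * (X + 2 ^ k) ∧
        x.2.2 ≤ (r + 2) ^ l.length * (X + 2 ^ k) := by
  induction l generalizing q b X with
  | nil =>
    refine ⟨hn, fun x hx => ?_⟩
    have := hq x hx
    have := Nat.one_le_two_pow (n := k)
    simp only [List.length_nil, pow_zero, one_mul]
    omega
  | cons o l ih =>
    have hpow (Y : ℕ) (h : Y + 2 ^ k ≤ (r + 2) * (X + 2 ^ k)) :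
        (r + 2) ^ l.length * (Y + 2 ^ k) ≤ (r + 2) ^ (o :: l).length * (X + 2 ^ k) := by
      rw [List.length_cons, pow_succ, mul_assoc]
      exact Nat.mul_le_mul_left _ h
    cases o with
    | none =>
      obtain ⟨h1, h2⟩ := ih q true X hq hn
      have h3 := hpow X (Nat.le_mul_of_pos_left _ (by omega))
      exact ⟨h1, fun x hx => by have := h2 x hx; simp only [List.foldl_cons] at *; omega⟩
    | some d =>
      have h0 : (q.headD (0, 0, 0)).1 ≤ X ∧ (q.headD (0, 0, 0)).2.1 ≤ X ∧
          (q.headD (0, 0, 0)).2.2 ≤ X := by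
        cases q with
        | nil => simp
        | cons x q => exact hq x (by simp)
      have hd := bval_lt k d
      have hmul (y : ℕ) (hy : y ≤ X) : r * y ≤ r * X := Nat.mul_le_mul_left _ hy
      have m1 := hmul _ h0.1
      have m2 := hmul _ h0.2.1
      have m3 := hmul _ h0.2.2
      obtain ⟨h1, h2⟩ := ih (step r k (q, b) (some d)).1 b ((r + 1) * X + 2 ^ k) (by
        intro x hx
        simp only [step, Option.elim, List.mem_append, List.mem_singleton] at hx
        rw [add_mul, one_mul]
        rcases hx with hx | rfl
        · have := hq x (List.mem_of_mem_tail hx)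
          omega
        · refine ⟨by simp only; omega, by simp only; omega, ?_⟩
          simp only
          split_ifs <;> omega) (by
        simp only [step, Option.elim, List.length_append, List.length_tail, List.length_singleton]
        omega)
      have h3 := hpow ((r + 1) * X + 2 ^ k) (by nlinarith [Nat.zero_le (r * 2 ^ k)])
      refine ⟨h1, fun x hx => ?_⟩
      have := h2 x hx
      omega

theorem PT_pathVec : PT fun p : Pad × List Tr × List Tr => pathVec p.1 p.2.1 p.2.2 := by
  unfold pathVec
  have hs : PT fun p : Pad × List Tr × List Tr => signVec p.2.1 := by unfold signVec; fun_prop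
  have hr : PB fun a : Pad => (a.base + 2) ^ (2 * a.inp.len) := by
    refine (Pad.PB_pow (f := fun a => (a.inp.par + 1) * (2 * a.inp.len)) fun a => ?_).mono fun a => ?_
    · unfold Inp.padLog; nlinarith
    · refine (Nat.pow_le_pow_left ?_ _).trans_eq (pow_mul 2 (a.inp.par + 1) _).symm
      have h1 : a.base < 2 ^ a.inp.par := bval_lt _ _
      have h2 := Nat.one_le_two_pow (n := a.inp.par)
      rw [pow_succ]
      have h3 : 1 ≤ a.inp.par := by unfold Inp.par; omega
      have h4 := Nat.pow_le_pow_right (n := 2) (by norm_num) h3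
      omega
  have hX := ((hr.comp (PT.id.fst : PT fun p : Pad × List Tr × List Tr => p.1)).mul
    ((PB.const 1).add ((Pad.PB_pow Pad.par_le).comp PT.id.fst)))
  refine (PT.foldl (f := fun (p : Pad × List Tr × List Tr) s o => step p.1.base p.1.inp.par s o)
    (l := fun p => if p.2.2.length ≤ 2 * p.1.inp.len then p.2.2.map (fun e => e.2.1) else [])
    (b := fun p => (signVec p.2.1, false)) (by fun_prop) (by fun_prop) ?_
    ⟨_, ((((PB.length hs).add (PB.const 1)).mul (((hX.mul (PB.const 6)).add (PB.const 5)).add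
      (PB.const 1))).add (PB.const 1)).add (PB.const 4), fun p l hl => ?_⟩).fst
  · unfold step
    refine PT.optionElim (o := fun p : (Pad × List Tr × List Tr) × (List (ℕ × ℕ × ℕ) × Bool) ×
      Option Bits => p.2.2) (f := fun p => (p.2.1.1, true)) (g := fun p d => (p.2.1.1.tail ++
      [(p.1.1.base * (p.2.1.1.headD (0, 0, 0)).1 + bval p.1.1.inp.par d,
        p.1.1.base * (p.2.1.1.headD (0, 0, 0)).2.1,
        if p.2.1.2 = true then p.1.1.base * (p.2.1.1.headD (0, 0, 0)).2.2
        else (p.2.1.1.headD (0, 0, 0)).2.2)], p.2.1.2)) (by fun_prop) (by fun_prop) (by fun_prop)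
  · have hlen : l.length ≤ 2 * p.1.inp.len := by
      refine hl.length_le.trans ?_
      split_ifs with h
      · simpa using h
      · simp
    obtain ⟨h1, h2⟩ := step_bound p.1.base p.1.inp.par (signVec p.2.1) false l 1
      (signVec p.2.1).length (by
        intro x hx
        simp only [signVec, List.mem_filterMap, Option.map_eq_some_iff] at hx
        obtain ⟨e, -, d, -, rfl⟩ := hx
        split_ifs <;> simp) (by omega)
    set s := l.foldl (step p.1.base p.1.inp.par) (signVec p.2.1, false) with hsd
    have h3 : esize s = esize s.1 + esize s.2 + 1 := rfl
    have h4 := esize_bool_le s.2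
    have h5 := Nat.pow_le_pow_right (n := p.1.base + 2) (by omega) hlen
    have h6 := Nat.mul_le_mul_right (1 + 2 ^ p.1.inp.par) h5
    -- A triple of unary numbers bounded by Y has size at most 6 Y + 5.
    have h7 := esize_list_le (l := s.1) (K := (p.1.base + 2) ^ (2 * p.1.inp.len) *
      (1 + 2 ^ p.1.inp.par) * 6 + 5) fun x hx => by
        have := h2 x hx
        have e1 : esize x = esize x.1 + (esize x.2.1 + esize x.2.2 + 1) + 1 := rfl
        rw [e1, esize_nat, esize_nat, esize_nat]
        omega
    have h8 := Nat.mul_le_mul_right ((p.1.base + 2) ^ (2 * p.1.inp.len) *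
      (1 + 2 ^ p.1.inp.par) * 6 + 5 + 1) h1
    show esize s ≤ _
    omega

theorem PT.pathVec {a : α → Pad} {z π : α → List Tr} (ha : PT a) (hz : PT z) (hπ : PT π) :
    PT fun x => ArithAutomata.pathVec (a x) (z x) (π x) :=
  PT_pathVec.comp (f := fun x => (a x, z x, π x)) (ha.pair (hz.pair hπ))
attribute [fun_prop] PT.pathVec

theorem PT.posPart {a : α → Pad} {φ : α → List (Bool × Bits)} {q : α → List (ℕ × ℕ × ℕ)}
    (ha : PT a) (hφ : PT φ) (hq : PT q) :
    PT fun x => ArithAutomata.posPart (a x) (φ x) (q x) := by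
  unfold ArithAutomata.posPart homog
  fun_prop
attribute [fun_prop] PT.posPart

theorem PT.negPart {a : α → Pad} {φ : α → List (Bool × Bits)} {q : α → List (ℕ × ℕ × ℕ)}
    (ha : PT a) (hφ : PT φ) (hq : PT q) :
    PT fun x => ArithAutomata.negPart (a x) (φ x) (q x) := by
  unfold ArithAutomata.negPart homog
  fun_prop
attribute [fun_prop] PT.negPart

theorem PT.testGen {a : α → Pad} {φ : α → List (Bool × Bits)} {z π ν : α → List Tr}
    (ha : PT a) (hφ : PT φ) (hz : PT z) (hπ : PT π) (hν : PT ν) :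
    PT fun x => ArithAutomata.testGen (a x) (φ x) (z x) (π x) (ν x) := by
  unfold ArithAutomata.testGen
  fun_prop
attribute [fun_prop] PT.testGen

theorem PT.isGenPath {a : α → Pad} {q0 q1 q2 : α → Bits} {z π ν : α → List Tr}
    (ha : PT a) (h0 : PT q0) (h1 : PT q1) (h2 : PT q2) (hz : PT z) (hπ : PT π) (hν : PT ν) :
    PT fun x => ArithAutomata.isGenPath (a x) (q0 x) (q1 x) (q2 x) (z x) (π x) (ν x) := by
  unfold ArithAutomata.isGenPath
  fun_prop
attribute [fun_prop] PT.isGenPath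

theorem PT.valid {a : α → Pad} {φ : α → List (Bool × Bits)} (ha : PT a) (hφ : PT φ) :
    PT fun x => ArithAutomata.valid (a x) (φ x) := by
  unfold ArithAutomata.valid
  refine PT.all (by fun_prop) (PT.all (by fun_prop) (PT.all (by fun_prop) (PT.all (by fun_prop)
    (PT.all (by fun_prop) (PT.all (by fun_prop) (PT.or (by fun_prop) (by fun_prop)))))))
attribute [fun_prop] PT.valid

theorem PT_functionals : PT functionals := by
  unfold functionals
  fun_prop
attribute [fun_prop] PT_functionals

theorem PT_output : PT output := by
  unfold output toRat
  fun_prop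

/-! ### Padding -/

/-- The complete binary tree of depth `k`. -/
def fullTree : ℕ → Data
  | 0 => Data.nil
  | k + 1 => Data.cons (fullTree k) (fullTree k)

theorem size_fullTree (k : ℕ) : (fullTree k).size + 1 = 2 ^ (k + 1) := by
  induction k with
  | zero => rfl
  | succ k ih => simp only [fullTree, Data.size, pow_succ] at *; omega

/-- The padded input. -/
def pad (i : Inp) : Pad :=
  ⟨(i, fullTree i.padLog), by
    have := size_fullTree i.padLog
    have := Nat.one_le_two_pow (n := i.padLog)
    rw [pow_succ] at *
    simp only
    omega⟩

/-- With s + 2 instead of s as the base, a coefficient a is absorbed through a ≤ 2^a ≤ (s + 2)^a. -/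
theorem poly_le_pow (p : Polynomial ℕ) : ∃ k, ∀ s, p.eval s ≤ (s + 2) ^ k := by
  induction p using Polynomial.induction_on' with
  | add p q hp hq =>
    obtain ⟨k, hk⟩ := hp
    obtain ⟨l, hl⟩ := hq
    refine ⟨max k l + 1, fun s => ?_⟩
    have h1 := (hk s).trans (Nat.pow_le_pow_right (by omega) (le_max_left k l))
    have h2 := (hl s).trans (Nat.pow_le_pow_right (by omega) (le_max_right k l))
    have h3 : 0 ≤ (s + 2) ^ max k l * s := Nat.zero_le _
    rw [Polynomial.eval_add, pow_succ, mul_add]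
    omega
  | monomial n a =>
    refine ⟨n + a, fun s => ?_⟩
    rw [Polynomial.eval_monomial, pow_add, mul_comm]
    refine Nat.mul_le_mul (Nat.pow_le_pow_left (by omega) _) ?_
    exact Nat.lt_two_pow_self.le.trans (Nat.pow_le_pow_left (by omega) _)

/-- A function that runs in polynomial time in the size of the padding runs in exponential time. -/
theorem exists_prog_of_pad {β : Type} [Enc β] {f : Pad → β} (hf : PT f) :
    ∃ (P : Prog) (p : Polynomial ℕ), ∀ i : Inp, ∃ t, Eval P (enc i) (enc (f (pad i))) t ∧
      t ≤ 2 ^ p.eval (esize i) := by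
  obtain ⟨pE, hpE⟩ := PB.nat Inp.PT_padLog
  obtain ⟨P1, p1, h1⟩ := (PT.id.pair (Inp.PT_padLog.pair (PT.const Data.nil)) :
    PT fun i : Inp => (i, i.padLog, Data.nil))
  let g : Inp × ℕ × Data → Inp × ℕ × Data := fun s => (s.1, s.2.1 - 1, Data.cons s.2.2 s.2.2)
  have hg : PT g := PT.id.fst.pair (PT.id.snd.fst.pred.pair
    ((PT.id.snd.snd.pair PT.id.snd.snd).congr_enc fun _ => rfl))
  have hc : PT fun s : Inp × ℕ × Data => !decide (s.2.1 = 0) :=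
    (PT.eq PT.id.snd.fst (PT.const 0)).not
  have hit (i : Inp) (k : ℕ) :
      g^[k] (i, i.padLog, Data.nil) = (i, i.padLog - k, fullTree k) := by
    induction k with
    | zero => rfl
    | succ k ih => rw [Function.iterate_succ_apply', ih]; rfl
  obtain ⟨P2, p2, h2⟩ := hg
  obtain ⟨P3, p3, h3⟩ := hc
  obtain ⟨P4, p4, h4⟩ : PT fun s : Inp × ℕ × Data => (s.1, s.2.2) := PT.id.fst.pair PT.id.snd.snd
  obtain ⟨P5, p5, h5⟩ := hf
  -- The term 3 X pays for the charge of the input in each of the three compositions.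
  obtain ⟨k, hk⟩ := poly_le_pow (p1 + (Polynomial.X + 1) * (p3 + p2 + Polynomial.X) + p4 + p5 +
    3 * Polynomial.X)
  refine ⟨Prog.comp P5 (Prog.comp P4 (Prog.comp (Prog.loop P3 P2) P1)),
    Polynomial.C k * (2 * pE + Polynomial.X + 6), fun i => ?_⟩
  -- S bounds the input, every state of the doubling loop and the padded input.
  set S := esize i + 2 * i.padLog + 2 ^ (i.padLog + 1) + 3 with hS
  have hp : 1 ≤ 2 ^ i.padLog := Nat.one_le_two_pow
  have hsz (j : ℕ) (hj : j ≤ i.padLog) : esize (g^[j] (i, i.padLog, Data.nil)) ≤ S := by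
    rw [hit]
    have e0 : esize (i, i.padLog - j, fullTree j) =
      esize i + (esize (i.padLog - j) + esize (fullTree j) + 1) + 1 := rfl
    rw [e0, esize_nat]
    have e1 := size_fullTree j
    have e2 : esize (fullTree j) = (fullTree j).size := rfl
    have e3 := Nat.pow_le_pow_right (n := 2) (by norm_num) (by omega : j + 1 ≤ i.padLog + 1)
    omega
  obtain ⟨t1, e1, b1⟩ := h1 i
  obtain ⟨t2, e2, b2⟩ := eval_loop h3 h2 (S := S) i.padLog (i, i.padLog, Data.nil)
    (fun j hj => by simp only [hit]; simp; omega) (by simp only [hit]; simp) hsz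
  obtain ⟨t3, e3, b3⟩ := h4 (g^[i.padLog] (i, i.padLog, Data.nil))
  obtain ⟨t4, e4, b4⟩ := h5 (pad i)
  have e3' : Eval P4 (enc (g^[i.padLog] (i, i.padLog, Data.nil))) (enc (pad i)) t3 := by
    convert e3 using 1
    rw [hit]
    rfl
  refine ⟨_, Eval.comp (Eval.comp (Eval.comp e1 e2) e3') e4, ?_⟩
  have hi : esize i ≤ S := by omega
  have hpad : esize (pad i) ≤ S := by
    have e1 := size_fullTree i.padLog
    have e2 : esize (pad i) = esize i + (fullTree i.padLog).size + 1 := rfl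
    omega
  have c1 := b1.trans (eval_poly_mono p1 hi)
  have c3 := b3.trans (eval_poly_mono p4 (hsz _ le_rfl))
  have c4 := b4.trans (eval_poly_mono p5 hpad)
  have c2 : t2 ≤ (S + 1) * (p3.eval S + p2.eval S + S) :=
    b2.trans (Nat.mul_le_mul_right _ (by omega))
  have hkS := hk S
  simp only [Polynomial.eval_add, Polynomial.eval_mul, Polynomial.eval_X, Polynomial.eval_one,
    Polynomial.eval_ofNat] at hkS
  have hi' : (enc i).size = esize i := rfl
  refine le_trans ?_ (hkS.trans ?_)
  · omega
  · simp only [Polynomial.eval_add, Polynomial.eval_mul, Polynomial.eval_X, Polynomial.eval_C,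
      Polynomial.eval_ofNat]
    rw [mul_comm k, pow_mul]
    refine Nat.pow_le_pow_left ?_ _
    have a1 := hpE i
    have a2 := Nat.lt_two_pow_self (n := esize i)
    have a3 := Nat.lt_two_pow_self (n := i.padLog)
    refine le_trans ?_ (Nat.pow_le_pow_right (by norm_num)
      (by omega : 2 * i.padLog + esize i + 6 ≤ _))
    have a4 : 2 ^ (2 * i.padLog + esize i + 6) = 2 ^ i.padLog * 2 ^ i.padLog * 2 ^ esize i * 64 := by
      rw [pow_add, pow_add, two_mul, pow_add]; norm_num
    have a5 := Nat.one_le_two_pow (n := esize i)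
    rw [a4, hS, pow_succ]
    generalize 2 ^ i.padLog = x at *
    generalize 2 ^ esize i = y at *
    have f1 : x ≤ x * x * y := by nlinarith [Nat.mul_le_mul hp a5, Nat.mul_le_mul_left x hp]
    have f2 : y ≤ x * x * y := Nat.le_mul_of_pos_left _ (by positivity)
    nlinarith
end
open Enc

/-! ### Binary numbers -/

theorem toNat_cons (x : Bool) (b : Bits) : toNat (x :: b) = 2 * toNat b + x.toNat := rfl

theorem toNat_bits (n : ℕ) : toNat n.bits = n := by
  induction n using Nat.strong_induction_on with
  | _ n ih =>
    rcases Nat.even_or_odd' n with ⟨k, rfl | rfl⟩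
    · rcases Nat.eq_zero_or_pos k with rfl | hk
      · rfl
      · rw [Nat.bit0_bits k hk.ne', toNat_cons, ih k (by omega)]
        rfl
    · rw [Nat.bit1_bits k, toNat_cons, ih k (by omega)]
      rfl

theorem toNat_append_true_pos (b : Bits) : 0 < toNat (b ++ [true]) := by
  induction b with
  | nil => decide
  | cons x b ih => rw [List.cons_append, toNat_cons]; omega

/-- Words with leading bit `true` are fixed points of decoding and encoding, so the enumerated
coefficients are already in the output format. -/
theorem bits_toNat (b : Bits) : (toNat (b ++ [true])).bits = b ++ [true] := by
  induction b with
  | nil => simp [toNat]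
  | cons x b ih =>
    rw [List.cons_append, toNat_cons]
    cases x
    · have := Nat.bit0_bits _ (toNat_append_true_pos b).ne'
      rw [ih] at this
      simpa using this
    · have := Nat.bit1_bits (toNat (b ++ [true]))
      rw [ih] at this
      simpa using this

theorem exists_bits_eq {n : ℕ} (hn : n ≠ 0) : ∃ b, n.bits = b ++ [true] := by
  induction n using Nat.strong_induction_on with
  | _ n ih =>
    rcases Nat.even_or_odd' n with ⟨k, rfl | rfl⟩
    · obtain ⟨b, hb⟩ := ih k (by omega) (by omega)
      exact ⟨false :: b, by rw [Nat.bit0_bits k (by omega), hb]; rfl⟩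
    · rw [Nat.bit1_bits k]
      rcases Nat.eq_zero_or_pos k with rfl | hk
      · exact ⟨[], by simp⟩
      · obtain ⟨b, hb⟩ := ih k (by omega) (by omega)
        exact ⟨true :: b, by rw [hb]; rfl⟩

theorem bits_injective : Function.Injective Nat.bits :=
  Function.LeftInverse.injective toNat_bits

theorem bval_bits {k n : ℕ} (h : n < 2 ^ k) : bval k n.bits = n := by
  have : n.bits.length ≤ k := by rw [Nat.size_eq_bits_len]; exact Nat.size_le.2 h
  rw [bval, if_pos this, toNat_bits]

/-- The value of a coefficient. -/
def cval (x : Bool × Bits) : ℤ := if x.1 = true then -(toNat x.2 : ℤ) else toNat x.2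

theorem mem_coeffs {a : Pad} {x : Bool × Bits} : x ∈ a.coeffs ↔
    x = (false, []) ∨ ∃ s b, x = (s, b ++ [true]) ∧ b.length ≤ a.inp.coeffLen := by
  have h (b : List Bool) : b ∈ listsLE [false, true] a.inp.coeffLen ↔
      b.length ≤ a.inp.coeffLen := by
    rw [mem_listsLE]
    exact ⟨fun h => h.1, fun h => ⟨h, fun x _ => by cases x <;> simp⟩⟩
  simp only [Pad.coeffs, List.mem_cons, List.mem_append, List.mem_map, h]
  constructor
  · rintro (h | ⟨b, hb, rfl⟩ | ⟨b, hb, rfl⟩)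
    exacts [Or.inl h, Or.inr ⟨_, b, rfl, hb⟩, Or.inr ⟨_, b, rfl, hb⟩]
  · rintro (h | ⟨s, b, rfl, hb⟩)
    · exact Or.inl h
    · cases s
      exacts [Or.inr (Or.inl ⟨b, hb, rfl⟩), Or.inr (Or.inr ⟨b, hb, rfl⟩)]

theorem enc_coeff {a : Pad} {x : Bool × Bits} (hx : x ∈ a.coeffs) :
    enc x = Data.ofInt (cval x) := by
  rcases mem_coeffs.1 hx with rfl | ⟨s, b, rfl, -⟩
  · simp [cval, toNat, Data.ofInt, Data.ofNat, enc]
  · have h := toNat_append_true_pos b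
    have e := bits_toNat b
    cases s
    · simp only [cval, Data.ofInt, Data.ofNat, enc]
      simp only [Bool.false_eq_true, ↓reduceIte, Int.natAbs_natCast, e,
        decide_eq_false (Int.natCast_nonneg (toNat (b ++ [true]))).not_gt]
    · simp only [cval, Data.ofInt, Data.ofNat, enc]
      simp [e, h]

theorem enc_toRat {a : Pad} {x : Bool × Bits} (hx : x ∈ a.coeffs) :
    enc (toRat x) = Data.ofRat (cval x : ℤ) := by
  have h : enc (toRat x) = Data.cons (enc x) (enc ([true] : Bits)) := rfl
  rw [h, enc_coeff hx, Data.ofRat]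
  simp [Data.ofNat, enc]

theorem exists_coeff {a : Pad} {z : ℤ} (hz : z.natAbs < 2 ^ (a.inp.coeffLen + 1)) :
    ∃ x ∈ a.coeffs, cval x = z := by
  rcases eq_or_ne z 0 with rfl | h0
  · exact ⟨_, mem_coeffs.2 (Or.inl rfl), rfl⟩
  · obtain ⟨b, hb⟩ := exists_bits_eq (Int.natAbs_ne_zero.2 h0)
    have hlen : b.length ≤ a.inp.coeffLen := by
      have := Nat.size_le.2 hz
      rw [← Nat.size_eq_bits_len, hb] at this
      simpa using this
    refine ⟨(decide (z < 0), b ++ [true]), mem_coeffs.2 (Or.inr ⟨_, b, rfl, hlen⟩), ?_⟩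
    rw [cval, ← hb, toNat_bits]
    simp only [decide_eq_true_eq]
    split_ifs <;> omega

theorem bval_coeff {a : Pad} {x : Bool × Bits} (hx : x ∈ a.coeffs) :
    bval (a.inp.coeffLen + 1) x.2 = toNat x.2 := by
  rw [bval, if_pos]
  rcases mem_coeffs.1 hx with rfl | ⟨s, b, rfl, h⟩
  · simp
  · simpa using h

/-! ### The vectors that are computed -/

/-- A list of components represents the vector `V` with the scale `h`. -/
def Rep {m : ℕ} (q : List (ℕ × ℕ × ℕ)) (V : Fin m → ℤ) (h : ℕ) : Prop :=
  ∃ t : Fin m → ℕ × ℕ × ℕ, q = List.ofFn t ∧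
    ∀ i, ((t i).1 : ℤ) - (t i).2.1 = V i ∧ (t i).2.2 = h

/-- The code of a letter. -/
def letterCode {r : ℕ} (o : Letter r) : Option Bits := o.map fun d : Fin r => (d : ℕ).bits

section
variable {r m k : ℕ}

/-- The entries read are updated and reappear behind q'. For q' empty and one block of digits this
is one full rotation. -/
theorem step_foldl (hrk : r ≤ 2 ^ k) (q q' : List (ℕ × ℕ × ℕ)) (b : Bool) (d : List (Fin r))
    (h : q.length = d.length) :
    ((d.map some).map letterCode).foldl (step r k) (q ++ q', b) =
      (q' ++ List.zipWith (fun x (d : Fin r) =>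
        (r * x.1 + d, r * x.2.1, if b = true then r * x.2.2 else x.2.2)) q d, b) := by
  induction d generalizing q q' with
  | nil => simp [List.length_eq_zero_iff.1 h]
  | cons c d ih =>
    cases q with
    | nil => simp at h
    | cons x q =>
      have hs : step r k (x :: q ++ q', b) (letterCode (some c)) = (q ++ (q' ++
          [(r * x.1 + c, r * x.2.1, if b = true then r * x.2.2 else x.2.2)]), b) := by
        simp [step, letterCode, bval_bits (c.2.trans_le hrk)]
      rw [List.map_cons, List.map_cons, List.foldl_cons, hs, ih _ _ (by simpa using h)]
      simp

theorem Rep.foldl (hrk : r ≤ 2 ^ k) {q : List (ℕ × ℕ × ℕ)} {s : Fin m → Fin r}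
    {l : List (Fin m → Fin r)} {h : ℕ} (hq : Rep q (intPart s l) h) (b : Bool)
    (u : List (Fin m → Fin r)) :
    ∃ q', (((flat u).map some).map letterCode).foldl (step r k) (q, b) = (q', b) ∧
      Rep q' (intPart s (l ++ u)) (if b = true then r ^ u.length * h else h) := by
  induction u generalizing q l h with
  | nil => exact ⟨q, rfl, by simpa using hq⟩
  | cons c u ih =>
    obtain ⟨t, rfl, ht⟩ := hq
    have h1 := step_foldl hrk (List.ofFn t) [] b (List.ofFn c) (by simp)
    have h2 : Rep (List.zipWith (fun x (d : Fin r) =>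
        (r * x.1 + d, r * x.2.1, if b = true then r * x.2.2 else x.2.2)) (List.ofFn t)
          (List.ofFn c)) (intPart s (l ++ [c])) (if b = true then r * h else h) := by
      refine ⟨fun i => (r * (t i).1 + c i, r * (t i).2.1, if b = true then r * (t i).2.2 else (t i).2.2),
        ?_, fun i => ⟨?_, ?_⟩⟩
      · apply List.ext_getElem <;> simp
      · rw [intPart_append_singleton, ← (ht i).1]
        push_cast
        ring
      · simp only [(ht i).2]
    obtain ⟨q', h3, h4⟩ := ih h2
    refine ⟨q', ?_, ?_⟩
    · have : flat (c :: u) = List.ofFn c ++ flat u := rfl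
      rw [this, List.map_append, List.map_append, List.foldl_append]
      rw [List.append_nil, List.nil_append] at h1
      rw [h1, h3]
    · rw [List.append_assoc] at h4
      have e : (if b = true then r ^ (c :: u).length * h else h) = if b = true then
          r ^ u.length * (if b = true then r * h else h) else (if b = true then r * h else h) := by
        cases b
        · rfl
        · simp only [if_true, List.length_cons, pow_succ]; ring
      rw [e]
      exact h4

theorem posPart_sub_negPart {a : Pad} {β : Bool × Bits} {α : Fin m → Bool × Bits} (hm : 1 ≤ m)
    (hβ : β ∈ a.coeffs) (hα : ∀ i, α i ∈ a.coeffs) {q : List (ℕ × ℕ × ℕ)} {V : Fin m → ℤ} {h : ℕ}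
    (hq : Rep q V h) :
    (posPart a (β :: List.ofFn α) q : ℤ) - negPart a (β :: List.ofFn α) q =
      ∑ i, cval (α i) * V i + cval β * h := by
  obtain ⟨t, rfl, ht⟩ := hq
  have key (x : Bool × Bits) (y : ℕ × ℕ) (hx : x ∈ a.coeffs) :
      ((bval (a.inp.coeffLen + 1) x.2 * if x.1 = true then y.2 else y.1 : ℕ) : ℤ) -
        ((bval (a.inp.coeffLen + 1) x.2 * if x.1 = true then y.1 else y.2 : ℕ) : ℤ) =
        cval x * (y.1 - y.2) := by
    rw [bval_coeff hx, cval]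
    split_ifs <;> push_cast <;> ring
  have hz : (β :: List.ofFn α).zip (homog (List.ofFn t)) =
      (β, (h, 0)) :: List.ofFn fun i => (α i, ((t i).1, (t i).2.1)) := by
    -- All components carry the same scale; it is read in the first one, which exists because the
    -- dimension is positive.
    have h0 : ((List.ofFn t).headD (0, 0, 0)).2.2 = h := by
      cases m with
      | zero => omega
      | succ m =>
        rw [List.ofFn_succ]
        exact (ht 0).2
    rw [homog, h0, List.zip_cons_cons]
    congr 1
    apply List.ext_getElem <;> simp
  rw [posPart, negPart, hz]
  simp only [List.map_cons, List.sum_cons, List.map_ofFn, List.sum_ofFn, Function.comp_def]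
  have h1 := key β (h, 0) hβ
  simp only [Nat.cast_zero, sub_zero] at h1
  push_cast at h1 ⊢
  rw [add_sub_add_comm, ← Finset.sum_sub_distrib, h1, add_comm]
  congr 1
  refine Finset.sum_congr rfl fun i _ => ?_
  have h2 := key (α i) ((t i).1, (t i).2.1) (hα i)
  simp only [(ht i).1] at h2
  push_cast at h2
  exact h2

end
open Enc MullerAutomaton

/-! ### Parsing of words -/

section streams
variable {α β : Type*}

theorem append_eq_map {f : α → β} {x : List β} {y : Stream' β} {w : Stream' α}
    (h : x ++ₛ y = w.map f) : ∃ (d : List α) (w' : Stream' α), x = d.map f ∧ y = Stream'.map f w' := by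
  have h1 : w.map f = (w.take x.length).map f ++ₛ (w.drop x.length).map f := by
    rw [← Stream'.map_append_stream, Stream'.append_take_drop]
  rw [h1] at h
  exact ⟨_, _, append_stream_inj (by simp) h⟩

/-- The prefix x stops either before the separator or after it; accordingly a path lies in the
integer part or reaches the fractional part. -/
theorem append_eq_some_append {x : List (Option α)} {y : Stream' (Option α)} {d : List α}
    {w : Stream' α} (h : x ++ₛ y = d.map some ++ₛ ([none] ++ₛ w.map some)) :
    (∃ d1 d2 : List α, d = d1 ++ d2 ∧ x = d1.map some ∧ y = d2.map some ++ₛ ([none] ++ₛ w.map some)) ∨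
      ∃ (e : List α) (w' : Stream' α), x = d.map some ++ none :: e.map some ∧ y = Stream'.map some w' := by
  induction x generalizing d with
  | nil => exact Or.inl ⟨[], d, rfl, rfl, h⟩
  | cons a x ih =>
    have h0 := congrFun h 0
    cases d with
    | nil =>
      have h0 : a = none := h0
      obtain ⟨e, w', h1, h2⟩ := append_eq_map (x := x) (y := y) (w := w) (f := some)
        (funext fun n => congrFun h (n + 1))
      exact Or.inr ⟨e, w', by rw [h0, h1]; rfl, h2⟩
    | cons b d =>
      have h0 : a = some b := h0
      rcases ih (d := d) (funext fun n => congrFun h (n + 1)) with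
        ⟨d1, d2, h1, h2, h3⟩ | ⟨e, w', h1, h2⟩
      · exact Or.inl ⟨b :: d1, d2, by rw [h1]; rfl, by rw [h0, h2]; rfl, h3⟩
      · exact Or.inr ⟨e, w', by rw [h0, h1]; rfl, h2⟩

end streams

/-! ### The algorithm on codes of automata -/

/-- The code of a transition. -/
def trCode {r n : ℕ} (e : Fin n × Letter r × Fin n) : Tr :=
  ((e.1 : ℕ).bits, letterCode e.2.1, (e.2.2 : ℕ).bits)

/-- The input that describes an automaton. -/
def inpCode {r n : ℕ} (m : ℕ) (c : AutomatonCode r n) : Inp :=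
  (r.bits, m.bits, n.bits, c.trans.map trCode, c.init.map fun q : Fin n => (q : ℕ).bits,
    c.acc.map (List.map fun q : Fin n => (q : ℕ).bits), ())

section
variable {r n m : ℕ} {c : AutomatonCode r n}

theorem enc_letterCode (o : Letter r) : enc (letterCode o) = Data.ofLetter o := by
  cases o <;> rfl

theorem enc_list_map {α β : Type} [Enc β] (f : α → β) (l : List α) :
    enc (l.map f) = Data.ofList (l.map fun a => enc (f a)) := by
  show Data.ofList _ = _
  rw [List.map_map]
  rfl

theorem enc_inpCode : enc (inpCode m c) = c.toData m := by
  have h1 : enc (c.trans.map trCode) = Data.ofList (c.trans.map fun e =>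
      Data.cons (Data.ofNat e.1) (Data.cons (Data.ofLetter e.2.1) (Data.ofNat e.2.2))) := by
    rw [enc_list_map]
    congr 2
    funext e
    rw [← enc_letterCode]
    rfl
  have h2 : enc (c.init.map fun q : Fin n => (q : ℕ).bits) =
      Data.ofList (c.init.map fun q : Fin n => Data.ofNat q) := enc_list_map _ _
  have h3 : enc (c.acc.map (List.map fun q : Fin n => (q : ℕ).bits)) =
      Data.ofList (c.acc.map fun l => Data.ofList (l.map fun q : Fin n => Data.ofNat q)) := by
    rw [enc_list_map]
    congr 2
    funext l
    exact enc_list_map _ _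
  -- In `AutomatonCode.toData`, lists of states are coerced to lists of numbers by a monadic bind,
  -- which is turned back into a `map` here.
  have h4 (l : List (Fin n)) : (do let a ← l; pure (a : ℕ)).map (fun q => Data.ofNat q) =
      l.map fun q : Fin n => Data.ofNat q := by
    rw [List.map_eq_flatMap (l := l)]
    simp [List.map_flatMap]
  simp only [AutomatonCode.toData, h4]
  rw [← h1, ← h2, ← h3]
  rfl

theorem state_injective : Function.Injective fun q : Fin n => (q : ℕ).bits :=
  bits_injective.comp Fin.val_injective

theorem walk_iff {q q' : Fin n} {l : List (Fin n × Letter r × Fin n)} :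
    c.toMuller.Walk q l q' ↔ isWalk (q : ℕ).bits (l.map trCode) (q' : ℕ).bits = true ∧
      ∀ e ∈ l, e ∈ c.trans := by
  induction l generalizing q with
  | nil =>
    simp only [Walk, isWalk, List.map_nil, List.nil_append, decide_eq_true_eq, List.not_mem_nil,
      false_imp_iff, implies_true, and_true, List.cons.injEq]
    exact ⟨fun h => by rw [h], fun h => (state_injective h).symm⟩
  | cons e l ih =>
    have h1 : e ∈ c.toMuller.trans ↔ e ∈ c.trans := Iff.rfl
    have h2 : (e.1 : ℕ).bits = (q : ℕ).bits ↔ e.1 = q := state_injective.eq_iff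
    simp only [Walk, ih, isWalk, List.map_cons, List.cons_append, decide_eq_true_eq,
      List.cons.injEq, List.forall_mem_cons, h1, trCode, h2]
    tauto

theorem exists_eq_map {α β : Type*} {f : α → β} {L : List α} {l : List β} :
    (∀ x ∈ l, x ∈ L.map f) ↔ ∃ l' : List α, l = l'.map f ∧ ∀ e ∈ l', e ∈ L := by
  constructor
  · intro h
    induction l with
    | nil => exact ⟨[], rfl, by simp⟩
    | cons x l ih =>
      obtain ⟨l', h1, h2⟩ := ih fun y hy => h y (List.mem_cons_of_mem _ hy)
      obtain ⟨e, he, rfl⟩ := List.mem_map.1 (h x List.mem_cons_self)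
      exact ⟨e :: l', by rw [h1]; rfl, List.forall_mem_cons.2 ⟨he, h2⟩⟩
  · rintro ⟨l', rfl, h⟩ x hx
    obtain ⟨e, he, rfl⟩ := List.mem_map.1 hx
    exact List.mem_map_of_mem (h e he)

theorem mem_paths {l : List Tr} : l ∈ (pad (inpCode m c)).paths ↔
    ∃ E : List (Fin n × Letter r × Fin n), l = E.map trCode ∧ E.length ≤ (inpCode m c).len ∧ ∀ e ∈ E, e ∈ c.trans := by
  have : (pad (inpCode m c)).paths = listsLE (c.trans.map trCode) (inpCode m c).len := rfl
  rw [this, mem_listsLE, exists_eq_map]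
  constructor
  · rintro ⟨h, E, rfl, hE⟩
    exact ⟨E, rfl, by simpa using h, hE⟩
  · rintro ⟨E, rfl, h, hE⟩
    exact ⟨by simpa using h, E, rfl, hE⟩

theorem map_mem_paths {q q' : Fin n} {l : List (Fin n × Letter r × Fin n)}
    (h : c.toMuller.Walk q l q') (hl : l.length ≤ (inpCode m c).len) :
    l.map trCode ∈ (pad (inpCode m c)).paths :=
  mem_paths.2 ⟨l, rfl, hl, (walk_iff.1 h).2⟩

theorem mem_states {b : Bits} : b ∈ (inpCode m c).states ↔ ∃ e ∈ c.trans, (e.2.2 : ℕ).bits = b := by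
  have : (inpCode m c).states = (c.trans.map trCode).map fun e => e.2.2 := rfl
  rw [this, List.map_map, List.mem_map]
  rfl

theorem exists_mem_of_walk {q q' : Fin n} {l : List (Fin n × Letter r × Fin n)}
    (h : c.toMuller.Walk q l q') (hl : l ≠ []) : (q' : ℕ).bits ∈ (inpCode m c).states := by
  induction l generalizing q with
  | nil => exact absurd rfl hl
  | cons e l ih =>
    cases l with
    | nil => exact mem_states.2 ⟨e, h.1, by rw [h.2.2]⟩
    | cons e' l => exact ih h.2.2 (List.cons_ne_nil _ _)

theorem par_eq : (inpCode m c).par =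
    r.bits.length + m.bits.length + c.trans.length + c.acc.flatten.length + 1 := by
  simp only [Inp.par, Inp.trans, Inp.acc, inpCode, List.length_map, List.length_flatten,
    List.map_map]
  congr 3
  apply List.map_congr_left
  intro l _
  simp

theorem le_len {x : ℕ} (h : x ≤ 4 * ((inpCode m c).par + 1) * ((inpCode m c).par + 1)) :
    x ≤ (inpCode m c).len := h

theorem coacc_iff (q : Fin n) :
    coacc (pad (inpCode m c)) (q : ℕ).bits = true ↔ ∃ y, c.toMuller.Accepts q y := by
  simp only [coacc, List.any_eq_true, Bool.and_eq_true, List.all_eq_true, decide_eq_true_eq,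
    Bool.not_eq_true', List.isEmpty_eq_false_iff]
  have hinp : (pad (inpCode m c)).inp = inpCode m c := rfl
  have hacc : (inpCode m c).acc = c.acc.map (List.map fun q : Fin n => (q : ℕ).bits) := rfl
  have hc (l : List (Fin n × Letter r × Fin n)) : ((l.map trCode).map fun e => e.1) =
      (l.map Prod.fst).map fun q : Fin n => (q : ℕ).bits := by
    rw [List.map_map, List.map_map]; rfl
  rw [hinp, hacc]
  constructor
  · rintro ⟨q', hq', t, ht, s, hs, h1, h2, h3, F, hF, h4, h5⟩
    obtain ⟨e, -, rfl⟩ := mem_states.1 hq'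
    obtain ⟨t, rfl, -, ht⟩ := mem_paths.1 ht
    obtain ⟨s, rfl, -, hs⟩ := mem_paths.1 hs
    obtain ⟨F, hF', rfl⟩ := List.mem_map.1 hF
    rw [hc] at h4 h5
    refine Cert.exists_accepts (A := c.toMuller) (q := q) (q' := e.2.2) (t := t) (c := s)
      ⟨walk_iff.2 ⟨h1, ht⟩, walk_iff.2 ⟨h2, hs⟩, by simpa using h3, F, hF', ?_⟩
    ext x
    constructor
    · intro hx
      exact (List.mem_map_of_injective state_injective).1 (h5 _ (List.mem_map_of_mem hx))
    · intro hx
      exact (List.mem_map_of_injective state_injective).1 (h4 _ (List.mem_map_of_mem hx))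
  · rintro ⟨y, hy⟩
    -- Each accepting list is at most as long as all of them together, a quantity contained in
    -- `par`; so `len`, quadratic in `par`, exceeds the length of the cycle.
    obtain ⟨q', t, s, ⟨h1, h2, h3, F, hF, h4⟩, ht, hs⟩ := hy.exists_cert (E := c.trans)
      (N := c.acc.flatten.length) (fun e he => he) (by
        rintro F ⟨l, hl, rfl⟩
        exact ⟨l, rfl, (List.sublist_flatten_of_mem hl).length_le⟩)
    have hp := par_eq (m := m) (c := c)
    refine ⟨_, exists_mem_of_walk h2 h3, _, map_mem_paths h1 (le_len ?_), _,
      map_mem_paths h2 (le_len ?_), (walk_iff.1 h1).1, (walk_iff.1 h2).1, by simpa using h3, _,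
      List.mem_map_of_mem hF, ?_, ?_⟩
    · nlinarith
    · have a1 : c.trans.length ≤ (inpCode m c).par + 1 := by omega
      have a2 : c.acc.flatten.length ≤ (inpCode m c).par + 1 := by omega
      have := Nat.mul_le_mul a2 a1
      nlinarith
    · rw [hc]
      intro x hx
      obtain ⟨x, hx', rfl⟩ := List.mem_map.1 hx
      exact List.mem_map_of_mem (h4.symm.subset hx')
    · rw [hc]
      intro x hx
      obtain ⟨x, hx', rfl⟩ := List.mem_map.1 hx
      exact List.mem_map_of_mem (h4.subset hx')

theorem bval_par_base : (pad (inpCode m c)).base = r := by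
  have := par_eq (m := m) (c := c)
  show toNat (if r.bits.length ≤ (inpCode m c).par then r.bits else []) = _
  rw [if_pos (by omega), toNat_bits]

theorem bval_par_dim : bval (inpCode m c).par m.bits = m := by
  have := par_eq (m := m) (c := c)
  rw [bval, if_pos (by omega), toNat_bits]

theorem base_le : r ≤ 2 ^ (inpCode m c).par := by
  have h1 := par_eq (m := m) (c := c)
  have h2 : r < 2 ^ r.bits.length := by rw [Nat.size_eq_bits_len]; exact Nat.lt_size_self r
  exact h2.le.trans (Nat.pow_le_pow_right (by norm_num) (by omega))

theorem pad_dim (h : m ≤ c.trans.length) : (pad (inpCode m c)).dim = m := by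
  show (if bval (inpCode m c).par m.bits ≤ (c.trans.map trCode).length then
    bval (inpCode m c).par m.bits else 0) = m
  rw [bval_par_dim, List.length_map, if_pos h]

theorem signVec_map {z : List (Fin n × Letter r × Fin n)} {s : Fin m → Fin r}
    (hz : labels z = (List.ofFn s).map some ++ [none]) :
    Rep (signVec (z.map trCode)) (intPart s []) 1 := by
  refine ⟨fun i => if (s i : ℕ) = 0 then (0, 0, 1) else (0, 1, 1), ?_, fun i => ?_⟩
  · have h1 : signVec (z.map trCode) = (labels z).filterMap fun o =>
        (letterCode o).map fun d => if d = [] then (0, 0, 1) else (0, 1, 1) := by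
      rw [signVec, labels, List.filterMap_map, List.filterMap_map]
      rfl
    have h2 (d : ℕ) : d.bits = [] ↔ d = 0 := by
      rw [← Nat.zero_bits]
      exact bits_injective.eq_iff
    rw [h1, hz, List.filterMap_append, List.filterMap_map]
    simp [letterCode, Function.comp_def, h2]
  · simp only [intPart, List.foldl_nil]
    split_ifs <;> simp

theorem labels_trCode (π : List (Fin n × Letter r × Fin n)) :
    (π.map trCode).map (fun e => e.2.1) = (labels π).map letterCode := by
  rw [labels, List.map_map, List.map_map]
  rfl

/-- The flag b tells whether the path crosses the separator. If not, the scale stays 1 before and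
after the cycle, and the difference of scales is the 0 of `IsGen.int`; if so, it gives the
difference of powers of `IsGen.frac`. One test serves both kinds. -/
theorem pathVec_map {z π : List (Fin n × Letter r × Fin n)} (b : Bool) {s : Fin m → Fin r}
    {l u : List (Fin m → Fin r)} (hz : labels z = (List.ofFn s).map some ++ [none])
    (hπ : labels π = (flat l).map some ++ if b = true then none :: (flat u).map some else [])
    (hl : π.length ≤ 2 * (inpCode m c).len) :
    Rep (pathVec (pad (inpCode m c)) (z.map trCode) (π.map trCode))
      (intPart s (if b = true then l ++ u else l)) (if b = true then r ^ u.length else 1) := by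
  have h0 := signVec_map hz
  rw [pathVec, List.length_map]
  rw [if_pos (show π.length ≤ 2 * (pad (inpCode m c)).inp.len from hl), labels_trCode, hπ,
    bval_par_base]
  obtain ⟨q, h1, h2⟩ := h0.foldl base_le false l (k := (inpCode m c).par)
  have hp : (pad (inpCode m c)).inp.par = (inpCode m c).par := rfl
  rw [hp, List.map_append, List.foldl_append, h1]
  cases b
  · simpa using h2
  · simp only [if_true, List.map_cons, List.foldl_cons]
    obtain ⟨q', h3, h4⟩ := h2.foldl base_le true u (k := (inpCode m c).par)
    have hs : step r (inpCode m c).par (q, false) (letterCode (none : Letter r)) = (q, true) := rfl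
    rw [hs, h3]
    simpa using h4

end
open Enc MullerAutomaton

/-! ### Correctness of the algorithm -/

section
variable {r n m : ℕ} {c : AutomatonCode r n}

/-- The values of the coefficients of a functional. -/
def rowVal (m : ℕ) (φ : List (Bool × Bits)) : (Fin m → ℤ) × ℤ :=
  (fun i => cval (φ.tail.getD i (false, [])), cval (φ.headD (false, [])))

theorem testGen_iff {a : Pad} {β : Bool × Bits} {α : Fin m → Bool × Bits} (hm : 1 ≤ m)
    (hβ : β ∈ a.coeffs) (hα : ∀ i, α i ∈ a.coeffs) {z π ν : List Tr} {V V' : Fin m → ℤ} {h h' : ℕ}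
    (h1 : Rep (pathVec a z π) V h) (h2 : Rep (pathVec a z (π ++ ν)) V' h') :
    testGen a (β :: List.ofFn α) z π ν = true ↔
      ∑ i, cval (α i) * (V' i - V i) + cval β * ((h' : ℤ) - h) ≤ 0 := by
  have e1 := posPart_sub_negPart hm hβ hα h1
  have e2 := posPart_sub_negPart hm hβ hα h2
  have e3 : ∑ i, cval (α i) * (V' i - V i) + cval β * ((h' : ℤ) - h) =
      (∑ i, cval (α i) * V' i + cval β * h') - (∑ i, cval (α i) * V i + cval β * h) := by
    simp only [mul_sub, Finset.sum_sub_distrib]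
    ring
  rw [testGen, decide_eq_true_eq, e3, ← e1, ← e2]
  omega

theorem labels_length (π : List (Fin n × Letter r × Fin n)) : (labels π).length = π.length := by
  simp [labels]

theorem digits_eq (π : List (Fin n × Letter r × Fin n)) :
    ((π.map trCode).filterMap fun e => e.2.1).length = ((labels π).filterMap _root_.id).length := by
  rw [labels, List.filterMap_map, List.filterMap_map]
  induction π with
  | nil => rfl
  | cons e π ih =>
    obtain ⟨p, o, q⟩ := e
    cases o with
    | none => exact ih
    | some d => exact congrArg (· + 1) ih

theorem digits_map_some (d : List (Fin r)) : (d.map some).filterMap _root_.id = d := by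
  simp [List.filterMap_map]

theorem digits_map_some_append (d e : List (Fin r)) :
    (d.map some ++ none :: e.map some).filterMap _root_.id = d ++ e := by
  simp [List.filterMap_map]

theorem labels_append {α Q : Type*} (l l' : List (Q × α × Q)) :
    labels (l ++ l') = labels l ++ labels l' := List.map_append

/-- A path of 2|E| + 1 blocks, with one more letter for a separator, is among the enumerated ones as
soon as m ≤ |E|. -/
theorem mul_add_one_le_len {x y : ℕ} (h : m ≤ c.trans.length) (hx : x ≤ (2 * c.trans.length + 1) * m)
    (hy : y ≤ x + 1) : y ≤ (inpCode m c).len := by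
  have := par_eq (m := m) (c := c)
  apply le_len
  nlinarith

/-- A functional that passes all tests is nonpositive on the generators of bounded length. -/
theorem nonpos_of_valid (hm : 1 ≤ m) (hT : m ≤ c.trans.length) {β : Bool × Bits}
    {α : Fin m → Bool × Bits} (hβ : β ∈ (pad (inpCode m c)).coeffs)
    (hα : ∀ i, α i ∈ (pad (inpCode m c)).coeffs)
    (hv : valid (pad (inpCode m c)) (β :: List.ofFn α) = true) {V : Fin m → ℤ} {h : ℤ}
    (hg : IsGen c.toMuller m (2 * c.trans.length + 1) V h) :
    ∑ i, cval (α i) * V i + cval β * h ≤ 0 := by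
  simp only [valid, List.all_eq_true, Bool.or_eq_true, Bool.not_eq_true'] at hv
  have hinit (q : Fin n) (hq : q ∈ c.toMuller.init) :
      (q : ℕ).bits ∈ (pad (inpCode m c)).inp.init := List.mem_map_of_mem hq
  have key {q0 q1 q2 : Fin n} {z π ν : List (Fin n × Letter r × Fin n)} (h0 : q0 ∈ c.toMuller.init)
      (hz : c.toMuller.Walk q0 z q1) (hπ : c.toMuller.Walk q1 π q2) (hν : c.toMuller.Walk q2 ν q2)
      (hy : ∃ y, c.toMuller.Accepts q2 y) (hzl : z.length = m + 1)
      (hπl : π.length ≤ (inpCode m c).len) (hνl : ν.length ≤ (inpCode m c).len)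
      (hπd : m ∣ ((labels π).filterMap _root_.id).length) (hνd : m ∣ ν.length) :
      testGen (pad (inpCode m c)) (β :: List.ofFn α) (z.map trCode) (π.map trCode)
        (ν.map trCode) = true := by
    have hzn : z ≠ [] := by rintro rfl; simp at hzl
    have hzl' : z.length ≤ (inpCode m c).len := by
      rw [hzl]
      exact mul_add_one_le_len hT (Nat.le_mul_of_pos_left m (by omega)) le_rfl
    refine (hv _ (hinit _ h0) _ (exists_mem_of_walk hz hzn) _
      (exists_mem_of_walk (hz.append hπ) (by simp [hzn])) _ (map_mem_paths hz hzl') _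
      (map_mem_paths hπ hπl) _ (map_mem_paths hν hνl)).resolve_left ?_
    simp only [isGenPath, pad_dim hT, (walk_iff.1 hz).1, (walk_iff.1 hπ).1, (walk_iff.1 hν).1,
      (coacc_iff q2).2 hy, digits_eq, hπd, hνd, hzl, List.length_map, Bool.true_and, decide_true,
      Bool.true_eq_false, not_false_eq_true]
  cases hg with
  | @int q0 q1 q2 z π ν s u v h0 hz lz hπ lπ hν lν hy hN =>
    have hzl : z.length = m + 1 := by rw [← labels_length, lz]; simp
    have hπl : π.length = u.length * m := by
      rw [← labels_length, lπ, List.length_map, length_flat]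
    have hνl : ν.length = v.length * m := by
      rw [← labels_length, lν, List.length_map, length_flat]
    have hN' := Nat.mul_le_mul_right m hN
    rw [add_mul, ← hπl, ← hνl] at hN'
    have a1 : π.length ≤ (inpCode m c).len := mul_add_one_le_len hT (by omega) (by omega)
    have a2 : ν.length ≤ (inpCode m c).len := mul_add_one_le_len hT (x := ν.length) (by omega) (by omega)
    have ht := key h0 hz hπ hν hy hzl a1 a2
      (by rw [lπ, digits_map_some, length_flat]; exact dvd_mul_left _ _)
      (by rw [hνl]; exact dvd_mul_left _ _)
    rw [testGen_iff hm hβ hα (pathVec_map false (u := []) lz (l := u) (by simpa using lπ) (by omega))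
      (by
        rw [← List.map_append]
        exact pathVec_map false (u := []) lz (l := u ++ v)
          (by rw [labels_append, lπ, lν, flat_append]; simp) (by rw [List.length_append]; omega))]
      at ht
    simpa using ht
  | @frac q0 q1 q2 z π ν s l u v h0 hz lz hπ lπ hν lν hy hN =>
    have hzl : z.length = m + 1 := by rw [← labels_length, lz]; simp
    have hπl : π.length = (l.length + u.length) * m + 1 := by
      rw [← labels_length, lπ, List.length_append, List.length_cons, List.length_map,
        List.length_map, length_flat, length_flat]
      ring
    have hνl : ν.length = v.length * m := by
      rw [← labels_length, lν, List.length_map, length_flat]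
    have hN' := Nat.mul_le_mul_right m hN
    rw [← add_assoc, add_mul, ← hνl] at hN'
    have a1 : π.length ≤ (inpCode m c).len :=
      mul_add_one_le_len hT (x := (l.length + u.length) * m) (by omega) (by omega)
    have a2 : ν.length ≤ (inpCode m c).len := mul_add_one_le_len hT (x := ν.length) (by omega) (by omega)
    have ht := key h0 hz hπ hν hy hzl a1 a2
      (by
        rw [lπ, digits_map_some_append, ← flat_append, length_flat]
        exact dvd_mul_left _ _)
      (by rw [hνl]; exact dvd_mul_left _ _)
    rw [testGen_iff hm hβ hα (pathVec_map true (l := l) (u := u) lz (by simpa using lπ) (by omega))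
      (by
        rw [← List.map_append]
        exact pathVec_map true lz (l := l) (u := u ++ v)
          (by rw [labels_append, lπ, lν, flat_append]; simp) (by rw [List.length_append]; omega))]
      at ht
    simpa using ht

theorem length_le_length_flat (hm : 1 ≤ m) (l : List (Fin m → Fin r)) :
    l.length ≤ (flat l).length := by
  rw [length_flat]
  exact Nat.le_mul_of_pos_right _ hm

/-- A functional that is nonpositive on the generators of bounded length passes all tests. -/
theorem valid_of_nonpos (hm : 1 ≤ m) (hT : m ≤ c.trans.length) (hA : c.toMuller.IsArithmetic m)
    {β : Bool × Bits} {α : Fin m → Bool × Bits} (hβ : β ∈ (pad (inpCode m c)).coeffs)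
    (hα : ∀ i, α i ∈ (pad (inpCode m c)).coeffs)
    (H : ∀ V h, IsGen c.toMuller m (2 * (inpCode m c).len) V h →
      ∑ i, cval (α i) * V i + cval β * h ≤ 0) :
    valid (pad (inpCode m c)) (β :: List.ofFn α) = true := by
  simp only [valid, List.all_eq_true, Bool.or_eq_true, Bool.not_eq_true']
  intro q0 h0 q1 h1 q2 h2 z hz π hπ ν hν
  obtain ⟨q0, h0', rfl⟩ : ∃ q : Fin n, q ∈ c.init ∧ (q : ℕ).bits = q0 := List.mem_map.1 h0
  obtain ⟨e1, -, rfl⟩ := mem_states.1 h1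
  obtain ⟨e2, -, rfl⟩ := mem_states.1 h2
  obtain ⟨z, rfl, -, hz⟩ := mem_paths.1 hz
  obtain ⟨π, rfl, lπ, hπ⟩ := mem_paths.1 hπ
  obtain ⟨ν, rfl, lν, hν⟩ := mem_paths.1 hν
  rw [← Bool.not_eq_true, ← imp_iff_not_or]
  intro hg
  simp only [isGenPath, pad_dim hT, Bool.and_eq_true, decide_eq_true_eq, coacc_iff, digits_eq,
    List.length_map] at hg
  obtain ⟨g1, g2, g3, hzl, hπd, hνd, y, hy⟩ := hg
  have g1 := walk_iff.2 ⟨g1, hz⟩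
  have g2 := walk_iff.2 ⟨g2, hπ⟩
  have g3 := walk_iff.2 ⟨g3, hν⟩
  -- The cycle is run twice: a separator inside it would then be read twice after the sign word,
  -- which an arithmetic automaton does not allow.
  have hw := mem_language_iff.2 ⟨q0, h0', g1.accepts (g2.accepts (g3.accepts (g3.accepts hy)))⟩
  obtain ⟨s, k, σ, w, -, hw⟩ := hA _ hw
  rw [msdWord_eq_word] at hw
  generalize List.ofFn σ = l at hw
  obtain ⟨lz, hw⟩ := append_stream_inj (by rw [labels_length, hzl]; simp) hw
  rcases append_eq_some_append hw with ⟨d1, d2, hd, hx, hw⟩ | ⟨e, w', hx, hw⟩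
  -- The divisibility tests guarantee that the digits read form whole blocks.
  · obtain ⟨u, rfl⟩ := exists_flat_of_dvd (m := m) (d := d1) (by rwa [hx, digits_map_some] at hπd)
    rcases append_eq_some_append hw with ⟨d3, d4, -, hx', -⟩ | ⟨e, w', hx', hw⟩
    · obtain ⟨v, rfl⟩ := exists_flat_of_dvd (m := m) (d := d3)
        (by rwa [← labels_length, hx', List.length_map] at hνd)
      have a1 : (flat u).length = π.length := by rw [← labels_length, hx, List.length_map]
      have a2 : (flat v).length = ν.length := by rw [← labels_length, hx', List.length_map]
      have a3 := length_le_length_flat hm u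
      have a4 := length_le_length_flat hm v
      rw [testGen_iff hm hβ hα (pathVec_map false (u := []) lz (l := u) (by simpa using hx) (by omega))
        (by
          rw [← List.map_append]
          exact pathVec_map false (u := []) lz (l := u ++ v)
            (by rw [labels_append, hx, hx', flat_append]; simp) (by rw [List.length_append]; omega))]
      simpa using H _ _ (IsGen.int h0' g1 lz g2 hx g3 hx' ⟨y, hy⟩ (by omega))
    · obtain ⟨d, w'', h1, -⟩ := append_eq_map hw
      have : none ∈ d.map (some : Fin r → Option (Fin r)) := by rw [← h1, hx']; simp
      simp at this
  · obtain ⟨d, w'', hx', -⟩ := append_eq_map hw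
    rw [hx, digits_map_some_append, List.length_append, length_flat] at hπd
    obtain ⟨u, rfl⟩ := exists_flat_of_dvd (m := m) (d := e) ((Nat.dvd_add_right (dvd_mul_left _ _)).1 hπd)
    obtain ⟨v, rfl⟩ := exists_flat_of_dvd (m := m) (d := d)
      (by rwa [← labels_length, hx', List.length_map] at hνd)
    have a1 : (flat l).length + (flat u).length + 1 = π.length := by
      rw [← labels_length, hx, List.length_append, List.length_cons, List.length_map,
        List.length_map, add_assoc]
    have a2 : (flat v).length = ν.length := by rw [← labels_length, hx', List.length_map]
    have a3 := length_le_length_flat hm u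
    have a4 := length_le_length_flat hm v
    have a5 := length_le_length_flat hm l
    rw [testGen_iff hm hβ hα (pathVec_map true (l := l) (u := u) lz (by simpa using hx) (by omega))
      (by
        rw [← List.map_append]
        exact pathVec_map true lz (l := l) (u := u ++ v)
          (by rw [labels_append, hx, hx', flat_append]; simp) (by rw [List.length_append]; omega))]
    simpa using H _ _ (IsGen.frac h0' g1 lz g2 hx g3 hx' ⟨y, hy⟩ (by omega))

/-- The enumerated coefficients have up to `coeffLen` + 1 bits; they reach the bound required by
`closure_convexHull_eq` for N = 2 `len`. -/
theorem bound_lt (hT : m ≤ c.trans.length) :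
    (m + 1).factorial * (2 * r ^ (2 * (inpCode m c).len)) ^ (m + 1) <
      2 ^ ((inpCode m c).coeffLen + 1) := by
  have hp := par_eq (m := m) (c := c)
  have h1 : (m + 1).factorial ≤ 2 ^ ((inpCode m c).par * (m + 1)) := by
    rw [pow_mul]
    refine (Nat.factorial_le_pow _).trans (Nat.pow_le_pow_left ?_ _)
    exact (show m + 1 ≤ (inpCode m c).par by omega).trans Nat.lt_two_pow_self.le
  have h2 : (2 * r ^ (2 * (inpCode m c).len)) ^ (m + 1) ≤
      2 ^ ((1 + (inpCode m c).par * (2 * (inpCode m c).len)) * (m + 1)) := by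
    rw [pow_mul 2 (1 + _), pow_add 2 1, pow_mul 2 (inpCode m c).par, pow_one]
    exact Nat.pow_le_pow_left (Nat.mul_le_mul_left _ (Nat.pow_le_pow_left base_le _)) _
  refine (Nat.mul_le_mul h1 h2).trans_lt ?_
  rw [← pow_add]
  refine Nat.pow_lt_pow_right (by norm_num) (Nat.lt_succ_of_le ?_)
  rw [← add_mul, Inp.coeffLen, mul_comm]
  refine Nat.mul_le_mul (by omega) (le_of_eq_of_le (b := (inpCode m c).par + 1 +
    2 * (inpCode m c).len * (inpCode m c).par) (by ring) (by omega))

end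
open Enc MullerAutomaton

/-! ### The output for codes of automata, including the case of an empty set -/

section
variable {r n m : ℕ} {c : AutomatonCode r n}

/-- If there are fewer transitions than sign digits, then no word is accepted. -/
theorem represented_eq_empty (hm : 1 ≤ m) (hT : c.trans.length < m)
    (hA : c.toMuller.IsArithmetic m) : c.toMuller.represented m = ∅ := by
  by_contra! hne
  obtain ⟨-, s, k, σ, w, -, hw, -⟩ := hne
  rw [msdWord_eq_word, word, Stream'.append_append_stream] at hw
  obtain ⟨q0, h0, hw⟩ := mem_language_iff.1 hw
  obtain ⟨l, q1, hl, ll, hw⟩ := hw.split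
  have hlm : l.length = m := by rw [← labels_length, ll]; simp
  -- The path reading the m sign digits has a shortcut with fewer than m transitions, still labelled
  -- by digits. The automaton would then accept a word whose first separator comes too early.
  obtain ⟨l', hl', -, hlen, hsub⟩ := hl.shorten_length (E := c.trans)
    (by rintro rfl; simp at hlm; omega) (fun e he => he)
  obtain ⟨d, hd⟩ : ∃ d : List (Fin r), labels l' = d.map some := by
    obtain ⟨d, hd, -⟩ := (exists_eq_map (f := some) (L := List.ofFn s) (l := labels l')).1 (by
      intro x hx
      rw [← ll]
      obtain ⟨e, he, rfl⟩ := List.mem_map.1 hx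
      exact List.mem_map_of_mem (hsub he))
    exact ⟨d, hd⟩
  obtain ⟨s', k', σ', w', -, hw'⟩ := hA _ (mem_language_iff.2 ⟨q0, h0, hl'.accepts hw⟩)
  rw [msdWord_eq_word, word, Stream'.append_append_stream, hd] at hw'
  obtain ⟨d', h1, h2⟩ := some_append_eq hw'
  cases d' with
  | nil =>
    have h3 := congrArg List.length hd
    have h4 := congrArg List.length h1
    rw [labels_length, List.length_map] at h3
    simp only [List.length_ofFn, List.append_nil] at h4
    omega
  | cons b d' => exact absurd (congrFun h2 0).symm (Option.some_ne_none b)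

theorem enc_list {α : Type} [Enc α] (l : List α) : enc l = Data.ofList (l.map enc) := rfl

theorem enc_pair {α β : Type} [Enc α] [Enc β] (p : α × β) :
    enc p = Data.cons (enc p.1) (enc p.2) := rfl

theorem mem_functionals {a : Pad} {φ : List (Bool × Bits)} : φ ∈ functionals a ↔
    φ.length = a.dim + 1 ∧ (∀ x ∈ φ, x ∈ a.coeffs) ∧ valid a φ = true := by
  simp only [functionals, List.mem_filter, mem_listsLE, Bool.and_eq_true, decide_eq_true_eq]
  constructor
  · rintro ⟨⟨-, h⟩, h1, h2⟩
    exact ⟨h1, h, h2⟩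
  · rintro ⟨h1, h, h2⟩
    exact ⟨⟨h1.le, h⟩, h1, h2⟩

theorem eq_cons_ofFn {α : Type*} {l : List α} (h : l.length = m + 1) (d : α) :
    l = l.headD d :: List.ofFn fun i : Fin m => l.tail.getD i d := by
  cases l with
  | nil => simp at h
  | cons x l =>
    have h' : l.length = m := by simpa using h
    subst h'
    simp

theorem enc_map_eq_ofSystem {α β : Type} [Enc β] {f : α → β} {L : List α}
    {M : Matrix (Fin L.length) (Fin m) ℚ} {v : Fin L.length → ℚ}
    (h : ∀ i, enc (f (L.get i)) = Data.cons (Data.ofList (List.ofFn fun j => Data.ofRat (M i j)))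
      (Data.ofRat (v i))) : enc (L.map f) = Data.ofSystem M v := by
  have e : L.map (fun x => enc (f x)) = List.ofFn fun i => enc (f (L.get i)) := by
    conv_lhs => rw [← List.ofFn_get L, List.map_ofFn]
    rfl
  rw [enc_list_map, e]
  simp only [h]
  rfl

theorem enc_row {a : Pad} {β : Bool × Bits} {α : Fin m → Bool × Bits} (hβ : β ∈ a.coeffs)
    (hα : ∀ i, α i ∈ a.coeffs) :
    enc ((β :: List.ofFn α).tail.map toRat, toRat ((β :: List.ofFn α).headD (false, []))) =
      Data.cons (Data.ofList (List.ofFn fun j => Data.ofRat (cval (α j) : ℤ)))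
        (Data.ofRat (cval β : ℤ)) := by
  have e : (List.ofFn α).map (fun x => enc (toRat x)) =
      List.ofFn fun j => Data.ofRat (cval (α j) : ℤ) := by
    rw [List.map_ofFn]
    congr 1
    funext j
    exact enc_toRat (hα j)
  rw [enc_pair, ← enc_toRat hβ, ← e, ← enc_list_map]
  rfl

/-- The output of the algorithm describes the closed convex hull. -/
theorem output_spec (hr : 2 ≤ r) (hm : 1 ≤ m) (hA : c.toMuller.IsArithmetic m) :
    ∃ (k : ℕ) (M : Matrix (Fin k) (Fin m) ℚ) (v : Fin k → ℚ),
      enc (output (pad (inpCode m c))) = Data.ofSystem M v ∧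
      closure (convexHull ℝ (c.toMuller.represented m)) = solutionSet M v := by
  have hcond : bval (pad (inpCode m c)).inp.par (pad (inpCode m c)).inp.2.1 = m := bval_par_dim
  have hlen : (pad (inpCode m c)).inp.trans.length = c.trans.length := List.length_map _
  rw [output, hcond, hlen]
  split_ifs with hT
  · set a := pad (inpCode m c) with ha
    set L := functionals a with hL
    have hmem (φ : List (Bool × Bits)) (hφ : φ ∈ L) : ∃ β α, φ = β :: List.ofFn α ∧ β ∈ a.coeffs ∧
        (∀ i : Fin m, α i ∈ a.coeffs) ∧ valid a φ = true := by
      obtain ⟨h1, h2, h3⟩ := mem_functionals.1 hφ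
      rw [pad_dim hT] at h1
      have e := eq_cons_ofFn h1 (false, [])
      have h2' : ∀ x ∈ φ.headD (false, []) :: List.ofFn fun i : Fin m => φ.tail.getD i (false, []),
          x ∈ a.coeffs := by
        rw [← e]
        exact h2
      exact ⟨_, _, e, h2' _ List.mem_cons_self,
        fun i => h2' _ (List.mem_cons_of_mem _ (List.mem_ofFn.2 ⟨i, rfl⟩)), h3⟩
    have hval (β : Bool × Bits) (α : Fin m → Bool × Bits) :
        rowVal m (β :: List.ofFn α) = (fun i => cval (α i), cval β) := by
      simp [rowVal]
    -- N = 2 `len`: a tested pair π, ν has at most `len` letters each, hence at most 2 `len` blocks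
    -- together.
    have hmain := closure_convexHull_eq hr hm hA (E := c.trans) (fun e he => he)
      (2 * (inpCode m c).len) {p | ∃ φ ∈ L, p = rowVal m φ} (by
        rintro _ ⟨φ, hφ, rfl⟩ V h hg
        obtain ⟨β, α, rfl, hβ, hα, hv⟩ := hmem φ hφ
        rw [hval]
        exact nonpos_of_valid hm hT hβ hα hv hg) (by
        rintro ⟨f, b⟩ hf hb H
        have hb' := bound_lt (r := r) (c := c) hT
        have hco (z : ℤ) (hz : |z| ≤ (((m + 1).factorial *
            (2 * r ^ (2 * (inpCode m c).len)) ^ (m + 1) : ℕ) : ℤ)) : ∃ x ∈ a.coeffs, cval x = z :=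
          exists_coeff (by
            have : (inpCode m c).coeffLen = a.inp.coeffLen := rfl
            rw [← this]
            rw [Int.abs_eq_natAbs] at hz
            omega)
        obtain ⟨β, hβ, rfl⟩ := hco b hb
        choose α hα hα' using fun i => hco (f i) (hf i)
        obtain rfl : (fun i => cval (α i)) = f := funext hα'
        refine ⟨β :: List.ofFn α, mem_functionals.2 ⟨?_, ?_, valid_of_nonpos hm hT hA hβ hα H⟩,
          (hval _ _).symm⟩
        · rw [pad_dim hT]; simp
        · rintro x (_ | ⟨_, hx⟩)
          · exact hβ
          · obtain ⟨i, rfl⟩ := List.mem_ofFn.1 hx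
            exact hα i)
    refine ⟨L.length, fun i j => ((rowVal m (L.get i)).1 j : ℤ), fun i => ((rowVal m (L.get i)).2 : ℤ),
      ?_, ?_⟩
    · refine enc_map_eq_ofSystem fun i => ?_
      obtain ⟨β, α, e, hβ, hα, -⟩ := hmem _ (List.get_mem L i)
      rw [e, hval]
      exact enc_row hβ hα
    · rw [hmain]
      ext x
      simp only [solutionSet, Set.mem_ofPred_eq, Rat.cast_intCast]
      constructor
      · intro h i
        exact h _ ⟨_, List.get_mem L i, rfl⟩
      · rintro h _ ⟨φ, hφ, rfl⟩
        obtain ⟨i, rfl⟩ := List.get_of_mem hφ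
        exact h i
  -- The single inequality 0·x + 1 ≤ 0 describes the empty set.
  · refine ⟨1, fun _ _ => 0, fun _ => 1, ?_, ?_⟩
    · have h0 : enc (toRat (false, [])) = Data.ofRat 0 := by
        simp [toRat, enc, Data.ofRat, Data.ofInt, Data.ofNat]
      have h1 : enc (toRat (false, [true])) = Data.ofRat 1 := by
        simp [toRat, enc, Data.ofRat, Data.ofInt, Data.ofNat]
      unfold Data.ofSystem
      rw [enc_list, List.map_singleton, enc_pair, h1, enc_list, List.map_replicate, h0]
      simp [List.ofFn_const]
    · rw [represented_eq_empty hm (by omega) hA, convexHull_empty, closure_empty]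
      ext x
      simp [solutionSet]

end

/-! ### Renaming the states of an arbitrary finite automaton -/

section
variable {r m : ℕ}

/-- Every Muller automaton has a code, up to the names of the states. -/
theorem exists_code {Q : Type*} [Finite Q] (A : MullerAutomaton (Letter r) Q) :
    ∃ (n : ℕ) (c : AutomatonCode r n), c.toMuller.language = A.language := by
  obtain ⟨n, ⟨e⟩⟩ := Finite.exists_equiv_fin Q
  refine ⟨n, ⟨((Set.toFinite A.trans).toFinset.toList).map fun t => (e t.1, t.2.1, e t.2.2),
    ((Set.toFinite A.init).toFinset.toList).map e,
    ((Set.toFinite A.acc).toFinset.toList).map fun F => ((Set.toFinite F).toFinset.toList).map e⟩, ?_⟩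
  ext w
  simp only [language, IsRun, Set.mem_ofPred_eq, AutomatonCode.toMuller, List.mem_map,
    Finset.mem_toList, Set.Finite.mem_toFinset]
  have hinf (ρ : ℕ → Q) : infSet (fun k => e (ρ k)) = e '' infSet ρ := by
    ext q
    simp only [infSet, Set.mem_ofPred_eq, Set.mem_image]
    constructor
    · intro h
      exact ⟨e.symm q, by simpa [← e.apply_eq_iff_eq] using h, by simp⟩
    · rintro ⟨p, h, rfl⟩
      simpa using h
  have hset (F : Set Q) : {q : Fin n | ∃ a ∈ F, e a = q} = e '' F := rfl
  constructor
  · rintro ⟨ρ, ⟨⟨q, hq, h0⟩, h⟩, l, ⟨F, hF, rfl⟩, hl⟩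
    obtain ⟨ρ, rfl⟩ : ∃ ρ' : ℕ → Q, ρ = fun k => e (ρ' k) := ⟨fun k => e.symm (ρ k), by simp⟩
    refine ⟨ρ, ⟨e.injective h0 ▸ hq, fun k => ?_⟩, ?_⟩
    · obtain ⟨⟨p, o, p'⟩, ht, he⟩ := h k
      simp only [Prod.mk.injEq, EmbeddingLike.apply_eq_iff_eq] at he
      obtain ⟨rfl, rfl, rfl⟩ := he
      exact ht
    · rw [hinf] at hl
      simp only [List.mem_map, Finset.mem_toList, Set.Finite.mem_toFinset] at hl
      rw [hset] at hl
      rwa [e.injective.image_injective hl]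
  · rintro ⟨ρ, ⟨h0, h⟩, hF⟩
    refine ⟨fun k => e (ρ k), ⟨⟨_, h0, rfl⟩, fun k => ⟨_, h k, rfl⟩⟩, _, ⟨_, hF, rfl⟩, ?_⟩
    rw [hinf]
    simp only [List.mem_map, Finset.mem_toList, Set.Finite.mem_toFinset]
    rfl

end
end ArithAutomata

open ArithAutomata
theorem mainTheorem1 :
    (∀ (r m : ℕ), 2 ≤ r → 1 ≤ m →
      ∀ (Q : Type*) [Finite Q] (A : MullerAutomaton (Letter r) Q), A.IsArithmetic m →
        IsRationalPolyhedral (closure (convexHull ℝ (A.represented m)))) ∧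
    (∃ (P : Prog) (p : Polynomial ℕ), ∀ (r m : ℕ), 2 ≤ r → 1 ≤ m →
      ∀ (n : ℕ) (c : AutomatonCode r n), c.toMuller.IsArithmetic m →
        ∃ (k : ℕ) (M : Matrix (Fin k) (Fin m) ℚ) (v : Fin k → ℚ) (t : ℕ),
          Eval P (c.toData m) (Data.ofSystem M v) t ∧
          t ≤ 2 ^ p.eval (c.toData m).size ∧
          closure (convexHull ℝ (c.toMuller.represented m)) = solutionSet M v) := by
  refine ⟨fun r m hr hm Q _ A hA => ?_, ?_⟩
  · obtain ⟨n, c, hc⟩ := exists_code A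
    have hA' : c.toMuller.IsArithmetic m := by
      unfold MullerAutomaton.IsArithmetic
      rw [hc]
      exact hA
    have hX : A.represented m = c.toMuller.represented m := by
      unfold MullerAutomaton.represented
      rw [hc]
    obtain ⟨k, M, v, -, h⟩ := output_spec hr hm hA'
    exact ⟨k, M, v, hX ▸ h⟩
  · obtain ⟨P, p, hP⟩ := exists_prog_of_pad PT_output
    refine ⟨P, p, fun r m hr hm n c hA => ?_⟩
    obtain ⟨k, M, v, h1, h2⟩ := output_spec hr hm hA
    obtain ⟨t, h3, h4⟩ := hP (inpCode m c)
    refine ⟨k, M, v, t, ?_, ?_, h2⟩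
    · rwa [← enc_inpCode, ← h1]
    · rwa [← enc_inpCode]
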